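/- Conventions. Let $B_n$ be the braid group on $n$ strands with standard generators $\sigma_1,\dots,\sigma_{n-1}$ (Artin presentation), $\mu_n\colon B_n\to S_n$ the homomorphism with $\sigma_i\mapsto(i,i+1)$, $e\colon B_n\to\mathbb Z$ the exponent sum homomorphism ($\sigma_i\mapsto 1$), $B_n^+\subset B_n$ the monoid of positive braids (products of the $\sigma_i$), and $\Delta=\Delta_n=\prod_{i=1}^{n-1}\prod_{j=1}^{n-i}\sigma_j$. A *permutation braid* is a braid represented by a diagram in which all crossings are positive and any two strands cross at most once. The *projective closure* of a braid is the link in $\mathbb{RP}^3$, defined up to isotopy, represented by a diagram of the braid placed in a disk with the endpoints of the strands symmetrically on the boundary circle: the diagram gives a tangle in the 3-ball with endpoints on the equator, and opposite points of the boundary sphere are identified. For integers $p\ge q\ge 0$ with $p\equiv q \pmod 2$ the *projective torus link* is $$T_{\mathrm{proj}}(p,q)=\{(z,w)\in\mathbb C^2 : z^p=w^q,\ |z|^2+|w|^2=2\}/(-1)\ \subset\ (\mathbb C^2\setminus 0)/\mathbb R^\times=\mathbb{RP}^3 .$$ A knot is a link with exactly one component. Links are considered up to ambient isotopy in $\mathbb{RP}^3$.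 Theorem. Let $d\ge 2$ be an integer and $N_d=(d-1)(d-2)/2$. (a) Let $X$ be a permutation $d$-braid with $e(X)=N_d$. The projective closure of $X$ is a knot if and only if $\mu_d(X\Delta_d)$ is a $d$-cycle. If the projective closure of $X$ is a knot, then it is isotopic to $T_{\mathrm{proj}}(d,d-2)$. (b) Let $X$ be a $(d-2)$-braid such that $e(X)=N_d-1$ and $X=\Delta_{d-2} A$ for some $A\in B^+_{d-2}$. If the projective closure of $X$ is a knot, then it is isotopic to $T_{\mathrm{proj}}(d,d-2)$. -/

import Mathlib

open scoped LinearAlgebra.Projectivization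

noncomputable section

namespace ProjBraid

/-! ### Real projective space, isotopy, knots, projective torus links -/

/-- The real projective space `ℝP³ = (ℂ² ∖ 0) / ℝˣ`. -/
abbrev RP3 : Type := ℙ ℝ (ℂ × ℂ)

/-- `ℝP³` carries the quotient topology of `ℂ² ∖ 0`. -/
instance instTopologicalSpaceRP3 : TopologicalSpace RP3 :=
  inferInstanceAs (TopologicalSpace (Quotient (projectivizationSetoid ℝ (ℂ × ℂ))))

/-- Ambient isotopy of subsets of a space: a continuous family of self-homeomorphisms `H t`,
`0 ≤ t ≤ 1`, that starts at the identity and such that `H 1` carries `L` onto `L'`. -/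
def AmbientIsotopic {Y : Type*} [TopologicalSpace Y] (L L' : Set Y) : Prop :=
  ∃ H : unitInterval → (Y ≃ₜ Y), Continuous (fun x : unitInterval × Y => H x.1 x.2) ∧
    H 0 = Homeomorph.refl Y ∧ (H 1 : Y → Y) '' L = L'

/-- A link is a knot if it has exactly one connected component. -/
def IsKnot (L : Set RP3) : Prop := IsConnected L

/-- The projective torus link `T(p,q) / (-1)`, where
`T(p,q) = {(z,w) | z ^ p = w ^ q}` in the sphere of radius `√2` in `ℂ²`. -/
def Tproj (p q : ℕ) : Set RP3 :=
  {x | ∃ (z w : ℂ) (h : (z, w) ≠ 0),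
    ‖z‖ ^ 2 + ‖w‖ ^ 2 = 2 ∧ z ^ p = w ^ q ∧ x = Projectivization.mk ℝ (z, w) h}

/-! ### The braid group

The `n - 1` standard generators of the braid group on `n` strands are indexed by `Fin (n - 1)`,
from `0`, and the strand positions by `Fin n`: the generator with index `i` crosses the strands
in the positions `i` and `i + 1`. -/

/-- The position `i` of the generator with index `i`. -/
def lo {n : ℕ} (i : Fin (n - 1)) : Fin n := ⟨i, by omega⟩

/-- The position `i + 1` of the generator with index `i`. -/
def hi {n : ℕ} (i : Fin (n - 1)) : Fin n := ⟨i + 1, by omega⟩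

/-- The Artin relations: `σ_i σ_j = σ_j σ_i` for `j ≥ i + 2`, and
`σ_i σ_j σ_i = σ_j σ_i σ_j` for `j = i + 1`. -/
def artinRels (n : ℕ) : Set (FreeGroup (Fin (n - 1))) :=
  {r | ∃ i j : Fin (n - 1), (i : ℕ) + 2 ≤ j ∧
      r = (FreeGroup.of i * FreeGroup.of j) * (FreeGroup.of j * FreeGroup.of i)⁻¹} ∪
  {r | ∃ i j : Fin (n - 1), (i : ℕ) + 1 = j ∧
      r = (FreeGroup.of i * FreeGroup.of j * FreeGroup.of i) *
        (FreeGroup.of j * FreeGroup.of i * FreeGroup.of j)⁻¹}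

/-- The braid group on `n` strands. -/
abbrev BraidGroup (n : ℕ) : Type := PresentedGroup (artinRels n)

/-- The standard generators. -/
def sigma {n : ℕ} (i : Fin (n - 1)) : BraidGroup n := PresentedGroup.of i

/-- A braid word: `(i, true)` is the generator with index `i`, `(i, false)` its inverse. -/
abbrev BraidWord (n : ℕ) : Type := List (Fin (n - 1) × Bool)

/-- The braid represented by a word, read from left to right. -/
def BraidWord.toBraid {n : ℕ} (w : BraidWord n) : BraidGroup n :=
  PresentedGroup.mk (artinRels n) (FreeGroup.mk w)

theorem exponentSum_rels (n : ℕ) : ∀ r ∈ artinRels n,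
    FreeGroup.lift (fun _ : Fin (n - 1) => Multiplicative.ofAdd (1 : ℤ)) r = 1 := by
  rintro r (⟨i, j, _, rfl⟩ | ⟨i, j, _, rfl⟩) <;> simp

/-- The exponent sum homomorphism; every generator goes to `1`. -/
def exponentSumHom (n : ℕ) : BraidGroup n →* Multiplicative ℤ :=
  PresentedGroup.toGroup (exponentSum_rels n)

/-- The exponent sum of a braid, as an integer. -/
def exponentSum {n : ℕ} (X : BraidGroup n) : ℤ := Multiplicative.toAdd (exponentSumHom n X)

theorem perm_rels (n : ℕ) : ∀ r ∈ artinRels n,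
    FreeGroup.lift (fun i : Fin (n - 1) => Equiv.swap (lo i) (hi i)) r = 1 := by
  rintro r (⟨i, j, h, rfl⟩ | ⟨i, j, h, rfl⟩)
  all_goals
    simp only [map_mul, map_inv, FreeGroup.lift_apply_of, mul_inv_eq_one]
    ext x
    have hi' := i.2
    have hj' := j.2
    have hx' := x.2
    simp only [Equiv.Perm.mul_apply, Equiv.swap_apply_def, lo, hi, Fin.ext_iff]
    grind

/-- The standard homomorphism to the symmetric group;
the generator with index `i` goes to the transposition of `i` and `i + 1`. -/
def perm (n : ℕ) : BraidGroup n →* Equiv.Perm (Fin n) :=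
  PresentedGroup.toGroup (perm_rels n)

/-- The monoid of positive braids: products of standard generators. -/
def positiveBraids (n : ℕ) : Submonoid (BraidGroup n) :=
  Submonoid.closure (Set.range sigma)

/-- The Garside element `Δ = ∏_{i=1}^{n-1} ∏_{j=1}^{n-i} σ_j`
(the indices below are lower by one). -/
def garside (n : ℕ) : BraidGroup n :=
  ((List.range (n - 1)).map fun i =>
    (((List.finRange (n - 1)).take (n - 1 - i)).map sigma).prod).prod

/-- The list of the unordered pairs of strands that cross, crossing by crossing, in the diagram of
a positive word; `a p` is the strand that is in position `p` at the beginning of the diagram. -/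
def crossings {n : ℕ} : Equiv.Perm (Fin n) → List (Fin (n - 1)) → List (Sym2 (Fin n))
  | _, [] => []
  | a, i :: w => s(a (lo i), a (hi i)) :: crossings (a * Equiv.swap (lo i) (hi i)) w

/-- A permutation braid is a braid represented by a diagram all of whose crossings are positive
and any two strands of which cross at most once. -/
def IsPermutationBraid {n : ℕ} (X : BraidGroup n) : Prop :=
  ∃ w : List (Fin (n - 1)), (crossings 1 w).Nodup ∧ (w.map sigma).prod = X

/-! ### Geometric braids and their closures in `ℝP³` -/

/-- The standard positions `-(n-1), -(n-3), …, n-1` on the real line, symmetric about `0`. -/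
def pos {n : ℕ} (k : Fin n) : ℂ := 2 * (k : ℂ) - ((n : ℂ) - 1)

/-- The motion of the points of one letter during the time interval `[0,1]`: the points in the
positions `i` and `i + 1` make a half-turn about their midpoint, counterclockwise for a generator
and clockwise for its inverse; the other points rest. `k` is the position at the start. -/
def letterStrand {n : ℕ} (l : Fin (n - 1) × Bool) (k : Fin n) (t : ℝ) : ℂ :=
  let c : ℂ := (pos (lo l.1) + pos (hi l.1)) / 2
  if k = lo l.1 ∨ k = hi l.1 then
    c + (pos k - c) *
      Complex.exp ((((if l.2 then 1 else -1) * Real.pi * Real.smoothTransition t : ℝ) : ℂ) *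
        Complex.I)
  else pos k

/-- The strand, starting in position `k`, of the geometric braid of a word. The `j`-th letter
(from `0`) is performed in the time interval `[j, j+1]`; after the last letter all points rest. -/
def strand {n : ℕ} : BraidWord n → Fin n → ℝ → ℂ
  | [], k, _ => pos k
  | l :: w, k, t =>
    if t ≤ 1 then letterStrand l k t
    else strand w (Equiv.swap (lo l.1) (hi l.1) k) (t - 1)

theorem exp_pair_ne_zero (a v : ℂ) : ((Complex.exp a, v) : ℂ × ℂ) ≠ 0 := fun h =>
  Complex.exp_ne_zero a (congrArg Prod.fst h)

/-- The closure in `ℝP³` of the geometric braid of a word. The time interval `[0, m + 1]`, where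
`m` is the length of the word, is mapped linearly to angles `θ` in `[0, π]`, and the point `v` of a
strand at the angle `θ` gives the point `[exp (iθ) : v]`.

In the affine chart of points `[z : v]` with `Im z > 0`, oriented by the coordinates
`(-Re z, Re v, Im v) / Im z`, the first coordinate `-cot θ` increases from `-∞` to `∞`, and the
projection that forgets `Im v` is the diagram of the word, drawn in a disk with the endpoints of
the strands on the boundary; the relation `[exp (iπ) : v] = [exp (i0) : -v]` identifies opposite
points of the boundary. Generators give positive crossings. -/
def projClosure {n : ℕ} (w : BraidWord n) : Set RP3 :=
  {x | ∃ k : Fin n, ∃ t ∈ Set.Icc (0 : ℝ) (w.length + 1),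
    x = Projectivization.mk ℝ
      (Complex.exp (((Real.pi * t / (w.length + 1) : ℝ) : ℂ) * Complex.I), strand w k t)
      (exp_pair_ne_zero _ _)}

/-- `L` is a projective closure of the braid `X`: it is isotopic to the link in `ℝP³` given by
the diagram of some word that represents `X`. -/
def IsProjectiveClosure {n : ℕ} (X : BraidGroup n) (L : Set RP3) : Prop :=
  ∃ w : BraidWord n, w.toBraid = X ∧ AmbientIsotopic (projClosure w) L

/-- `N_d = (d-1)(d-2)/2`, used for `d ≥ 2` only. -/
def numN (d : ℕ) : ℕ := (d - 1) * (d - 2) / 2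

end ProjBraid

end

/-!
In the frame of `ℂ²` that makes a half-turn with the angle of `z`, the points of a braid are given by
the coordinate `w / z`, which is invariant under real scalings. A projective closure of a braid `X`
is thus the link in `ℝP³` swept out by a closed motion of `n` points of `ℂ`, and this motion has the
class of `X Δ⁻¹`, because a half-turn of the frame is undone by `Δ⁻¹` (`mk_untwist`,
`closes_of_isProjectiveClosure`). The link depends only on the homotopy class of the motion, by an
isotopy extension theorem (`ambientIsotopic_twLink_of_homotopy`): the homotopy is cut into small
steps, and a small displacement of the points is extended to `ℂ` by cone-shaped bumps, as a map with
a Lipschitz constant less than `1`. A quarter-turn of the frame shows that the link depends only on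
the conjugacy class of the motion (`Closes.conj`).

Hence `X` may be replaced by any conjugate of `X Δ⁻¹`. In the first part `X` is a permutation braid,
so that `Δ = X Y` for a positive word `Y` of `d(d-1)/2 - N_d = d - 1` letters, and `X Δ⁻¹` is conjugate
to `Y⁻¹`. In the second part `X Δ⁻¹ = Δ A Δ⁻¹` is conjugate to `A`, a positive word of `d - 3` letters
on `n = d - 2` strands. In both cases there is a positive word of `n - 1` letters on `n` strands. The
components of the link are the orbits of its permutation (`Closes.sameCycle`, `Closes.isKnot`), and
if this is transitive, then every generator occurs exactly once (`perm_finRange_of_sameCycle`). All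
such words are conjugate to `δ = σ_0 ⋯ σ_{n-2}` (`exists_conj_prod`). The motion of `δ` is homotopic to
the rotation of `n` equidistant points of a circle by `2π / n`, whose link consists of the points
with `(w / z) ^ n = z ^ 2`, which is `T(n + 2, n)` (`twLink_rotation_eq`). For `δ⁻¹` the rotation is
reversed, which gives `(w / z) ^ n = z ^ (-2)`, that is `T(n - 2, n)`, and the exchange of `z` and `w`,
which is isotopic to the identity, turns this into `T(n, n - 2)`
(`ambientIsotopic_rotation_reverse`).

The equalities of classes of positive braids, the Artin relations among them, come from one
contractibility statement. A motion whose points stay in the order in which none is vertically below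
one with a smaller label is determined by its endpoints up to homotopy, because the set of such
configurations is star-shaped (`homotopic_of_ascending`); and the words in which any two strands
cross at most once have motions of this kind (`ascending_strand`, `ascWord_one_of_nodup`).
-/

noncomputable section

namespace ProjBraid

/-! ### Ambient isotopy is an equivalence relation -/

theorem AmbientIsotopic.refl {Y : Type*} [TopologicalSpace Y] (L : Set Y) : AmbientIsotopic L L :=
  ⟨fun _ => Homeomorph.refl Y, continuous_snd, rfl, by simp⟩

theorem AmbientIsotopic.symm {Y : Type*} [TopologicalSpace Y] {L L' : Set Y}
    (h : AmbientIsotopic L L') : AmbientIsotopic L' L := by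
  obtain ⟨H, hc, h0, h1⟩ := h
  refine ⟨fun t => (H 1).symm.trans (H (unitInterval.symm t)), ?_, ?_, ?_⟩
  · exact hc.comp ((unitInterval.continuous_symm.comp continuous_fst).prodMk
      ((H 1).symm.continuous.comp continuous_snd))
  · ext y; simp
  · rw [← h1]
    ext y
    simp [h0]

theorem AmbientIsotopic.trans {Y : Type*} [TopologicalSpace Y] {L L' L'' : Set Y}
    (h : AmbientIsotopic L L') (h' : AmbientIsotopic L' L'') : AmbientIsotopic L L'' := by
  obtain ⟨H, hc, h0, h1⟩ := h
  obtain ⟨K, kc, k0, k1⟩ := h'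
  -- run `H` at double speed on the first half, then `K` after `H 1` on the second half
  refine ⟨fun t => (H (Set.projIcc 0 1 zero_le_one (2 * (t : ℝ)))).trans
    (K (Set.projIcc 0 1 zero_le_one (2 * (t : ℝ) - 1))), ?_, ?_, ?_⟩
  · have c1 : Continuous fun x : unitInterval × Y =>
        Set.projIcc (0 : ℝ) 1 zero_le_one (2 * (x.1 : ℝ)) :=
      continuous_projIcc.comp (by fun_prop)
    have c2 : Continuous fun x : unitInterval × Y =>
        Set.projIcc (0 : ℝ) 1 zero_le_one (2 * (x.1 : ℝ) - 1) :=
      continuous_projIcc.comp (by fun_prop)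
    exact kc.comp (c2.prodMk (hc.comp (c1.prodMk continuous_snd)))
  · have e1 : Set.projIcc (0 : ℝ) 1 zero_le_one (2 * ((0 : unitInterval) : ℝ)) = 0 := by
      simp
    have e2 : Set.projIcc (0 : ℝ) 1 zero_le_one (2 * ((0 : unitInterval) : ℝ) - 1) = 0 :=
      Set.projIcc_of_le_left _ (by simp)
    ext y
    simp only [e1, e2, h0, k0, Homeomorph.trans_apply, Homeomorph.refl_apply, id]
  · have e1 : Set.projIcc (0 : ℝ) 1 zero_le_one (2 * ((1 : unitInterval) : ℝ)) = 1 :=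
      Set.projIcc_of_right_le _ (by norm_num)
    have e2 : Set.projIcc (0 : ℝ) 1 zero_le_one (2 * ((1 : unitInterval) : ℝ) - 1) = 1 :=
      Set.projIcc_of_right_le _ (by norm_num)
    simp only [e1, e2]
    rw [← k1, ← h1, Set.image_image]
    rfl

theorem AmbientIsotopic.isConnected_iff {Y : Type*} [TopologicalSpace Y] {L L' : Set Y}
    (h : AmbientIsotopic L L') : IsConnected L ↔ IsConnected L' := by
  obtain ⟨H, -, -, h1⟩ := h
  rw [← h1, (H 1).isConnected_image]

/-! ### The topology of real projective space -/

theorem exists_eq_mk (x : RP3) : ∃ v, ∃ hv : v ≠ 0, x = Projectivization.mk ℝ v hv :=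
  Projectivization.ind (P := fun x => ∃ v, ∃ hv : v ≠ 0, x = Projectivization.mk ℝ v hv)
    (fun v hv => ⟨v, hv, rfl⟩) x

/-- The topology of `ℝP³` is by definition the quotient topology; the quotient map is open since it
is the quotient by a group of homeomorphisms. -/
theorem isOpenQuotientMap_mk' :
    IsOpenQuotientMap (Projectivization.mk' ℝ : {v : ℂ × ℂ // v ≠ 0} → RP3) := by
  refine ⟨Quotient.mk_surjective, continuous_quot_mk, fun U hU => ?_⟩
  -- the saturation of `U` is the union of its images under the scalings
  have key : (Projectivization.mk' ℝ : {v : ℂ × ℂ // v ≠ 0} → RP3) ⁻¹'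
      (Projectivization.mk' ℝ '' U) =
      ⋃ r : ℝˣ, (fun v : {v : ℂ × ℂ // v ≠ 0} =>
        (⟨(r : ℝ) • v.1, smul_ne_zero r.ne_zero v.2⟩ : {v : ℂ × ℂ // v ≠ 0})) ⁻¹' U := by
    ext v
    simp only [Set.mem_preimage, Set.mem_image, Set.mem_iUnion]
    constructor
    · rintro ⟨u, hu, h⟩
      obtain ⟨a, ha⟩ := (Projectivization.mk_eq_mk_iff ℝ _ _ _ _).1 h
      exact ⟨a, by convert hu using 1; exact Subtype.ext ha⟩
    · rintro ⟨r, hr⟩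
      exact ⟨_, hr, (Projectivization.mk_eq_mk_iff ℝ _ _ _ _).2 ⟨r, rfl⟩⟩
  have : IsOpen ((Projectivization.mk' ℝ : {v : ℂ × ℂ // v ≠ 0} → RP3) ⁻¹'
      (Projectivization.mk' ℝ '' U)) := by
    rw [key]
    refine isOpen_iUnion fun r => hU.preimage ?_
    exact (continuous_subtype_val.const_smul (r : ℝ)).subtype_mk _
  exact this

theorem continuous_mk {X : Type*} [TopologicalSpace X] {f : X → ℂ × ℂ} (hf : Continuous f)
    (h0 : ∀ x, f x ≠ 0) : Continuous fun x => (Projectivization.mk ℝ (f x) (h0 x) : RP3) :=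
  isOpenQuotientMap_mk'.continuous.comp (hf.subtype_mk h0)

instance : CompactSpace RP3 := by
  have hS : IsCompact (Metric.sphere (0 : ℂ × ℂ) 1) := isCompact_sphere _ _
  have := isCompact_iff_compactSpace.1 hS
  have hne : ∀ v : Metric.sphere (0 : ℂ × ℂ) 1, (v : ℂ × ℂ) ≠ 0 := fun v h => by
    have := v.2
    rw [h] at this
    simp at this
  have hc := continuous_mk continuous_subtype_val hne
  have hr : Set.range (fun v : Metric.sphere (0 : ℂ × ℂ) 1 =>
      (Projectivization.mk ℝ (v : ℂ × ℂ) (hne v) : RP3)) = Set.univ := by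
    refine Set.eq_univ_of_forall fun x => ?_
    obtain ⟨v, hv, rfl⟩ := exists_eq_mk x
    refine ⟨⟨‖v‖⁻¹ • v, ?_⟩, ?_⟩
    · simp [norm_smul, hv]
    · exact (Projectivization.mk_eq_mk_iff' ℝ _ _ _ _).2 ⟨‖v‖⁻¹, rfl⟩
  exact ⟨hr ▸ isCompact_range hc⟩

/-- The square of the Euclidean norm of `ℂ²`. -/
def sqNorm (v : ℂ × ℂ) : ℝ := ‖v.1‖ ^ 2 + ‖v.2‖ ^ 2

theorem sqNorm_pos {v : ℂ × ℂ} (hv : v ≠ 0) : 0 < sqNorm v := by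
  by_contra h
  have h1 : ‖v.1‖ = 0 := by unfold sqNorm at h; nlinarith [sq_nonneg ‖v.1‖, sq_nonneg ‖v.2‖]
  have h2 : ‖v.2‖ = 0 := by unfold sqNorm at h; nlinarith [sq_nonneg ‖v.1‖, sq_nonneg ‖v.2‖]
  exact hv (Prod.ext (norm_eq_zero.1 h1) (norm_eq_zero.1 h2))

/-- The map `[z : w] ↦ (z², z w, w²) / (|z|² + |w|²)`, which embeds `ℝP³` in `ℂ³`. -/
def quadraticEmbedding : RP3 → ℂ × ℂ × ℂ :=
  Projectivization.lift (fun v => ((sqNorm v.1)⁻¹ • (v.1.1 ^ 2, v.1.1 * v.1.2, v.1.2 ^ 2)))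
    (by
      rintro ⟨-, ha⟩ ⟨b, hb⟩ t rfl
      have ht : t ≠ 0 := by rintro rfl; simp at ha
      have ht' : (t : ℂ) ≠ 0 := by exact_mod_cast ht
      have h : sqNorm (t • b) = t ^ 2 * sqNorm b := by
        simp [sqNorm, mul_pow]; ring
      have hb' : (sqNorm b : ℂ) ≠ 0 := by exact_mod_cast (sqNorm_pos hb).ne'
      simp only [h, Prod.smul_fst, Prod.smul_snd, Prod.smul_mk, Complex.real_smul, Prod.mk.injEq]
      push_cast
      refine ⟨?_, ?_, ?_⟩ <;> field_simp)

theorem continuous_quadraticEmbedding : Continuous quadraticEmbedding := by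
  rw [isOpenQuotientMap_mk'.isQuotientMap.continuous_iff]
  have h : Continuous fun v : {v : ℂ × ℂ // v ≠ 0} => sqNorm v.1 := by
    unfold sqNorm; fun_prop
  have h' : Continuous fun v : {v : ℂ × ℂ // v ≠ 0} => (sqNorm v.1)⁻¹ :=
    h.inv₀ fun v => (sqNorm_pos v.2).ne'
  exact h'.smul (by fun_prop : Continuous fun v : {v : ℂ × ℂ // v ≠ 0} =>
    (v.1.1 ^ 2, v.1.1 * v.1.2, v.1.2 ^ 2))

theorem quadraticEmbedding_injective : Function.Injective quadraticEmbedding := by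
  intro x y hxy
  obtain ⟨v, hv, rfl⟩ := exists_eq_mk x
  obtain ⟨w, hw, rfl⟩ := exists_eq_mk y
  have hv0 : (0 : ℝ) < sqNorm v := sqNorm_pos hv
  have hw0 : (0 : ℝ) < sqNorm w := sqNorm_pos hw
  -- the scaling factor, up to sign
  obtain ⟨c, hc, hc2⟩ : ∃ c : ℝ, c ≠ 0 ∧ c ^ 2 = sqNorm v / sqNorm w :=
    ⟨√(sqNorm v / sqNorm w), by positivity, Real.sq_sqrt (by positivity)⟩
  have hc' : (c : ℂ) ^ 2 * sqNorm w = sqNorm v := by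
    have : c ^ 2 * sqNorm w = sqNorm v := by rw [hc2]; field_simp
    exact_mod_cast this
  have hv' : (sqNorm v : ℂ) ≠ 0 := by exact_mod_cast hv0.ne'
  have hw' : (sqNorm w : ℂ) ≠ 0 := by exact_mod_cast hw0.ne'
  simp only [quadraticEmbedding, Projectivization.lift_mk, Prod.smul_mk, Complex.real_smul,
    Prod.mk.injEq] at hxy
  obtain ⟨h1, h2, h3⟩ := hxy
  push_cast at h1 h2 h3
  have scale : ∀ a b : ℂ, (sqNorm v : ℂ)⁻¹ * a = (sqNorm w : ℂ)⁻¹ * b → a = c ^ 2 * b := by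
    intro a b h
    rw [inv_mul_eq_iff_eq_mul₀ hv'] at h
    rw [h, ← hc']
    field_simp
  have h1 := scale _ _ h1
  have h2 := scale _ _ h2
  have h3 := scale _ _ h3
  rw [Projectivization.mk_eq_mk_iff']
  have hcc : (c : ℂ) ≠ 0 := by exact_mod_cast hc
  by_cases hz : w.1 = 0
  · have hvz : v.1 = 0 := by
      rw [hz] at h1; simpa using h1
    have : (v.2 - c * w.2) * (v.2 + c * w.2) = 0 := by linear_combination h3
    rcases mul_eq_zero.1 this with h | h
    · exact ⟨c, Prod.ext (by simp [hz, hvz])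
        (by simp only [Prod.smul_snd, Complex.real_smul]; linear_combination -h)⟩
    · exact ⟨-c, Prod.ext (by simp [hz, hvz])
        (by simp only [Prod.smul_snd, Complex.real_smul]; push_cast; linear_combination -h)⟩
  · have : (v.1 - c * w.1) * (v.1 + c * w.1) = 0 := by linear_combination h1
    rcases mul_eq_zero.1 this with h | h
    · have e1 : v.1 = c * w.1 := by linear_combination h
      refine ⟨c, Prod.ext (by simp [e1]) ?_⟩
      simp only [Prod.smul_snd, Complex.real_smul]
      rw [e1] at h2
      exact (mul_left_cancel₀ (mul_ne_zero hcc hz) (by linear_combination h2)).symm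
    · have e1 : v.1 = -c * w.1 := by linear_combination h
      refine ⟨-c, Prod.ext (by simp [e1]) ?_⟩
      simp only [Prod.smul_snd, Complex.real_smul]
      push_cast
      rw [e1] at h2
      exact (mul_left_cancel₀ (mul_ne_zero (neg_ne_zero.2 hcc) hz)
        (by linear_combination h2)).symm

instance : T2Space RP3 :=
  T2Space.of_injective_continuous quadraticEmbedding_injective continuous_quadraticEmbedding

/-! ### Isotopies from homogeneous families of maps -/

/-- A continuous family of bijections of `ℂ²` that commute with real scalings and start at the
identity induces an ambient isotopy of `ℝP³`; the continuity of the inverses is automatic since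
`ℝP³` is compact and Hausdorff. -/
theorem ambientIsotopic_of_family (Φ : unitInterval → ℂ × ℂ → ℂ × ℂ)
    (hc : Continuous fun x : unitInterval × (ℂ × ℂ) => Φ x.1 x.2)
    (hs : ∀ s (r : ℝ) v, Φ s (r • v) = r • Φ s v)
    (hb : ∀ s, Function.Bijective (Φ s)) (h0 : ∀ v, Φ 0 v = v) {L L' : Set RP3}
    (hL : ∀ v hv hv', (Projectivization.mk ℝ v hv : RP3) ∈ L ↔
      (Projectivization.mk ℝ (Φ 1 v) hv' : RP3) ∈ L') : AmbientIsotopic L L' := by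
  have hz : ∀ s, Φ s 0 = 0 := fun s => by simpa using hs s 0 0
  have hne : ∀ s v, v ≠ 0 → Φ s v ≠ 0 := fun s v hv h => hv ((hb s).1 (h.trans (hz s).symm))
  let F : unitInterval → RP3 → RP3 := fun s => Projectivization.lift
    (fun v => Projectivization.mk ℝ (Φ s v.1) (hne s v.1 v.2)) (by
      rintro ⟨-, ha⟩ ⟨b, hb⟩ t rfl
      exact (Projectivization.mk_eq_mk_iff' ℝ _ _ _ _).2 ⟨t, (hs s t b).symm⟩)
  have hF : Continuous fun x : unitInterval × RP3 => F x.1 x.2 := by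
    have hq := (IsOpenQuotientMap.id (X := unitInterval)).prodMap isOpenQuotientMap_mk'
    rw [hq.isQuotientMap.continuous_iff]
    exact continuous_mk (f := fun x : unitInterval × {v : ℂ × ℂ // v ≠ 0} => Φ x.1 x.2.1)
      (hc.comp (by fun_prop : Continuous fun x : unitInterval × {v : ℂ × ℂ // v ≠ 0} =>
        (x.1, (x.2.1 : ℂ × ℂ)))) fun x => hne x.1 x.2.1 x.2.2
  have hFb : ∀ s, Function.Bijective (F s) := by
    refine fun s => ⟨fun x y hxy => ?_, fun y => ?_⟩
    · obtain ⟨v, hv, rfl⟩ := exists_eq_mk x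
      obtain ⟨w, hw, rfl⟩ := exists_eq_mk y
      obtain ⟨a, ha⟩ := (Projectivization.mk_eq_mk_iff' ℝ _ _ _ _).1 hxy
      rw [Projectivization.mk_eq_mk_iff']
      exact ⟨a, (hb s).1 (by rw [hs]; exact ha)⟩
    · obtain ⟨w, hw, rfl⟩ := exists_eq_mk y
      obtain ⟨v, rfl⟩ := (hb s).2 w
      exact ⟨Projectivization.mk ℝ v fun h => hw (by rw [h, hz]), rfl⟩
  have hFc : ∀ s, Continuous (F s) := fun s => hF.comp (by fun_prop : Continuous fun x => (s, x))
  refine ⟨fun s => (hFc s).homeoOfEquivCompactToT2 (f := Equiv.ofBijective (F s) (hFb s)),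
    hF, ?_, ?_⟩
  · ext x
    obtain ⟨v, hv, rfl⟩ := exists_eq_mk x
    change Projectivization.mk ℝ (Φ 0 v) _ = Projectivization.mk ℝ v hv
    congr 1
    exact h0 v
  · ext y
    constructor
    · rintro ⟨x, hx, rfl⟩
      obtain ⟨v, hv, rfl⟩ := exists_eq_mk x
      exact (hL v hv (hne 1 v hv)).1 hx
    · intro hy
      obtain ⟨x, rfl⟩ := (hFb 1).2 y
      refine ⟨x, ?_, rfl⟩
      obtain ⟨v, hv, rfl⟩ := exists_eq_mk x
      exact (hL v hv (hne 1 v hv)).2 hy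

/-! ### Links swept out by points in a rotating frame -/

/-- The link swept out by moving points `f t k` of `ℂ`, `0 ≤ t ≤ 1`, in the frame that makes a
half-turn: it consists of the points `[e ^ (iπt) : e ^ (iπt) f t k]`. In this frame the coordinate
`w / z` of `[z : w]` is invariant under real scalings, so that the link closes up as soon as the
sets of points at the times `0` and `1` agree. -/
def twLink {n : ℕ} (f : unitInterval → Fin n → ℂ) : Set RP3 :=
  {x | ∃ (t : unitInterval) (k : Fin n), x = Projectivization.mk ℝ
    (Complex.exp (((Real.pi * (t : ℝ) : ℝ) : ℂ) * Complex.I),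
      Complex.exp (((Real.pi * (t : ℝ) : ℝ) : ℂ) * Complex.I) * f t k) (exp_pair_ne_zero _ _)}

theorem mk_mem_twLink {n : ℕ} {f : unitInterval → Fin n → ℂ} {v : ℂ × ℂ} {hv : v ≠ 0} :
    (Projectivization.mk ℝ v hv : RP3) ∈ twLink f ↔ ∃ (t : unitInterval) (k : Fin n) (r : ℝ),
      r ≠ 0 ∧ v.1 = r * Complex.exp (((Real.pi * (t : ℝ) : ℝ) : ℂ) * Complex.I) ∧
        v.2 = v.1 * f t k := by
  constructor
  · rintro ⟨t, k, h⟩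
    obtain ⟨r, hr⟩ := (Projectivization.mk_eq_mk_iff ℝ _ _ _ _).1 h
    refine ⟨t, k, r, r.ne_zero, ?_, ?_⟩
    · rw [← hr]; rfl
    · rw [← hr]
      change ((r : ℝ) : ℂ) * (_ * _) = ((r : ℝ) : ℂ) * _ * _
      ring
  · rintro ⟨t, k, r, hr, h1, h2⟩
    refine ⟨t, k, (Projectivization.mk_eq_mk_iff' ℝ _ _ _ _).2 ⟨r, ?_⟩⟩
    refine Prod.ext ?_ ?_
    · rw [h1]; rfl
    · rw [h2, h1]
      change ((r : ℝ) : ℂ) * (_ * _) = ((r : ℝ) : ℂ) * _ * _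
      ring

/-- If `z` lies on the real line through `e ^ (iπt)`, then `arg z / π` agrees with `t` modulo `1`. So
`arg z / π` modulo `1` is a function of the class of `z` under real scalings. -/
theorem apply_arg_div_pi {α : Type*} {h : ℝ → α} (hh : Function.Periodic h 1) {z : ℂ} {r t : ℝ}
    (hr : r ≠ 0) (hz : z = r * Complex.exp (((Real.pi * t : ℝ) : ℂ) * Complex.I)) :
    h (Complex.arg z / Real.pi) = h t := by
  have h1 : (‖z‖ : ℂ) * Complex.exp (Complex.arg z * Complex.I) = z :=
    Complex.norm_mul_exp_arg_mul_I z
  have hz0 : z ≠ 0 := by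
    rw [hz]; exact mul_ne_zero (by exact_mod_cast hr) (Complex.exp_ne_zero _)
  have h2 : (‖z‖ : ℂ) * Complex.exp (((Complex.arg z - Real.pi * t : ℝ) : ℂ) * Complex.I) = r := by
    have : (((Complex.arg z - Real.pi * t : ℝ) : ℂ) * Complex.I) =
        Complex.arg z * Complex.I - ((Real.pi * t : ℝ) : ℂ) * Complex.I := by push_cast; ring
    rw [this, Complex.exp_sub, mul_div_assoc', h1]
    rw [div_eq_iff (Complex.exp_ne_zero _)]
    exact hz
  have h3 : ‖z‖ * Real.sin (Complex.arg z - Real.pi * t) = 0 := by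
    have := congrArg Complex.im h2
    rwa [Complex.im_ofReal_mul, Complex.exp_ofReal_mul_I_im, Complex.ofReal_im] at this
  obtain ⟨m, hm⟩ := Real.sin_eq_zero_iff.1
    ((mul_eq_zero.1 h3).resolve_left (norm_ne_zero_iff.2 hz0))
  have h4 : Complex.arg z / Real.pi = t + m * 1 := by
    field_simp
    linarith
  rw [h4]
  exact hh.int_mul m t

/-- The discontinuity of `arg` on the negative real axis is harmless for functions of period `1` of
`arg z / π`. -/
theorem continuousAt_arg_div_pi {α X : Type*} [TopologicalSpace α] [TopologicalSpace X]
    {g : ℝ → X → α} (hc : Continuous fun x : ℝ × X => g x.1 x.2)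
    (hper : Function.Periodic g 1) {z₀ : ℂ} (hz₀ : z₀ ≠ 0) (x₀ : X) :
    ContinuousAt (fun x : ℂ × X => g (Complex.arg x.1 / Real.pi) x.2) (z₀, x₀) := by
  have key : ∀ c : ℂ → ℂ, Continuous c → c z₀ ∈ Complex.slitPlane →
      ContinuousAt (fun x : ℂ × X => g (Complex.arg (c x.1) / Real.pi) x.2) (z₀, x₀) := by
    intro c hcc hc0
    have h1 : ContinuousAt (fun x : ℂ × X => Complex.arg (c x.1)) (z₀, x₀) :=
      ContinuousAt.comp (f := fun x : ℂ × X => c x.1) (g := Complex.arg)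
        (Complex.continuousAt_arg hc0) (by fun_prop)
    exact hc.continuousAt.comp ((h1.div_const _).prodMk continuousAt_snd)
  by_cases h : z₀ ∈ Complex.slitPlane
  · exact key id continuous_id h
  · -- on the branch cut, `-z` has a continuous argument, which gives the same value of `g`
    have h' : -z₀ ∈ Complex.slitPlane := by
      rw [Complex.mem_slitPlane_iff] at h ⊢
      push Not at h
      rw [Complex.neg_re, Complex.neg_im]
      left
      rcases h.1.lt_or_eq with h1 | h1
      · linarith
      · exact absurd (Complex.ext h1 h.2) hz₀
    refine (key (fun z => -z) continuous_neg h').congr ?_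
    have : ∀ᶠ x : ℂ × X in nhds (z₀, x₀), x.1 ≠ 0 :=
      continuousAt_fst.eventually_ne hz₀
    filter_upwards [this] with x hx
    have h1 : (‖-x.1‖ : ℂ) * Complex.exp (Complex.arg (-x.1) * Complex.I) = -x.1 :=
      Complex.norm_mul_exp_arg_mul_I _
    have h2 : g (Complex.arg x.1 / Real.pi) = g (Complex.arg (-x.1) / Real.pi) := by
      refine apply_arg_div_pi (h := g) hper (r := -‖-x.1‖) (by simpa using hx) ?_
      have : Real.pi * (Complex.arg (-x.1) / Real.pi) = Complex.arg (-x.1) := by field_simp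
      rw [this]
      push_cast
      rw [neg_mul, h1, neg_neg]
    exact congrFun h2.symm x.2

/-- A perturbation of the identity by a contraction is bijective, by the fixed point theorem of
Banach applied to `u ↦ y - h u`. -/
theorem bijective_add_of_lipschitz {h : ℂ → ℂ} {K : ℝ} (hK : K < 1)
    (hh : ∀ u u', ‖h u - h u'‖ ≤ K * ‖u - u'‖) : Function.Bijective fun u => u + h u := by
  constructor
  · intro u u' huu
    have h1 : u - u' = -(h u - h u') := by linear_combination huu
    have h2 := hh u u'
    rw [← norm_neg (h u - h u'), ← h1] at h2
    by_contra hne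
    have : 0 < ‖u - u'‖ := norm_pos_iff.2 (sub_ne_zero.2 hne)
    nlinarith
  · intro y
    have hcw : ContractingWith K.toNNReal fun u => y - h u := by
      refine ⟨by rw [← NNReal.coe_lt_coe]; simpa using hK, LipschitzWith.of_dist_le_mul ?_⟩
      intro u u'
      rw [dist_eq_norm, dist_eq_norm]
      have : y - h u - (y - h u') = -(h u - h u') := by ring
      rw [this, norm_neg]
      exact (hh u u').trans (mul_le_mul_of_nonneg_right (Real.le_coe_toNNReal K) (norm_nonneg _))
    refine ⟨ContractingWith.fixedPoint _ hcw, ?_⟩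
    have h1 : y - h _ = _ := hcw.fixedPoint_isFixedPt
    change _ + h _ = y
    linear_combination -h1

/-- A displacement of the coordinate `w / z` that depends periodically on the angle of `z`, is
bounded, and has a Lipschitz constant less than `1`, gives an ambient isotopy. -/
theorem ambientIsotopic_of_displacement {n : ℕ} (g : ℝ → ℂ → ℂ)
    (hc : Continuous fun x : ℝ × ℂ => g x.1 x.2) (hper : Function.Periodic g 1)
    {C K : ℝ} (hC : ∀ t u, ‖g t u‖ ≤ C) (hK1 : K < 1)
    (hK : ∀ t u u', ‖g t u - g t u'‖ ≤ K * ‖u - u'‖) {f f' : unitInterval → Fin n → ℂ}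
    (hf : ∀ (t : unitInterval) k, f t k + g t (f t k) = f' t k) :
    AmbientIsotopic (twLink f) (twLink f') := by
  refine ambientIsotopic_of_family
    (fun s v => (v.1, v.2 + s * (v.1 * g (Complex.arg v.1 / Real.pi) (v.2 / v.1))))
    ?_ ?_ ?_ ?_ ?_
  · refine (continuous_fst.comp continuous_snd).prodMk
      ((continuous_snd.comp continuous_snd).add ?_)
    rw [continuous_iff_continuousAt]
    rintro ⟨s₀, z₀, v₀⟩
    by_cases hz : z₀ = 0
    · subst hz
      -- the displacement is at most `C ‖z‖`
      have h1 : Filter.Tendsto (fun x : unitInterval × (ℂ × ℂ) => ‖x.2.1‖ * C)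
          (nhds (s₀, 0, v₀)) (nhds 0) := by
        have : Continuous fun x : unitInterval × (ℂ × ℂ) => ‖x.2.1‖ * C := by fun_prop
        simpa using this.tendsto (s₀, 0, v₀)
      have h2 := squeeze_zero_norm (f := fun x : unitInterval × (ℂ × ℂ) =>
        ((x.1 : ℝ) : ℂ) * (x.2.1 * g (Complex.arg x.2.1 / Real.pi) (x.2.2 / x.2.1)))
        (fun x => ?_) h1
      · simpa [ContinuousAt] using h2
      · rw [norm_mul, norm_mul, Complex.norm_real, Real.norm_eq_abs, abs_of_nonneg x.1.2.1]
        have := hC (Complex.arg x.2.1 / Real.pi) (x.2.2 / x.2.1)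
        calc (x.1 : ℝ) * (‖x.2.1‖ * ‖g (Complex.arg x.2.1 / Real.pi) (x.2.2 / x.2.1)‖)
            ≤ 1 * (‖x.2.1‖ * ‖g (Complex.arg x.2.1 / Real.pi) (x.2.2 / x.2.1)‖) :=
              mul_le_mul_of_nonneg_right x.1.2.2 (by positivity)
          _ ≤ ‖x.2.1‖ * C := by
              rw [one_mul]; exact mul_le_mul_of_nonneg_left this (norm_nonneg _)
    · have h1 : ContinuousAt (fun x : unitInterval × (ℂ × ℂ) => (x.2.1, x.2.2 / x.2.1))
          (s₀, z₀, v₀) :=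
        ContinuousAt.prodMk (by fun_prop) (ContinuousAt.div (by fun_prop) (by fun_prop) hz)
      have h2 : ContinuousAt (fun x : unitInterval × (ℂ × ℂ) =>
          g (Complex.arg x.2.1 / Real.pi) (x.2.2 / x.2.1)) (s₀, z₀, v₀) :=
        ContinuousAt.comp (f := fun x : unitInterval × (ℂ × ℂ) => (x.2.1, x.2.2 / x.2.1))
          (g := fun x : ℂ × ℂ => g (Complex.arg x.1 / Real.pi) x.2)
          (continuousAt_arg_div_pi hc hper hz _) h1
      exact ContinuousAt.mul (by fun_prop) (ContinuousAt.mul (by fun_prop) h2)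
  · rintro s r ⟨z, v⟩
    simp only [Prod.smul_mk, Complex.real_smul, Prod.mk.injEq, true_and]
    by_cases hz : z = 0
    · simp [hz]
    by_cases hr : r = 0
    · simp [hr]
    have hr' : (r : ℂ) ≠ 0 := by exact_mod_cast hr
    have h1 : g (Complex.arg (r * z) / Real.pi) = g (Complex.arg z / Real.pi) := by
      refine apply_arg_div_pi (h := g) hper (r := r * ‖z‖)
        (mul_ne_zero hr (norm_ne_zero_iff.2 hz)) ?_
      have : Real.pi * (Complex.arg z / Real.pi) = Complex.arg z := by field_simp
      rw [this]
      push_cast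
      rw [mul_assoc, Complex.norm_mul_exp_arg_mul_I]
    rw [h1, mul_div_mul_left _ _ hr']
    ring
  · intro s
    have hb : ∀ z, Function.Bijective fun u => u + (s : ℝ) * g (Complex.arg z / Real.pi) u := by
      intro z
      refine bijective_add_of_lipschitz (K := max K 0) (max_lt hK1 one_pos) fun u u' => ?_
      rw [← mul_sub, norm_mul, Complex.norm_real, Real.norm_eq_abs, abs_of_nonneg s.2.1]
      have h1 := hK (Complex.arg z / Real.pi) u u'
      have h2 : K * ‖u - u'‖ ≤ max K 0 * ‖u - u'‖ :=
        mul_le_mul_of_nonneg_right (le_max_left _ _) (norm_nonneg _)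
      calc _ ≤ 1 * ‖g (Complex.arg z / Real.pi) u - g (Complex.arg z / Real.pi) u'‖ :=
            mul_le_mul_of_nonneg_right s.2.2 (norm_nonneg _)
        _ ≤ _ := by linarith
    constructor
    · rintro ⟨z, v⟩ ⟨z', v'⟩ h
      simp only [Prod.mk.injEq] at h
      obtain ⟨rfl, h⟩ := h
      by_cases hz : z = 0
      · simpa [hz] using h
      have : v / z = v' / z := by
        refine (hb z).1 ?_
        change v / z + _ = v' / z + _
        field_simp
        linear_combination h
      rw [div_left_inj' hz] at this
      rw [this]
    · rintro ⟨z, v⟩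
      by_cases hz : z = 0
      · exact ⟨(z, v), by simp [hz]⟩
      obtain ⟨u, hu⟩ := (hb z).2 (v / z)
      refine ⟨(z, z * u), ?_⟩
      simp only [Prod.mk.injEq, true_and]
      rw [mul_div_cancel_left₀ _ hz]
      change u + _ = v / z at hu
      rw [eq_div_iff hz] at hu
      linear_combination hu
  · rintro ⟨z, v⟩
    simp
  · rintro ⟨z, v⟩ hv hv'
    rw [mk_mem_twLink, mk_mem_twLink]
    refine exists_congr fun t => exists_congr fun k => exists_congr fun r =>
      and_congr_right fun hr => and_congr_right fun hz => ?_
    dsimp only at hz ⊢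
    have hz0 : z ≠ 0 := by
      rw [hz]; exact mul_ne_zero (by exact_mod_cast hr) (Complex.exp_ne_zero _)
    rw [apply_arg_div_pi (h := g) hper hr hz, ← hf t k]
    have e1 : (((1 : unitInterval) : ℝ) : ℂ) = 1 := by simp
    rw [e1, one_mul]
    constructor
    · rintro rfl
      rw [mul_div_cancel_left₀ _ hz0]
      ring
    · intro h
      have h1 : v / z + g t (v / z) = f t k + g t (f t k) := by
        have : v + z * g t (v / z) = z * (v / z + g t (v / z)) := by field_simp
        exact mul_left_cancel₀ hz0 (this.symm.trans h)
      have h2 := (bijective_add_of_lipschitz hK1 (hK t)).1 h1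
      rw [← h2]
      field_simp

/-! ### Isotopy extension -/

/-- A cone-shaped bump of height `1` and radius `ε`. -/
def bump (ε x : ℝ) : ℝ := max 0 (1 - x / ε)

theorem continuous_bump (ε : ℝ) : Continuous (bump ε) := by unfold bump; fun_prop

theorem abs_bump_sub_le {ε : ℝ} (hε : 0 < ε) (x y : ℝ) :
    |bump ε x - bump ε y| ≤ |x - y| / ε := by
  have h := abs_max_sub_max_le_abs (1 - x / ε) (1 - y / ε) 0
  rw [max_comm, max_comm (1 - y / ε)] at h
  refine h.trans (le_of_eq ?_)
  rw [show 1 - x / ε - (1 - y / ε) = -((x - y) / ε) by ring, abs_neg, abs_div, abs_of_pos hε]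

theorem abs_bump_le_one {ε x : ℝ} (hε : 0 < ε) (hx : 0 ≤ x) : |bump ε x| ≤ 1 := by
  rw [abs_of_nonneg (le_max_left _ _)]
  exact max_le zero_le_one (by have := div_nonneg hx hε.le; linarith)

theorem bump_zero (ε : ℝ) : bump ε 0 = 1 := by simp [bump]

theorem bump_of_le {ε x : ℝ} (hε : 0 < ε) (hx : ε ≤ x) : bump ε x = 0 :=
  max_eq_left (by have := (one_le_div hε).2 hx; linarith)

/-- A displacement of moving points that is small in comparison with their mutual distances
extends to an ambient isotopy. -/
theorem ambientIsotopic_twLink_of_close {n : ℕ} {f f' : unitInterval → Fin n → ℂ}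
    (hf : Continuous f) (hf' : Continuous f') (σ : Equiv.Perm (Fin n))
    (h1 : ∀ k, f 1 k = f 0 (σ k)) (h1' : ∀ k, f' 1 k = f' 0 (σ k)) {ε η : ℝ} (hε : 0 < ε)
    (hη : n * η < ε) (hsep : ∀ t j k, j ≠ k → ε ≤ ‖f t j - f t k‖)
    (hclose : ∀ t k, ‖f' t k - f t k‖ ≤ η) : AmbientIsotopic (twLink f) (twLink f') := by
  obtain ⟨G, hGd⟩ : ∃ G : unitInterval → ℂ → ℂ, ∀ t u,
      G t u = ∑ k, (bump ε ‖u - f t k‖ : ℂ) * (f' t k - f t k) := ⟨_, fun _ _ => rfl⟩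
  have hG : Continuous fun x : unitInterval × ℂ => G x.1 x.2 := by
    have hb := continuous_bump ε
    have e1 : ∀ k, Continuous fun t => f t k := fun k => (continuous_apply k).comp hf
    have e2 : ∀ k, Continuous fun t => f' t k := fun k => (continuous_apply k).comp hf'
    simp only [hGd]
    refine continuous_finsetSum _ fun k _ => ?_
    have e1 := e1 k
    have e2 := e2 k
    fun_prop
  have hG01 : G 0 = G 1 := by
    funext u
    rw [hGd, hGd, ← Equiv.sum_comp σ]
    simp only [h1, h1']
  let g : ℝ → ℂ → ℂ := fun t u => G (Set.projIcc 0 1 zero_le_one (Int.fract t)) u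
  have hg : ∀ t : unitInterval, g t = G t := by
    intro t
    by_cases ht : t = 1
    · subst ht
      rw [← hG01]
      change G _ = _
      simp
    · have h2 : (t : ℝ) < 1 := lt_of_le_of_ne t.2.2 fun h => ht (Subtype.ext h)
      change G _ = _
      rw [Int.fract_eq_self.2 ⟨t.2.1, h2⟩, Set.projIcc_val]
  have hη0 : ∀ t (k : Fin n), 0 ≤ η := fun t k => (norm_nonneg _).trans (hclose t k)
  refine ambientIsotopic_of_displacement g (C := n * η) (K := n * η / ε) ?_ ?_ ?_ ?_ ?_ ?_
  · have h1 : Continuous (Set.projIcc (0 : ℝ) 1 zero_le_one) := continuous_projIcc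
    have h2 : Continuous fun x : (ℝ × ℂ) × ℝ =>
        G (Set.projIcc 0 1 zero_le_one x.2) x.1.2 :=
      hG.comp ((h1.comp continuous_snd).prodMk
        (continuous_snd.comp continuous_fst))
    have h3 := ContinuousOn.comp_fract (β := ℝ × ℂ) (s := Prod.fst)
      (f := fun x t => G (Set.projIcc 0 1 zero_le_one t) x.2) h2.continuousOn continuous_fst
      (fun x => by simpa using congrFun hG01 x.2)
    exact h3
  · intro t
    simp only [g, Int.fract_add_one]
  · intro t u
    simp only [g, hGd]
    refine (norm_sum_le _ _).trans ?_
    refine (Finset.sum_le_card_nsmul _ _ η fun k _ => ?_).trans (by simp)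
    rw [norm_mul, Complex.norm_real, Real.norm_eq_abs]
    calc _ ≤ 1 * η := mul_le_mul (abs_bump_le_one hε (norm_nonneg _)) (hclose _ _)
          (norm_nonneg _) zero_le_one
      _ = η := one_mul η
  · rwa [div_lt_one hε]
  · intro t u u'
    simp only [g, hGd]
    rw [← Finset.sum_sub_distrib]
    refine (norm_sum_le _ _).trans ?_
    refine (Finset.sum_le_card_nsmul _ _ (‖u - u'‖ / ε * η) fun k _ => ?_).trans
      (le_of_eq (by simp; ring))
    rw [← sub_mul, norm_mul, ← Complex.ofReal_sub, Complex.norm_real, Real.norm_eq_abs]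
    refine mul_le_mul ((abs_bump_sub_le hε _ _).trans ?_) (hclose _ _) (norm_nonneg _)
      (by positivity)
    refine div_le_div_of_nonneg_right ((abs_norm_sub_norm_le _ _).trans (le_of_eq ?_)) hε.le
    congr 1
    ring
  · intro t k
    rw [hg]
    -- only the bump around `f t k` contributes
    have : G t (f t k) = f' t k - f t k := by
      rw [hGd, Finset.sum_eq_single k]
      · simp [bump_zero]
      · intro j _ hj
        rw [bump_of_le hε (hsep t k j hj.symm)]
        simp
      · simp
    rw [this]
    ring

theorem exists_separation {n : ℕ} {f : unitInterval → Fin n → ℂ} (hf : Continuous f)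
    (hi : ∀ t, Function.Injective (f t)) :
    ∃ ε > 0, ∀ t j k, j ≠ k → ε ≤ ‖f t j - f t k‖ := by
  have key : ∀ j k : Fin n, ∀ᶠ ε in nhdsWithin (0 : ℝ) (Set.Ioi 0),
      j ≠ k → ∀ t, ε ≤ ‖f t j - f t k‖ := by
    intro j k
    by_cases hjk : j = k
    · simp [hjk]
    have hc : Continuous fun t => ‖f t j - f t k‖ :=
      (((continuous_apply j).comp hf).sub ((continuous_apply k).comp hf)).norm
    obtain ⟨t₀, -, ht₀⟩ := isCompact_univ.exists_isMinOn Set.univ_nonempty hc.continuousOn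
    have hpos : 0 < ‖f t₀ j - f t₀ k‖ :=
      norm_pos_iff.2 (sub_ne_zero.2 fun h => hjk (hi t₀ h))
    filter_upwards [Ioo_mem_nhdsGT hpos] with ε hε _ t
    exact hε.2.le.trans (ht₀ (Set.mem_univ t))
  have h := Filter.eventually_all.2 fun j => Filter.eventually_all.2 fun k => key j k
  obtain ⟨ε, hε, hpos⟩ := (h.and self_mem_nhdsWithin).exists
  exact ⟨ε, hpos, fun t j k hjk => hε j k hjk t⟩

/-- Isotopy extension: a homotopy of closed motions of `n` distinct points gives an ambient
isotopy of the links that they sweep out. -/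
theorem ambientIsotopic_twLink_of_homotopy {n : ℕ} (F : unitInterval → unitInterval → Fin n → ℂ)
    (hF : Continuous fun x : unitInterval × unitInterval => F x.1 x.2)
    (hi : ∀ s t, Function.Injective (F s t)) (σ : Equiv.Perm (Fin n))
    (hσ : ∀ s k, F s 1 k = F s 0 (σ k)) : AmbientIsotopic (twLink (F 0)) (twLink (F 1)) := by
  have hFs : ∀ s, Continuous (F s) := fun s => hF.comp (by fun_prop : Continuous fun t => (s, t))
  refine PreconnectedSpace.induction₂' (fun s s' => AmbientIsotopic (twLink (F s)) (twLink (F s')))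
    (fun s => ?_) ⟨fun _ _ _ h h' => AmbientIsotopic.trans h h'⟩ 0 1
  obtain ⟨ε, hε, hsep⟩ := exists_separation (hFs s) (hi s)
  have hη : 0 < ε / (n + 1) := by positivity
  let c : C(unitInterval, C(unitInterval, Fin n → ℂ)) :=
    ContinuousMap.curry ⟨fun x : unitInterval × unitInterval => F x.1 x.2, hF⟩
  have hev : ∀ᶠ s' in nhds s, dist (c s') (c s) < ε / (n + 1) :=
    c.continuous.continuousAt.eventually (Metric.ball_mem_nhds _ hη)
  filter_upwards [hev] with s' hs'
  have h : AmbientIsotopic (twLink (F s)) (twLink (F s')) := by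
    refine ambientIsotopic_twLink_of_close (hFs s) (hFs s') σ (hσ s) (hσ s') hε
      (η := ε / (n + 1)) ?_ hsep ?_
    · rw [mul_div_assoc', div_lt_iff₀ (by positivity)]
      nlinarith
    · intro t k
      have h1 := ContinuousMap.dist_apply_le_dist (f := c s') (g := c s) t
      have h2 := dist_le_pi_dist (c s' t) (c s t) k
      rw [← dist_eq_norm]
      exact (h2.trans h1).trans hs'.le
  exact ⟨h, h.symm⟩

/-! ### Homotopy classes of geometric braids -/

/-- The space of configurations of `n` distinct labelled points of `ℂ`. -/
abbrev Conf (n : ℕ) : Type := {x : Fin n → ℂ // Function.Injective x}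

/-- Permuting the labels of a configuration. -/
def relabel {n : ℕ} (π : Equiv.Perm (Fin n)) : C(Conf n, Conf n) where
  toFun x := ⟨fun k => x.1 (π k), x.2.comp π.injective⟩
  continuous_toFun := by
    refine Continuous.subtype_mk (continuous_pi fun k => ?_) _
    exact (continuous_apply (π k)).comp continuous_subtype_val

theorem pos_re {n : ℕ} (k : Fin n) : (pos k).re = 2 * (k : ℝ) - (n - 1) := by
  simp [pos]

theorem pos_im {n : ℕ} (k : Fin n) : (pos k).im = 0 := by
  simp [pos]

theorem pos_injective {n : ℕ} : Function.Injective (pos : Fin n → ℂ) := by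
  intro j k h
  have := congrArg Complex.re h
  rw [pos_re, pos_re] at this
  exact Fin.ext (by exact_mod_cast (by linarith : (j : ℝ) = k))

/-- The standard configuration in which the point `k` is in the position `π k`. -/
def stdConf {n : ℕ} (π : Equiv.Perm (Fin n)) : Conf n :=
  ⟨fun k => pos (π k), pos_injective.comp π.injective⟩

/-- The homotopy classes of geometric braids: motions of `n` distinct labelled points that start
in the standard configuration and end in it up to a permutation `π` of the labels; the point `k`
ends in the position `π k`. -/
def BraidClass (n : ℕ) : Type :=
  Σ π : Equiv.Perm (Fin n), Path.Homotopic.Quotient (stdConf 1) (stdConf π)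

/-- The class of a geometric braid. -/
def BraidClass.mk {n : ℕ} {π : Equiv.Perm (Fin n)} (p : Path (stdConf 1) (stdConf π)) :
    BraidClass n := ⟨π, Path.Homotopic.Quotient.mk p⟩

/-- The concatenation of geometric braids. -/
def mulPath {n : ℕ} {π ρ : Equiv.Perm (Fin n)} (p : Path (stdConf 1) (stdConf π))
    (q : Path (stdConf 1) (stdConf ρ)) : Path (stdConf 1) (stdConf (ρ * π)) :=
  p.trans ((q.map (relabel π).continuous).cast (x' := stdConf π) (y' := stdConf (ρ * π)) rfl rfl)

theorem mulPath_of_le {n : ℕ} {π ρ : Equiv.Perm (Fin n)} (p : Path (stdConf 1) (stdConf π))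
    (q : Path (stdConf 1) (stdConf ρ)) {t : unitInterval} (h : (t : ℝ) ≤ 1 / 2) :
    mulPath p q t = p ⟨2 * t, (unitInterval.mul_pos_mem_iff zero_lt_two).2 ⟨t.2.1, h⟩⟩ := by
  rw [mulPath, Path.trans_apply, dif_pos h]

theorem mulPath_of_not_le {n : ℕ} {π ρ : Equiv.Perm (Fin n)} (p : Path (stdConf 1) (stdConf π))
    (q : Path (stdConf 1) (stdConf ρ)) {t : unitInterval} (h : ¬ (t : ℝ) ≤ 1 / 2) :
    mulPath p q t = relabel π (q ⟨2 * t - 1,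
      unitInterval.two_mul_sub_one_mem_iff.2 ⟨(not_le.1 h).le, t.2.2⟩⟩) := by
  rw [mulPath, Path.trans_apply, dif_neg h]
  rfl

/-- The reversed geometric braid. -/
def invPath {n : ℕ} {π : Equiv.Perm (Fin n)} (p : Path (stdConf 1) (stdConf π)) :
    Path (stdConf 1) (stdConf π⁻¹) :=
  (p.symm.map (relabel π⁻¹).continuous).cast
    (Subtype.ext (funext fun k => by simp [stdConf, relabel])) rfl

instance (n : ℕ) : Mul (BraidClass n) where
  mul g h := ⟨h.1 * g.1, g.2.trans ((h.2.map (relabel g.1)).cast (x' := stdConf g.1)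
    (y' := stdConf (h.1 * g.1)) rfl rfl)⟩

instance (n : ℕ) : One (BraidClass n) where
  one := BraidClass.mk (Path.refl _)

namespace BraidClass

variable {n : ℕ}

theorem mk_mul_mk {π ρ : Equiv.Perm (Fin n)} (p : Path (stdConf 1) (stdConf π))
    (q : Path (stdConf 1) (stdConf ρ)) : mk p * mk q = mk (mulPath p q) := rfl

theorem one_def : (1 : BraidClass n) = mk (Path.refl _) := rfl

theorem exists_rep (g : BraidClass n) : ∃ π, ∃ p : Path (stdConf 1) (stdConf π), g = mk p := by
  obtain ⟨π, q⟩ := g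
  obtain ⟨p, rfl⟩ := Path.Homotopic.Quotient.mk_surjective q
  exact ⟨π, p, rfl⟩

/-- Two geometric braids are in the same class if they agree pointwise with homotopic paths, whose
endpoints need not be stated in terms of `stdConf`. -/
theorem mk_eq_mk_of_homotopic {a b : Conf n} {p₁ q₁ : Path a b} (h : p₁.Homotopic q₁)
    {π ρ : Equiv.Perm (Fin n)} {p : Path (stdConf 1) (stdConf π)}
    {q : Path (stdConf 1) (stdConf ρ)} (hπ : π = ρ) (hp : ∀ t, p t = p₁ t)
    (hq : ∀ t, q t = q₁ t) : mk p = mk q := by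
  subst hπ
  obtain rfl : a = stdConf 1 := by have := hp 0; simpa using this.symm
  obtain rfl : b = stdConf π := by have := hp 1; simpa using this.symm
  obtain rfl : p = p₁ := by ext1; funext t; exact hp t
  obtain rfl : q = q₁ := by ext1; funext t; exact hq t
  exact congrArg (Sigma.mk π) (Path.Homotopic.Quotient.eq.2 h)

theorem mk_eq_mk_of_forall {π ρ : Equiv.Perm (Fin n)} {p : Path (stdConf 1) (stdConf π)}
    {q : Path (stdConf 1) (stdConf ρ)} (h : π = ρ) (hpq : ∀ t, p t = q t) : mk p = mk q :=
  mk_eq_mk_of_homotopic (Path.Homotopic.refl p) h (fun _ => rfl) fun t => (hpq t).symm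

theorem homotopic_of_mk_eq_mk {π : Equiv.Perm (Fin n)} {p q : Path (stdConf 1) (stdConf π)}
    (h : mk p = mk q) : p.Homotopic q :=
  Path.Homotopic.Quotient.eq.1 (eq_of_heq (Sigma.mk.inj h).2)

theorem mk_mul_mk_invPath {π : Equiv.Perm (Fin n)} (p : Path (stdConf 1) (stdConf π)) :
    mk p * mk (invPath p) = 1 := by
  rw [mk_mul_mk, one_def]
  refine mk_eq_mk_of_homotopic (Path.Homotopic.trans_symm p) (inv_mul_cancel π) (fun t => ?_)
    fun _ => rfl
  have : ∀ s, relabel π (invPath p s) = p.symm s := by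
    intro s
    refine Subtype.ext (funext fun k => ?_)
    change (p.symm s).1 (π⁻¹ (π k)) = _
    simp
  rw [Path.trans_apply]
  split_ifs with h
  · rw [mulPath_of_le p _ h]
  · rw [mulPath_of_not_le p _ h, this]

/-- Concatenation makes the classes of geometric braids a group. -/
instance : Group (BraidClass n) :=
  letI : Inv (BraidClass n) := ⟨fun g => ⟨g.1⁻¹, (Path.Homotopic.Quotient.map g.2.symm
    (relabel g.1⁻¹)).cast (Subtype.ext (funext fun k => by simp [stdConf, relabel])) rfl⟩⟩
  Group.ofRightAxioms
    (by
      intro a b c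
      obtain ⟨π, p, rfl⟩ := exists_rep a
      obtain ⟨ρ, q, rfl⟩ := exists_rep b
      obtain ⟨τ, r, rfl⟩ := exists_rep c
      simp only [mk_mul_mk]
      refine mk_eq_mk_of_homotopic (Path.Homotopic.trans_assoc p
        ((q.map (relabel π).continuous).cast (x' := stdConf π) (y' := stdConf (ρ * π)) rfl rfl)
        ((r.map (relabel (ρ * π)).continuous).cast (x' := stdConf (ρ * π))
          (y' := stdConf (τ * (ρ * π))) rfl rfl)) rfl (fun _ => rfl) (fun t => ?_)
      rw [Path.trans_apply]
      split_ifs with h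
      · rw [mulPath_of_le p _ h]
      · rw [mulPath_of_not_le p _ h, Path.trans_apply]
        split_ifs with h'
        · rw [mulPath_of_le q _ h']
          rfl
        · rw [mulPath_of_not_le q _ h']
          rfl)
    (by
      intro a
      obtain ⟨π, p, rfl⟩ := exists_rep a
      rw [one_def, mk_mul_mk]
      exact mk_eq_mk_of_homotopic (Path.Homotopic.trans_refl p) rfl (fun _ => rfl) fun _ => rfl)
    (by
      intro a
      obtain ⟨π, p, rfl⟩ := exists_rep a
      exact mk_mul_mk_invPath p)

theorem mk_invPath {π : Equiv.Perm (Fin n)} (p : Path (stdConf 1) (stdConf π)) :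
    mk (invPath p) = (mk p)⁻¹ := (inv_eq_of_mul_eq_one_right (mk_mul_mk_invPath p)).symm

/-- The permutation of the positions that corresponds to a class of geometric braids. In a product
`g * h` the motion `g` comes first, so that the permutations `π` compose in the opposite order; the
inverse makes this a homomorphism. -/
def permHom : BraidClass n →* Equiv.Perm (Fin n) where
  toFun g := g.1⁻¹
  map_one' := rfl
  map_mul' g h := mul_inv_rev h.1 g.1

theorem permHom_mk {π : Equiv.Perm (Fin n)} (p : Path (stdConf 1) (stdConf π)) :
    permHom (mk p) = π⁻¹ := rfl

/-! ### The link of a class of geometric braids -/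

/-- `L` is isotopic to the link that a geometric braid of the class `g` sweeps out. -/
def Closes (g : BraidClass n) (L : Set RP3) : Prop :=
  ∃ π, ∃ p : Path (stdConf 1) (stdConf π), mk p = g ∧ AmbientIsotopic (twLink fun t => (p t).1) L

theorem ambientIsotopic_of_homotopic {π : Equiv.Perm (Fin n)}
    {p q : Path (stdConf 1) (stdConf π)} (h : p.Homotopic q) :
    AmbientIsotopic (twLink fun t => (p t).1) (twLink fun t => (q t).1) := by
  obtain ⟨H⟩ := h
  have := ambientIsotopic_twLink_of_homotopy (fun s t => (H (s, t)).1)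
    (continuous_subtype_val.comp H.continuous) (fun s t => (H (s, t)).2) π
    (fun s k => by rw [H.source, H.target]; rfl)
  simpa using this

theorem Closes.ambientIsotopic {g : BraidClass n} {L L' : Set RP3} (h : Closes g L)
    (h' : Closes g L') : AmbientIsotopic L L' := by
  obtain ⟨π, p, rfl, hp⟩ := h
  obtain ⟨ρ, q, hq, hq'⟩ := h'
  obtain rfl : ρ = π := congrArg Sigma.fst hq
  exact hp.symm.trans ((ambientIsotopic_of_homotopic (homotopic_of_mk_eq_mk hq)).symm.trans hq')

theorem closes_mk {π : Equiv.Perm (Fin n)} (p : Path (stdConf 1) (stdConf π)) :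
    Closes (mk p) (twLink fun t => (p t).1) := ⟨π, p, rfl, AmbientIsotopic.refl _⟩

theorem Closes.congr {g : BraidClass n} {L L' : Set RP3} (h : Closes g L)
    (h' : AmbientIsotopic L L') : Closes g L' := by
  obtain ⟨π, p, hp, hL⟩ := h
  exact ⟨π, p, hp, hL.trans h'⟩

/-- A quarter-turn of the frame exchanges the two halves of a concatenation. -/
theorem mk_mem_twLink_mulPath_comm {π ρ : Equiv.Perm (Fin n)} {p : Path (stdConf 1) (stdConf π)}
    {q : Path (stdConf 1) (stdConf ρ)} {v w : ℂ × ℂ} {hv : v ≠ 0} {hw : w ≠ 0}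
    (h1 : w.1 = -Complex.I * v.1) (h2 : w.2 = -Complex.I * v.2)
    (h : (Projectivization.mk ℝ v hv : RP3) ∈ twLink fun t => (mulPath p q t).1) :
    (Projectivization.mk ℝ w hw : RP3) ∈ twLink fun t => (mulPath q p t).1 := by
  rw [mk_mem_twLink] at h ⊢
  obtain ⟨t, k, r, hr, hz, hu⟩ := h
  by_cases ht : (t : ℝ) ≤ 1 / 2
  · refine ⟨⟨t + 1 / 2, by linarith [t.2.1], by linarith⟩, ρ⁻¹ k, -r, neg_ne_zero.2 hr, ?_, ?_⟩
    · rw [h1, hz]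
      have : (((Real.pi * ((t : ℝ) + 1 / 2) : ℝ) : ℂ) * Complex.I) =
          ((Real.pi * t : ℝ) : ℂ) * Complex.I + Real.pi / 2 * Complex.I := by push_cast; ring
      simp only [this, Complex.exp_add, Complex.exp_pi_div_two_mul_I]
      push_cast
      ring
    · rw [h2, h1, hu, mul_assoc]
      congr 2
      by_cases ht0 : (t : ℝ) = 0
      · obtain rfl : t = 0 := Subtype.ext ht0
        have e : ∀ h, q ⟨2 * (((0 : unitInterval) : ℝ) + 1 / 2), h⟩ = stdConf ρ := fun h => by
          rw [show (⟨2 * (((0 : unitInterval) : ℝ) + 1 / 2), h⟩ : unitInterval) = 1 from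
            Subtype.ext (by simp), Path.target]
        rw [Path.source, mulPath_of_le _ _ (by simp), e]
        simp [stdConf]
      · have ht0' : 0 < (t : ℝ) := lt_of_le_of_ne t.2.1 (Ne.symm ht0)
        rw [mulPath_of_le _ _ ht, mulPath_of_not_le _ _ (by linarith)]
        change _ = (p _).1 (ρ (ρ⁻¹ k))
        rw [Equiv.Perm.inv_def, Equiv.apply_symm_apply]
        ring_nf
  · push Not at ht
    refine ⟨⟨t - 1 / 2, by linarith, by linarith [t.2.2]⟩, π k, r, hr, ?_, ?_⟩
    · rw [h1, hz]
      have : (((Real.pi * ((t : ℝ) - 1 / 2) : ℝ) : ℂ) * Complex.I) =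
          ((Real.pi * t : ℝ) : ℂ) * Complex.I + -(Real.pi / 2 * Complex.I) := by push_cast; ring
      simp only [this, Complex.exp_add, Complex.exp_neg, Complex.exp_pi_div_two_mul_I,
        Complex.inv_I]
      ring
    · rw [h2, h1, hu, mul_assoc]
      congr 2
      have ht1 : (t : ℝ) - 1 / 2 ≤ 1 / 2 := by linarith [t.2.2]
      rw [mulPath_of_not_le _ _ (not_le.2 ht), mulPath_of_le _ _ ht1]
      change (q _).1 (π k) = _
      ring_nf

/-- The link of a product does not depend on the order of the factors: the motion may start at its
middle. -/
theorem Closes.mul_comm {g h : BraidClass n} {L : Set RP3} (hL : Closes (g * h) L) :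
    Closes (h * g) L := by
  obtain ⟨π, p, rfl⟩ := exists_rep g
  obtain ⟨ρ, q, rfl⟩ := exists_rep h
  refine Closes.congr (closes_mk (mulPath q p)) (AmbientIsotopic.trans ?_
    (Closes.ambientIsotopic (closes_mk (mulPath p q)) hL))
  refine AmbientIsotopic.symm (ambientIsotopic_of_family
    (fun s v => (Complex.exp (-(Real.pi / 2 * (s : ℝ)) * Complex.I) * v.1,
      Complex.exp (-(Real.pi / 2 * (s : ℝ)) * Complex.I) * v.2)) (by fun_prop) ?_ ?_ ?_ ?_)
  · intro s r v
    simp only [Prod.smul_fst, Prod.smul_snd, Prod.smul_mk, Complex.real_smul, Prod.mk.injEq]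
    constructor <;> ring
  · intro s
    have he : Complex.exp (-(Real.pi / 2 * (s : ℝ)) * Complex.I) ≠ 0 := Complex.exp_ne_zero _
    constructor
    · rintro ⟨z, v⟩ ⟨z', v'⟩ h
      simpa [he] using h
    · rintro ⟨z, v⟩
      exact ⟨(_⁻¹ * z, _⁻¹ * v), Prod.ext (mul_inv_cancel_left₀ he z) (mul_inv_cancel_left₀ he v)⟩
  · intro v
    simp
  · intro v hv hv'
    have e : Complex.exp (-(Real.pi / 2 * ((1 : unitInterval) : ℝ)) * Complex.I) =
        -Complex.I := by
      rw [neg_mul, Complex.exp_neg]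
      simp [Complex.exp_pi_div_two_mul_I]
    refine ⟨fun h => mk_mem_twLink_mulPath_comm (by simp only [e]) (by simp only [e]) h,
      fun h => ?_⟩
    -- two quarter-turns multiply by the real scalar `-1`
    have h' := mk_mem_twLink_mulPath_comm (w := (-1 : ℝ) • v)
      (hw := smul_ne_zero (by norm_num) hv) ?_ ?_ h
    · rwa [show (Projectivization.mk ℝ ((-1 : ℝ) • v) _ : RP3) = Projectivization.mk ℝ v hv from
        (Projectivization.mk_eq_mk_iff' ℝ _ _ _ _).2 ⟨-1, rfl⟩] at h'
    · simp only [e]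
      rw [← mul_assoc, neg_mul_neg, Complex.I_mul_I]
      simp
    · simp only [e]
      rw [← mul_assoc, neg_mul_neg, Complex.I_mul_I]
      simp

theorem Closes.conj {g : BraidClass n} {L : Set RP3} (hL : Closes g L) (a : BraidClass n) :
    Closes (a * g * a⁻¹) L := by
  have : Closes (g * a⁻¹ * a) L := by simpa using hL
  simpa [mul_assoc] using this.mul_comm

end BraidClass

/-! ### Paths of ascending configurations -/

/-- The configurations of labelled points such that, for `p < q`, the point `q` is not vertically
below the point `p`. The difference of the points `q` and `p` stays in a plane slit along the
negative imaginary axis, which is what makes homotopies of such motions unique. -/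
def Ascending {n : ℕ} (x : Fin n → ℂ) : Prop :=
  ∀ p q, p < q → (x p).re = (x q).re → (x p).im < (x q).im

theorem Ascending.injective {n : ℕ} {x : Fin n → ℂ} (hx : Ascending x) :
    Function.Injective x := by
  intro p q h
  by_contra hne
  rcases lt_or_gt_of_ne hne with hlt | hlt
  · exact (hx p q hlt (by rw [h])).ne (by rw [h])
  · exact (hx q p hlt (by rw [h])).ne (by rw [h])

/-- The set of ascending configurations is star-shaped about a vertical stack of points. -/
theorem starConvex_ascending {n : ℕ} :
    StarConvex ℝ (fun k : Fin n => (k : ℂ) * Complex.I) {x : Fin n → ℂ | Ascending x} := by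
  intro x hx a b ha hb hab p q hpq
  have hpq' : (p : ℝ) < q := by exact_mod_cast hpq
  simp only [Pi.add_apply, Pi.smul_apply, Complex.add_re, Complex.add_im, Complex.real_smul,
    Complex.re_ofReal_mul, Complex.im_ofReal_mul, Complex.mul_I_re, Complex.mul_I_im,
    Complex.natCast_re, Complex.natCast_im]
  intro h
  rcases hb.eq_or_lt with rfl | hb
  · have : a = 1 := by linarith
    subst this
    linarith
  · have h1 : (x p).re = (x q).re := by
      have : b * (x p).re = b * (x q).re := by linarith
      exact mul_left_cancel₀ hb.ne' this
    have h2 := hx p q hpq h1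
    have h3 : b * (x p).im < b * (x q).im := mul_lt_mul_of_pos_left h2 hb
    have h4 : a * (p : ℝ) ≤ a * q := mul_le_mul_of_nonneg_left hpq'.le ha
    linarith

/-- Two motions through ascending configurations with the same endpoints are homotopic, since the
set of these configurations is contractible. -/
theorem homotopic_of_ascending {n : ℕ} {x y : Conf n} {p q : Path x y}
    (hp : ∀ t, Ascending (p t).1) (hq : ∀ t, Ascending (q t).1) : p.Homotopic q := by
  have : ContractibleSpace {x : Fin n → ℂ | Ascending x} :=
    starConvex_ascending.contractibleSpace ⟨(p 0).1, hp 0⟩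
  let ι : C({x : Fin n → ℂ | Ascending x}, Conf n) :=
    ⟨fun x => ⟨x.1, x.2.injective⟩, by fun_prop⟩
  have hx : Ascending x.1 := by simpa using hp 0
  have hy : Ascending y.1 := by simpa using hp 1
  let p' : Path (⟨x.1, hx⟩ : {x : Fin n → ℂ | Ascending x}) ⟨y.1, hy⟩ :=
    ⟨⟨fun t => ⟨(p t).1, hp t⟩, by fun_prop⟩, by simp, by simp⟩
  let q' : Path (⟨x.1, hx⟩ : {x : Fin n → ℂ | Ascending x}) ⟨y.1, hy⟩ :=
    ⟨⟨fun t => ⟨(q t).1, hq t⟩, by fun_prop⟩, by simp, by simp⟩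
  exact (SimplyConnectedSpace.paths_homotopic p' q').map ι

theorem BraidClass.mk_eq_mk_of_ascending {n : ℕ} {π ρ : Equiv.Perm (Fin n)}
    {p : Path (stdConf 1) (stdConf π)} {q : Path (stdConf 1) (stdConf ρ)} (h : π = ρ)
    (hp : ∀ t, Ascending (p t).1) (hq : ∀ t, Ascending (q t).1) :
    BraidClass.mk p = BraidClass.mk q := by
  subst h
  exact mk_eq_mk_of_homotopic (homotopic_of_ascending hp hq) rfl (fun _ => rfl) fun _ => rfl

/-! ### The motion of one letter -/

theorem lo_ne_hi {n : ℕ} (i : Fin (n - 1)) : lo i ≠ hi i := by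
  simp [lo, hi, Fin.ext_iff]

/-- The swap of positions effected by the generator with index `i`. -/
def genSwap {n : ℕ} (i : Fin (n - 1)) : Equiv.Perm (Fin n) := Equiv.swap (lo i) (hi i)

theorem letterStrand_lo {n : ℕ} (l : Fin (n - 1) × Bool) (t : ℝ) :
    letterStrand l (lo l.1) t = pos (lo l.1) + 1 -
      Complex.exp ((((if l.2 then 1 else -1) * Real.pi * Real.smoothTransition t : ℝ) : ℂ) *
        Complex.I) := by
  simp only [letterStrand, true_or, if_true]
  simp only [pos, lo, hi]
  push_cast
  ring

theorem letterStrand_hi {n : ℕ} (l : Fin (n - 1) × Bool) (t : ℝ) :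
    letterStrand l (hi l.1) t = pos (lo l.1) + 1 +
      Complex.exp ((((if l.2 then 1 else -1) * Real.pi * Real.smoothTransition t : ℝ) : ℂ) *
        Complex.I) := by
  simp only [letterStrand, or_true, if_true]
  simp only [pos, lo, hi]
  push_cast
  ring

theorem letterStrand_of_ne {n : ℕ} (l : Fin (n - 1) × Bool) {k : Fin n} (h1 : k ≠ lo l.1)
    (h2 : k ≠ hi l.1) (t : ℝ) : letterStrand l k t = pos k := by
  simp [letterStrand, h1, h2]

theorem pos_hi {n : ℕ} (i : Fin (n - 1)) : (pos (hi i) : ℂ) = pos (lo i) + 2 := by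
  simp only [pos, lo, hi]
  push_cast
  ring

theorem continuous_letterStrand {n : ℕ} (l : Fin (n - 1) × Bool) (k : Fin n) :
    Continuous (letterStrand l k) := by
  have h := Real.smoothTransition.continuous
  unfold letterStrand
  by_cases hk : k = lo l.1 ∨ k = hi l.1
  · simp only [if_pos hk]
    fun_prop
  · simp only [if_neg hk]
    fun_prop

theorem letterStrand_of_nonpos {n : ℕ} (l : Fin (n - 1) × Bool) (k : Fin n) {t : ℝ}
    (ht : t ≤ 0) : letterStrand l k t = pos k := by
  by_cases h1 : k = lo l.1
  · rw [h1, letterStrand_lo, Real.smoothTransition.zero_of_nonpos ht]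
    simp
  by_cases h2 : k = hi l.1
  · rw [h2, letterStrand_hi, Real.smoothTransition.zero_of_nonpos ht, pos_hi]
    simp only [mul_zero, Complex.ofReal_zero, zero_mul, Complex.exp_zero]
    ring
  · exact letterStrand_of_ne l h1 h2 t

theorem letterStrand_of_one_le {n : ℕ} (l : Fin (n - 1) × Bool) (k : Fin n) {t : ℝ}
    (ht : 1 ≤ t) : letterStrand l k t = pos (genSwap l.1 k) := by
  have he : Complex.exp ((((if l.2 then 1 else -1) * Real.pi * 1 : ℝ) : ℂ) * Complex.I) = -1 := by
    split_ifs
    · simp [Complex.exp_pi_mul_I]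
    · simp [Complex.exp_neg, Complex.exp_pi_mul_I]
  by_cases h1 : k = lo l.1
  · rw [h1, letterStrand_lo, Real.smoothTransition.one_of_one_le ht, he, genSwap,
      Equiv.swap_apply_left, pos_hi]
    ring
  by_cases h2 : k = hi l.1
  · rw [h2, letterStrand_hi, Real.smoothTransition.one_of_one_le ht, he, genSwap,
      Equiv.swap_apply_right]
    ring
  · rw [letterStrand_of_ne l h1 h2, genSwap, Equiv.swap_apply_of_ne_of_ne h1 h2]

/-- During a letter, two points of which at least one is at rest have distinct real parts. -/
theorem letterStrand_re_ne {n : ℕ} (l : Fin (n - 1) × Bool) {j k : Fin n} (hjk : j ≠ k)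
    (h1 : k ≠ lo l.1) (h2 : k ≠ hi l.1) (t : ℝ) :
    (letterStrand l j t).re ≠ (letterStrand l k t).re := by
  rw [letterStrand_of_ne l h1 h2, pos_re]
  have hk : k.val < (lo l.1).val ∨ (lo l.1).val + 2 ≤ k.val := by
    have := Fin.val_ne_of_ne h1
    have := Fin.val_ne_of_ne h2
    simp only [lo, hi] at *
    omega
  have hk' : (k : ℝ) + 1 ≤ (lo l.1 : ℝ) ∨ (lo l.1 : ℝ) + 2 ≤ k := by
    rcases hk with h | h
    · left; exact_mod_cast h
    · right; exact_mod_cast h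
  have hc := fun θ : ℝ => Real.neg_one_le_cos θ
  have hc' := fun θ : ℝ => Real.cos_le_one θ
  by_cases hj1 : j = lo l.1
  · rw [hj1, letterStrand_lo]
    simp only [Complex.add_re, Complex.sub_re, Complex.one_re, Complex.exp_ofReal_mul_I_re, pos_re]
    intro h
    have h3 := hc ((if l.2 then 1 else -1) * Real.pi * Real.smoothTransition t)
    have h4 := hc' ((if l.2 then 1 else -1) * Real.pi * Real.smoothTransition t)
    rcases hk' with h' | h' <;> linarith
  by_cases hj2 : j = hi l.1
  · rw [hj2, letterStrand_hi]
    simp only [Complex.add_re, Complex.one_re, Complex.exp_ofReal_mul_I_re, pos_re]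
    intro h
    have h3 := hc ((if l.2 then 1 else -1) * Real.pi * Real.smoothTransition t)
    have h4 := hc' ((if l.2 then 1 else -1) * Real.pi * Real.smoothTransition t)
    rcases hk' with h' | h' <;> linarith
  · rw [letterStrand_of_ne l hj1 hj2, ← pos_re]
    intro h
    exact hjk (pos_injective (Complex.ext h (by rw [pos_im, pos_im])))

theorem letterStrand_injective {n : ℕ} (l : Fin (n - 1) × Bool) (t : ℝ) :
    Function.Injective fun k => letterStrand l k t := by
  intro j k h
  by_contra hjk
  dsimp only at h
  have key : letterStrand l (lo l.1) t ≠ letterStrand l (hi l.1) t := by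
    rw [letterStrand_lo, letterStrand_hi]
    intro h
    refine Complex.exp_ne_zero ((((if l.2 then 1 else -1) * Real.pi *
      Real.smoothTransition t : ℝ) : ℂ) * Complex.I) ?_
    linear_combination -h / 2
  by_cases hk : k = lo l.1 ∨ k = hi l.1
  · by_cases hj : j = lo l.1 ∨ j = hi l.1
    · rcases hj with rfl | rfl <;> rcases hk with rfl | rfl
      · exact hjk rfl
      · exact key h
      · exact key h.symm
      · exact hjk rfl
    · push Not at hj
      exact letterStrand_re_ne l (Ne.symm hjk) hj.1 hj.2 t (by rw [h])
  · push Not at hk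
    exact letterStrand_re_ne l hjk hk.1 hk.2 t (by rw [h])

/-! ### The motion of a word -/

/-- The position in which the strand that starts in the position `k` ends. -/
def endPerm {n : ℕ} : BraidWord n → Equiv.Perm (Fin n)
  | [] => 1
  | l :: w => endPerm w * genSwap l.1

theorem strand_of_nonpos {n : ℕ} (w : BraidWord n) (k : Fin n) {t : ℝ} (ht : t ≤ 0) :
    strand w k t = pos k := by
  cases w with
  | nil => rfl
  | cons l w => rw [strand, if_pos (by linarith), letterStrand_of_nonpos l k ht]

theorem strand_of_length_le {n : ℕ} (w : BraidWord n) (k : Fin n) {t : ℝ}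
    (ht : (w.length : ℝ) ≤ t) : strand w k t = pos (endPerm w k) := by
  induction w generalizing k t with
  | nil => rfl
  | cons l w ih =>
    rw [List.length_cons] at ht
    push_cast at ht
    rw [strand]
    split_ifs with h
    · have h0 : (w.length : ℝ) = 0 := le_antisymm (by linarith) (Nat.cast_nonneg _)
      have h0' : w = [] := List.length_eq_zero_iff.1 (by exact_mod_cast h0)
      subst h0'
      rw [letterStrand_of_one_le l k (by linarith)]
      rfl
    · rw [ih _ (by linarith)]
      rfl

theorem continuous_strand {n : ℕ} (w : BraidWord n) (k : Fin n) : Continuous (strand w k) := by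
  induction w generalizing k with
  | nil => exact continuous_const
  | cons l w ih =>
    have : strand (l :: w) k = fun t => if t ≤ 1 then letterStrand l k t
        else strand w (Equiv.swap (lo l.1) (hi l.1) k) (t - 1) := rfl
    rw [this]
    refine Continuous.if_le (continuous_letterStrand l k) ((ih _).comp (by fun_prop))
      continuous_id continuous_const ?_
    intro t ht
    rw [letterStrand_of_one_le l k (le_of_eq ht.symm), strand_of_nonpos _ _ (by linarith)]
    rfl

theorem strand_injective {n : ℕ} (w : BraidWord n) (t : ℝ) :
    Function.Injective fun k => strand w k t := by
  induction w generalizing t with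
  | nil => exact pos_injective
  | cons l w ih =>
    by_cases h : t ≤ 1
    · simpa only [strand, if_pos h] using letterStrand_injective l t
    · simp only [strand, if_neg h]
      exact (ih (t - 1)).comp (Equiv.injective _)

/-- The geometric braid of a letter. -/
def letterPath {n : ℕ} (l : Fin (n - 1) × Bool) : Path (stdConf 1) (stdConf (genSwap l.1)) where
  toFun t := ⟨fun k => letterStrand l k t, letterStrand_injective l t⟩
  continuous_toFun := Continuous.subtype_mk
    (continuous_pi fun k => (continuous_letterStrand l k).comp continuous_subtype_val) _
  source' := Subtype.ext (funext fun k => letterStrand_of_nonpos l k (by simp))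
  target' := Subtype.ext (funext fun k => letterStrand_of_one_le l k (by simp))

/-- The geometric braid of a word. -/
def wordPath {n : ℕ} (w : BraidWord n) : Path (stdConf 1) (stdConf (endPerm w)) where
  toFun t := ⟨fun k => strand w k (t * (w.length + 1)), strand_injective w _⟩
  continuous_toFun := Continuous.subtype_mk
    (continuous_pi fun k => (continuous_strand w k).comp (by fun_prop)) _
  source' := Subtype.ext (funext fun k => strand_of_nonpos w k (by simp))
  target' := Subtype.ext (funext fun k => strand_of_length_le w k (by simp))

theorem mk_wordPath_nil {n : ℕ} : BraidClass.mk (wordPath ([] : BraidWord n)) = 1 :=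
  BraidClass.mk_eq_mk_of_forall rfl fun _ => rfl

/-- The time change that turns the motion of the word `l :: w`, with `m` the length of `w`, into a
concatenation of two motions at constant speed. -/
def consTime (m : ℕ) (t : unitInterval) : unitInterval :=
  ⟨min (t * (m + 2) / 2) ((1 + (t * (m + 2) - 1) / (m + 1)) / 2), by
    have h0 := t.2.1
    have h1 := t.2.2
    have hm : (0 : ℝ) < (m : ℝ) + 1 := by positivity
    constructor
    · refine le_min (by positivity) ?_
      have : (-1 : ℝ) ≤ ((t : ℝ) * (m + 2) - 1) / (m + 1) := by
        rw [le_div_iff₀ hm]; nlinarith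
      linarith
    · refine (min_le_right _ _).trans ?_
      have : ((t : ℝ) * (m + 2) - 1) / (m + 1) ≤ (1 : ℝ) := by
        rw [div_le_iff₀ hm]; nlinarith
      linarith⟩

theorem consTime_of_le {m : ℕ} {t : unitInterval} (h : (t : ℝ) * (m + 2) ≤ 1) :
    (consTime m t : ℝ) = t * (m + 2) / 2 := by
  refine min_eq_left ?_
  have hm : (0 : ℝ) < (m : ℝ) + 1 := by positivity
  have : (t : ℝ) * (m + 2) - 1 ≤ (t * (m + 2) - 1) / (m + 1) := by
    rw [le_div_iff₀ hm]
    nlinarith [Nat.cast_nonneg (α := ℝ) m]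
  linarith

theorem consTime_of_lt {m : ℕ} {t : unitInterval} (h : 1 < (t : ℝ) * (m + 2)) :
    (consTime m t : ℝ) = (1 + (t * (m + 2) - 1) / (m + 1)) / 2 := by
  refine min_eq_right ?_
  have hm : (0 : ℝ) < (m : ℝ) + 1 := by positivity
  have : ((t : ℝ) * (m + 2) - 1) / (m + 1) ≤ (t : ℝ) * (m + 2) - 1 := by
    rw [div_le_iff₀ hm]
    nlinarith [Nat.cast_nonneg (α := ℝ) m]
  linarith

theorem mk_wordPath_cons {n : ℕ} (l : Fin (n - 1) × Bool) (w : BraidWord n) :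
    BraidClass.mk (wordPath (l :: w)) =
      BraidClass.mk (letterPath l) * BraidClass.mk (wordPath w) := by
  rw [BraidClass.mk_mul_mk]
  have hc : Continuous (consTime w.length) := Continuous.subtype_mk (by fun_prop) _
  have h0 : consTime w.length 0 = 0 := Subtype.ext (by rw [consTime_of_le] <;> simp)
  have h1 : consTime w.length 1 = 1 := by
    refine Subtype.ext ?_
    have hm : (0 : ℝ) < (w.length : ℝ) + 1 := by positivity
    rw [consTime_of_lt (by simp; linarith)]
    simp only [Set.Icc.coe_one]
    field_simp
    ring
  refine BraidClass.mk_eq_mk_of_homotopic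
    (p₁ := (mulPath (letterPath l) (wordPath w)).reparam _ hc h0 h1)
    (q₁ := mulPath (letterPath l) (wordPath w))
    ⟨(Path.Homotopy.reparam _ _ hc h0 h1).symm⟩ rfl (fun t => ?_) fun _ => rfl
  rw [Path.coe_reparam, Function.comp_apply]
  have e : (t : ℝ) * ((l :: w).length + 1) = t * (w.length + 2) := by
    rw [List.length_cons]; push_cast; ring
  refine Subtype.ext (funext fun k => ?_)
  change strand (l :: w) k (t * ((l :: w).length + 1)) = _
  rw [e]
  have hm : (0 : ℝ) < (w.length : ℝ) + 1 := by positivity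
  by_cases h : (t : ℝ) * (w.length + 2) ≤ 1
  · rw [mulPath_of_le _ _ (by rw [consTime_of_le h]; linarith), strand, if_pos h]
    change _ = letterStrand l k (2 * (consTime w.length t : ℝ))
    rw [consTime_of_le h]
    ring_nf
  · have h' := not_le.1 h
    have hpos : 0 < ((t : ℝ) * (w.length + 2) - 1) / (w.length + 1) :=
      div_pos (by linarith) hm
    rw [mulPath_of_not_le _ _ (by rw [consTime_of_lt h']; linarith), strand, if_neg h]
    change _ = strand w (genSwap l.1 k) ((2 * (consTime w.length t : ℝ) - 1) * (w.length + 1))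
    rw [consTime_of_lt h']
    congr 1
    field_simp
    ring

/-! ### Words whose letters cross the strands in ascending order -/

/-- The positive word, read as a braid word. -/
def posWord {n : ℕ} (w : List (Fin (n - 1))) : BraidWord n := w.map fun i => (i, true)

/-- Every letter of the positive word `w` crosses two strands of which the left one has the
smaller label; `a p` is the label of the strand in the position `p` at the beginning. -/
def AscWord {n : ℕ} : Equiv.Perm (Fin n) → List (Fin (n - 1)) → Prop
  | _, [] => True
  | a, i :: w => a (lo i) < a (hi i) ∧ AscWord (a * genSwap i) w

theorem genSwap_inv {n : ℕ} (i : Fin (n - 1)) : (genSwap i)⁻¹ = genSwap i := Equiv.swap_inv _ _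

/-- The motion of an ascending word goes through ascending configurations: a positive crossing moves
the strand that starts on the right, which has the larger label, above the other one. -/
theorem ascending_strand {n : ℕ} {a : Equiv.Perm (Fin n)} {w : List (Fin (n - 1))}
    (h : AscWord a w) (t : ℝ) : Ascending fun p => strand (posWord w) (a⁻¹ p) t := by
  induction w generalizing a t with
  | nil =>
    intro p q hpq hre
    have him : (pos (a⁻¹ p)).im = (pos (a⁻¹ q)).im := by rw [pos_im, pos_im]
    exact absurd (a⁻¹.injective (pos_injective (Complex.ext hre him))) hpq.ne
  | cons i w ih =>
    intro p q hpq
    have hcons : posWord (i :: w) = (i, true) :: posWord w := rfl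
    by_cases ht : t ≤ 1
    · simp only [hcons, strand, if_pos ht]
      have hne : a⁻¹ p ≠ a⁻¹ q := fun h => hpq.ne (a⁻¹.injective h)
      intro hre
      by_cases hq : a⁻¹ q = lo i ∨ a⁻¹ q = hi i
      swap
      · push Not at hq
        exact absurd hre (letterStrand_re_ne (i, true) hne hq.1 hq.2 t)
      by_cases hp : a⁻¹ p = lo i ∨ a⁻¹ p = hi i
      swap
      · push Not at hp
        exact absurd hre.symm (letterStrand_re_ne (i, true) hne.symm hp.1 hp.2 t)
      rcases hp with hp | hp <;> rcases hq with hq | hq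
      · exact absurd (hp.trans hq.symm) hne
      · -- the right strand turns above the left one
        rw [hp, hq] at hre ⊢
        rw [letterStrand_lo (i, true), letterStrand_hi (i, true)] at hre ⊢
        simp only [Complex.add_re, Complex.sub_re, Complex.add_im, Complex.sub_im,
          Complex.exp_ofReal_mul_I_re, Complex.exp_ofReal_mul_I_im, if_true, one_mul] at hre ⊢
        have h0 := Real.smoothTransition.nonneg t
        have h1 := Real.smoothTransition.le_one t
        have hs : 0 ≤ Real.sin (Real.pi * Real.smoothTransition t) :=
          Real.sin_nonneg_of_nonneg_of_le_pi (by positivity) (by nlinarith [Real.pi_pos])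
        have hcos : Real.cos (Real.pi * Real.smoothTransition t) = 0 := by linarith
        have hs' : Real.sin (Real.pi * Real.smoothTransition t) ≠ 0 := by
          intro hs'
          have := Real.sin_sq_add_cos_sq (Real.pi * Real.smoothTransition t)
          rw [hs', hcos] at this
          norm_num at this
        have := lt_of_le_of_ne hs hs'.symm
        linarith
      · have h1 : p = a (hi i) := by rw [← hp]; simp
        have h2 : q = a (lo i) := by rw [← hq]; simp
        rw [h1, h2] at hpq
        exact absurd hpq (not_lt.2 h.1.le)
      · exact absurd (hp.trans hq.symm) hne
    · simp only [hcons, strand, if_neg ht]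
      have := ih h.2 (t - 1) p q hpq
      rw [mul_inv_rev, genSwap_inv] at this
      exact this

theorem mk_posWord_eq_of_ascending {n : ℕ} {w : List (Fin (n - 1))} (h : AscWord 1 w)
    {π : Equiv.Perm (Fin n)} (hπ : endPerm (posWord w) = π) {p : Path (stdConf 1) (stdConf π)}
    (hp : ∀ t, Ascending (p t).1) : BraidClass.mk (wordPath (posWord w)) = BraidClass.mk p :=
  BraidClass.mk_eq_mk_of_ascending hπ (fun _ => ascending_strand h _) hp

theorem mk_posWord_eq {n : ℕ} {w w' : List (Fin (n - 1))} (h : AscWord 1 w) (h' : AscWord 1 w')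
    (he : endPerm (posWord w) = endPerm (posWord w')) :
    BraidClass.mk (wordPath (posWord w)) = BraidClass.mk (wordPath (posWord w')) :=
  mk_posWord_eq_of_ascending h he fun _ => ascending_strand h' _

/-! ### The homomorphism from the braid group -/

theorem mk_wordPath {n : ℕ} (w : BraidWord n) :
    BraidClass.mk (wordPath w) = (w.map fun l => BraidClass.mk (letterPath l)).prod := by
  induction w with
  | nil => exact mk_wordPath_nil
  | cons l w ih => rw [mk_wordPath_cons, ih, List.map_cons, List.prod_cons]

theorem smoothTransition_symm (t : ℝ) :
    Real.smoothTransition (1 - t) = 1 - Real.smoothTransition t := by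
  have h := Real.smoothTransition.pos_denom t
  unfold Real.smoothTransition
  rw [sub_sub_cancel, add_comm (expNegInvGlue (1 - t)), eq_sub_iff_add_eq, ← add_div,
    add_comm (expNegInvGlue (1 - t)), div_self h.ne']

theorem mk_letterPath_inv {n : ℕ} (i : Fin (n - 1)) :
    BraidClass.mk (letterPath (i, false)) = (BraidClass.mk (letterPath (i, true)))⁻¹ := by
  rw [← BraidClass.mk_invPath]
  refine BraidClass.mk_eq_mk_of_forall (genSwap_inv i).symm fun t => Subtype.ext (funext fun k => ?_)
  change letterStrand (i, false) k t = letterStrand (i, true) ((genSwap i)⁻¹ k) (1 - t)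
  rw [genSwap_inv]
  have he : Complex.exp (((Real.pi * (1 - Real.smoothTransition t) : ℝ) : ℂ) * Complex.I) =
      -Complex.exp (((-1 * Real.pi * Real.smoothTransition t : ℝ) : ℂ) * Complex.I) := by
    rw [show ((Real.pi * (1 - Real.smoothTransition t) : ℝ) : ℂ) * Complex.I =
      Real.pi * Complex.I + ((-1 * Real.pi * Real.smoothTransition t : ℝ) : ℂ) * Complex.I by
        push_cast; ring, Complex.exp_add, Complex.exp_pi_mul_I]
    ring
  by_cases h1 : k = lo i
  · rw [h1, genSwap, Equiv.swap_apply_left, letterStrand_lo (i, false), letterStrand_hi (i, true),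
      smoothTransition_symm]
    simp only [if_true, one_mul, he, Bool.false_eq_true, if_false]
    ring
  by_cases h2 : k = hi i
  · rw [h2, genSwap, Equiv.swap_apply_right, letterStrand_hi (i, false), letterStrand_lo (i, true),
      smoothTransition_symm]
    simp only [if_true, one_mul, he, Bool.false_eq_true, if_false]
    ring
  · rw [genSwap, Equiv.swap_apply_of_ne_of_ne h1 h2, letterStrand_of_ne (i, false) h1 h2,
      letterStrand_of_ne (i, true) h1 h2]

theorem endPerm_posWord {n : ℕ} (w : List (Fin (n - 1))) :
    endPerm (posWord w) = ((w.map genSwap).prod)⁻¹ := by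
  induction w with
  | nil => rfl
  | cons i w ih =>
    rw [List.map_cons, List.prod_cons, mul_inv_rev, genSwap_inv, ← ih]
    rfl

/-- Both sides of an Artin relation are ascending words with the same permutation. -/
theorem braidHom_rels (n : ℕ) : ∀ r ∈ artinRels n,
    FreeGroup.lift (fun i : Fin (n - 1) => BraidClass.mk (letterPath (i, true))) r = 1 := by
  have key : ∀ w w' : List (Fin (n - 1)), AscWord 1 w → AscWord 1 w' →
      (w.map genSwap).prod = (w'.map genSwap).prod →
      (w.map fun i => BraidClass.mk (letterPath (i, true))).prod =
        (w'.map fun i => BraidClass.mk (letterPath (i, true))).prod := by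
    intro w w' h h' he
    have := mk_posWord_eq h h' (by rw [endPerm_posWord, endPerm_posWord, he])
    rw [mk_wordPath, mk_wordPath, posWord, posWord, List.map_map, List.map_map] at this
    exact this
  intro r hr
  have hperm := perm_rels n r hr
  rcases hr with ⟨i, j, h, rfl⟩ | ⟨i, j, h, rfl⟩
  all_goals
    have hi' := i.2
    have hj' := j.2
    simp only [map_mul, map_inv, FreeGroup.lift_apply_of, mul_inv_eq_one] at hperm ⊢
  · have := key [i, j] [j, i] ?_ ?_ (by simpa [genSwap] using hperm)
    · simpa using this
    all_goals
      simp only [AscWord, genSwap, Equiv.Perm.mul_apply, Equiv.swap_apply_def, lo, hi,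
        Fin.ext_iff, Equiv.Perm.one_apply, Fin.lt_def, and_true]
      grind
  · have := key [i, j, i] [j, i, j] ?_ ?_ (by simpa [genSwap, mul_assoc] using hperm)
    · simpa [mul_assoc] using this
    all_goals
      simp only [AscWord, genSwap, Equiv.Perm.mul_apply, Equiv.swap_apply_def, lo, hi,
        Fin.ext_iff, Equiv.Perm.one_apply, Fin.lt_def, and_true]
      grind

/-- The homomorphism that sends a braid to the class of its geometric braids. -/
def braidHom (n : ℕ) : BraidGroup n →* BraidClass n := PresentedGroup.toGroup (braidHom_rels n)

theorem braidHom_sigma {n : ℕ} (i : Fin (n - 1)) :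
    braidHom n (sigma i) = BraidClass.mk (letterPath (i, true)) :=
  PresentedGroup.toGroup.of (braidHom_rels n)

theorem braidHom_toBraid {n : ℕ} (w : BraidWord n) :
    braidHom n w.toBraid = BraidClass.mk (wordPath w) := by
  induction w with
  | nil => exact (map_one (braidHom n)).trans mk_wordPath_nil.symm
  | cons l w ih =>
    have h : BraidWord.toBraid (l :: w) = BraidWord.toBraid [l] * BraidWord.toBraid w := by
      change PresentedGroup.mk _ (FreeGroup.mk ([l] ++ w)) = _
      rw [← FreeGroup.mul_mk, map_mul]
      rfl
    rw [h, map_mul, ih, mk_wordPath_cons]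
    congr 1
    obtain ⟨i, b⟩ := l
    cases b with
    | true => exact braidHom_sigma i
    | false =>
      have : BraidWord.toBraid [(i, false)] = (sigma i)⁻¹ := rfl
      rw [this, map_inv, braidHom_sigma, mk_letterPath_inv]

theorem permHom_braidHom {n : ℕ} (X : BraidGroup n) :
    BraidClass.permHom (braidHom n X) = perm n X := by
  have : (BraidClass.permHom.comp (braidHom n)) = perm n := by
    refine PresentedGroup.ext fun i => ?_
    have h1 : braidHom n (PresentedGroup.of i) = _ := braidHom_sigma i
    rw [MonoidHom.comp_apply, h1, BraidClass.permHom_mk, genSwap_inv]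
    exact (PresentedGroup.toGroup.of (perm_rels n)).symm
  rw [← this, MonoidHom.comp_apply]

theorem braidHom_prod {n : ℕ} (w : List (Fin (n - 1))) :
    braidHom n (w.map sigma).prod = BraidClass.mk (wordPath (posWord w)) := by
  rw [mk_wordPath, map_list_prod, posWord, List.map_map, List.map_map]
  congr 2
  funext i
  exact braidHom_sigma i

theorem perm_prod {n : ℕ} (w : List (Fin (n - 1))) :
    perm n (w.map sigma).prod = (w.map genSwap).prod := by
  rw [map_list_prod, List.map_map]
  exact congrArg (fun f => (w.map f).prod)
    (funext fun i => PresentedGroup.toGroup.of (perm_rels n))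

/-! ### Crossings of positive words -/

section Crossings

variable {n : ℕ}

theorem genSwap_lt_genSwap {i : Fin (n - 1)} {x y : Fin n} (h : x < y)
    (hne : ¬ (x = lo i ∧ y = hi i)) : genSwap i x < genSwap i y := by
  simp only [genSwap, Equiv.swap_apply_def, lo, hi, Fin.ext_iff, Fin.lt_def] at *
  grind

theorem length_crossings (a : Equiv.Perm (Fin n)) (w : List (Fin (n - 1))) :
    (crossings a w).length = w.length := by
  induction w generalizing a with
  | nil => rfl
  | cons i w ih => simp [crossings, ih]

theorem crossings_cons (a : Equiv.Perm (Fin n)) (i : Fin (n - 1)) (w : List (Fin (n - 1))) :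
    crossings a (i :: w) = s(a (lo i), a (hi i)) :: crossings (a * genSwap i) w := rfl

theorem mul_genSwap_inv_apply (a : Equiv.Perm (Fin n)) (i : Fin (n - 1)) (p : Fin n) :
    (a * genSwap i)⁻¹ p = genSwap i (a⁻¹ p) := by
  rw [mul_inv_rev, genSwap_inv, Equiv.Perm.mul_apply]

/-- If no two strands cross twice, and none cross that have already changed their order, then
every crossing is between strands in ascending order. -/
theorem ascWord_of_nodup {a : Equiv.Perm (Fin n)} {w : List (Fin (n - 1))}
    (hinv : ∀ p q, p < q → a⁻¹ q < a⁻¹ p → s(p, q) ∉ crossings a w)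
    (hn : (crossings a w).Nodup) : AscWord a w := by
  induction w generalizing a with
  | nil => trivial
  | cons i w ih =>
    rw [crossings_cons, List.nodup_cons] at hn
    have hlt : lo i < hi i := by simp [lo, hi, Fin.lt_def]
    have h1 : a (lo i) < a (hi i) := by
      by_contra hlt'
      have hne : a (hi i) ≠ a (lo i) := fun h => lo_ne_hi i (a.injective h).symm
      refine hinv _ _ (lt_of_le_of_ne (not_lt.1 hlt') hne) (by simpa using hlt) ?_
      rw [crossings_cons, Sym2.eq_swap]
      exact List.mem_cons_self
    refine ⟨h1, ih (fun p q hpq hlt' hmem => ?_) hn.2⟩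
    rw [mul_genSwap_inv_apply, mul_genSwap_inv_apply] at hlt'
    by_cases hc : a⁻¹ p = lo i ∧ a⁻¹ q = hi i
    · rw [← hc.1, ← hc.2] at hn
      simp only [Equiv.Perm.inv_def, Equiv.apply_symm_apply] at hn
      exact hn.1 hmem
    · rcases lt_trichotomy (a⁻¹ p) (a⁻¹ q) with h | h | h
      · exact absurd (genSwap_lt_genSwap h hc) (not_lt.2 hlt'.le)
      · exact hpq.ne (a⁻¹.injective h)
      · exact hinv p q hpq h (by rw [crossings_cons]; exact List.mem_cons_of_mem _ hmem)

theorem lt_of_mem_crossings {a : Equiv.Perm (Fin n)} {w : List (Fin (n - 1))} (h : AscWord a w)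
    {p q : Fin n} (hpq : p < q) (hm : s(p, q) ∈ crossings a w) : a⁻¹ p < a⁻¹ q := by
  induction w generalizing a with
  | nil => simp [crossings] at hm
  | cons i w ih =>
    have hlt : lo i < hi i := by simp [lo, hi, Fin.lt_def]
    rw [crossings_cons, List.mem_cons] at hm
    rcases hm with hm | hm
    · rcases Sym2.eq_iff.1 hm with ⟨rfl, rfl⟩ | ⟨rfl, rfl⟩
      · simpa using hlt
      · exact absurd hpq (not_lt.2 h.1.le)
    · have h1 := ih h.2 hm
      rw [mul_genSwap_inv_apply, mul_genSwap_inv_apply] at h1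
      by_contra hle
      have hne : a⁻¹ q ≠ a⁻¹ p := fun h => hpq.ne (a⁻¹.injective h).symm
      have hlt' : a⁻¹ q < a⁻¹ p := lt_of_le_of_ne (not_lt.1 hle) hne
      by_cases hc : a⁻¹ q = lo i ∧ a⁻¹ p = hi i
      · have e1 : q = a (lo i) := by rw [← hc.1]; simp
        have e2 : p = a (hi i) := by rw [← hc.2]; simp
        rw [e1, e2] at hpq
        exact absurd hpq (not_lt.2 h.1.le)
      · exact absurd (genSwap_lt_genSwap hlt' hc) (not_lt.2 h1.le)

theorem nodup_crossings {a : Equiv.Perm (Fin n)} {w : List (Fin (n - 1))} (h : AscWord a w) :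
    (crossings a w).Nodup := by
  induction w generalizing a with
  | nil => exact List.nodup_nil
  | cons i w ih =>
    rw [crossings_cons, List.nodup_cons]
    refine ⟨fun hm => ?_, ih h.2⟩
    have hlt : lo i < hi i := by simp [lo, hi, Fin.lt_def]
    have h1 := lt_of_mem_crossings h.2 h.1 hm
    rw [mul_genSwap_inv_apply, mul_genSwap_inv_apply] at h1
    simp only [Equiv.Perm.inv_def, Equiv.symm_apply_apply] at h1
    rw [genSwap, Equiv.swap_apply_left, Equiv.swap_apply_right] at h1
    exact absurd h1 (not_lt.2 hlt.le)

/-- Two strands that change their order cross. -/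
theorem mem_crossings {a : Equiv.Perm (Fin n)} {w : List (Fin (n - 1))} {p q : Fin n}
    (h : a⁻¹ p < a⁻¹ q)
    (h' : (a * (w.map genSwap).prod)⁻¹ q < (a * (w.map genSwap).prod)⁻¹ p) :
    s(p, q) ∈ crossings a w := by
  induction w generalizing a with
  | nil =>
    rw [List.map_nil, List.prod_nil, mul_one] at h'
    exact absurd h (not_lt.2 h'.le)
  | cons i w ih =>
    rw [crossings_cons, List.mem_cons]
    by_cases hc : a⁻¹ p = lo i ∧ a⁻¹ q = hi i
    · left
      rw [← hc.1, ← hc.2]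
      simp
    · right
      refine ih ?_ ?_
      · rw [mul_genSwap_inv_apply, mul_genSwap_inv_apply]
        exact genSwap_lt_genSwap h hc
      · rwa [List.map_cons, List.prod_cons, ← mul_assoc] at h'

theorem ascWord_append {a : Equiv.Perm (Fin n)} {w v : List (Fin (n - 1))} :
    AscWord a (w ++ v) ↔ AscWord a w ∧ AscWord (a * (w.map genSwap).prod) v := by
  induction w generalizing a with
  | nil => simp [AscWord]
  | cons i w ih =>
    simp only [List.cons_append, AscWord, ih, List.map_cons, List.prod_cons, and_assoc, mul_assoc]

theorem eq_revPerm_of_forall {a : Equiv.Perm (Fin n)} (h : ∀ i : Fin (n - 1), a (hi i) < a (lo i)) :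
    a = Fin.revPerm := by
  cases n with
  | zero => exact Subsingleton.elim _ _
  | succ m =>
    have h1 : StrictMono fun k => Fin.rev (a k) := by
      rw [Fin.strictMono_iff_lt_succ]
      intro i
      exact Fin.rev_lt_rev.2 (h i)
    have h2 : (fun k => Fin.rev (a k)) = id := by
      refine (StrictMono.range_inj h1 strictMono_id).1 ?_
      rw [Set.range_id]
      exact (Fin.rev_bijective.comp a.bijective).surjective.range_eq
    refine Equiv.ext fun k => ?_
    have : Fin.rev (a k) = k := congrFun h2 k
    rw [Fin.revPerm_apply, ← Fin.rev_rev (a k), this]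

theorem length_le_of_ascWord {a : Equiv.Perm (Fin n)} {w : List (Fin (n - 1))}
    (h : AscWord a w) : w.length ≤ Fintype.card (Sym2 (Fin n)) := by
  rw [← length_crossings a w]
  exact (nodup_crossings h).length_le_card

/-- An ascending word can be continued until the order of the strands is reversed. -/
theorem exists_append_revPerm {w : List (Fin (n - 1))} (h : AscWord 1 w) :
    ∃ y, AscWord 1 (w ++ y) ∧ ((w ++ y).map genSwap).prod = Fin.revPerm := by
  induction hk : Fintype.card (Sym2 (Fin n)) - w.length using Nat.strong_induction_on
    generalizing w with
  | _ k ih =>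
    by_cases hex : ∃ i : Fin (n - 1), (w.map genSwap).prod (lo i) < (w.map genSwap).prod (hi i)
    · obtain ⟨i, hi⟩ := hex
      have h1 : AscWord 1 (w ++ [i]) := by
        rw [ascWord_append, one_mul]
        exact ⟨h, hi, trivial⟩
      have h2 := length_le_of_ascWord h1
      obtain ⟨y, hy⟩ := ih (Fintype.card (Sym2 (Fin n)) - (w ++ [i]).length)
        (by rw [List.length_append, List.length_singleton] at *; omega) h1 rfl
      exact ⟨i :: y, by simpa using hy⟩
    · push Not at hex
      refine ⟨[], by simpa using h, ?_⟩
      rw [List.append_nil]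
      refine eq_revPerm_of_forall fun i => lt_of_le_of_ne (hex i) fun he => ?_
      exact lo_ne_hi i ((Equiv.injective _ he).symm)

theorem mem_crossings_of_revPerm {w : List (Fin (n - 1))}
    (h : (w.map genSwap).prod = Fin.revPerm) {z : Sym2 (Fin n)} (hz : ¬ z.IsDiag) :
    z ∈ crossings 1 w := by
  have key : ∀ p q : Fin n, p < q → s(p, q) ∈ crossings 1 w := by
    intro p q hpq
    refine mem_crossings (by simpa using hpq) ?_
    rw [h, one_mul]
    exact Fin.rev_lt_rev.2 hpq
  induction z with
  | _ p q =>
    rw [Sym2.mk_isDiag_iff] at hz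
    rcases lt_or_gt_of_ne hz with h | h
    · exact key p q h
    · rw [Sym2.eq_swap]; exact key q p h

theorem not_isDiag_of_mem_crossings {a : Equiv.Perm (Fin n)} {w : List (Fin (n - 1))}
    {z : Sym2 (Fin n)} (hz : z ∈ crossings a w) : ¬ z.IsDiag := by
  induction w generalizing a with
  | nil => simp [crossings] at hz
  | cons i w ih =>
    rw [crossings_cons, List.mem_cons] at hz
    rcases hz with rfl | hz
    · rw [Sym2.mk_isDiag_iff]
      exact fun h => lo_ne_hi i (a.injective h)
    · exact ih hz

theorem card_toFinset_crossings {w : List (Fin (n - 1))}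
    (h : (w.map genSwap).prod = Fin.revPerm) : (crossings 1 w).toFinset.card = n.choose 2 := by
  have : (crossings 1 w).toFinset = Finset.univ.filter fun z : Sym2 (Fin n) => ¬ z.IsDiag := by
    ext z
    simp only [List.mem_toFinset, Finset.mem_filter, Finset.mem_univ, true_and]
    exact ⟨not_isDiag_of_mem_crossings, mem_crossings_of_revPerm h⟩
  rw [this, ← Fintype.card_subtype, Sym2.card_subtype_not_diag, Fintype.card_fin]

theorem length_of_ascWord_revPerm {w : List (Fin (n - 1))} (h : AscWord 1 w)
    (h' : (w.map genSwap).prod = Fin.revPerm) : w.length = n.choose 2 := by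
  rw [← card_toFinset_crossings h', List.toFinset_card_of_nodup (nodup_crossings h),
    length_crossings]

theorem ascWord_one_of_nodup {w : List (Fin (n - 1))} (h : (crossings 1 w).Nodup) :
    AscWord 1 w :=
  ascWord_of_nodup (fun p q hpq hqp => absurd hpq (not_lt.2 (by simpa using hqp.le))) h

/-- A word that reverses the order of the strands lets any two of them cross, so that no two cross
twice if it has the length `n.choose 2`. -/
theorem ascWord_of_length {w : List (Fin (n - 1))}
    (h : (w.map genSwap).prod = Fin.revPerm) (hl : w.length = n.choose 2) : AscWord 1 w := by
  refine ascWord_one_of_nodup ?_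
  have h1 := card_toFinset_crossings h
  rw [← hl, ← length_crossings 1 w, List.card_toFinset] at h1
  exact List.dedup_eq_self.1 ((List.dedup_sublist _).eq_of_length h1)

end Crossings

/-! ### The Garside element -/

/-- The word that defines the Garside element. -/
def garsideWord (n : ℕ) : List (Fin (n - 1)) :=
  (List.range (n - 1)).flatMap fun i => (List.finRange (n - 1)).take (n - 1 - i)

theorem prod_map_flatMap {α β M : Type*} [Monoid M] (l : List α) (g : α → List β) (f : β → M) :
    ((l.flatMap g).map f).prod = (l.map fun i => ((g i).map f).prod).prod := by
  induction l with
  | nil => rfl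
  | cons x l ih => simp [ih]

theorem garside_eq (n : ℕ) : garside n = ((garsideWord n).map sigma).prod :=
  (prod_map_flatMap _ _ _).symm

theorem length_garsideWord (n : ℕ) : (garsideWord n).length = n.choose 2 := by
  have h : (garsideWord n).length = ∑ i ∈ Finset.range (n - 1), (n - 1 - i) := by
    rw [garsideWord, List.length_flatMap, ← List.sum_toFinset _ List.nodup_range]
    simp only [List.length_take, List.length_finRange, List.toFinset_range]
    exact Finset.sum_congr rfl fun i _ => by omega
  rw [h]
  cases n with
  | zero => rfl
  | succ m =>
    rw [Nat.add_sub_cancel]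
    clear h
    induction m with
    | zero => rfl
    | succ m ih =>
      rw [Finset.sum_range_succ', Nat.choose_succ_succ', Nat.choose_one_right, ← ih, add_comm]
      simp

/-- The product of the first `m` transpositions is the cycle that raises `0, …, m - 1` by one and
sends `m` to `0`. -/
theorem prod_take_apply {n m : ℕ} (hm : m ≤ n - 1) (k : Fin n) :
    ((((List.finRange (n - 1)).take m).map genSwap).prod k : ℕ) =
      if (k : ℕ) < m then (k : ℕ) + 1 else if (k : ℕ) = m then 0 else k := by
  induction m generalizing k with
  | zero => simp
  | succ m ih =>
    rw [List.take_add_one, List.map_append, List.prod_append, Equiv.Perm.mul_apply, ih (by omega)]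
    have : (List.finRange (n - 1))[m]? = some ⟨m, hm⟩ := by
      rw [List.getElem?_eq_getElem (by simpa using hm)]
      simp
    rw [this]
    simp only [Option.toList_some, List.map_cons, List.map_nil, List.prod_singleton]
    simp only [genSwap, Equiv.swap_apply_def, lo, hi, Fin.ext_iff]
    split_ifs <;> simp_all <;> omega

theorem prod_garsideWord (n : ℕ) : ((garsideWord n).map genSwap).prod = Fin.revPerm := by
  rw [garsideWord, prod_map_flatMap]
  have key : ∀ j ≤ n - 1, ∀ k : Fin n,
      (((List.range j).map fun i =>
        (((List.finRange (n - 1)).take (n - 1 - i)).map genSwap).prod).prod k : ℕ) =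
      if (k : ℕ) + j < n then (k : ℕ) + j else n - 1 - k := by
    intro j
    induction j with
    | zero => intro _ k; simp
    | succ j ih =>
      intro hj k
      rw [List.range_succ, List.map_append, List.prod_append, Equiv.Perm.mul_apply,
        ih (by omega), List.map_singleton, List.prod_singleton, prod_take_apply (by omega)]
      have := k.2
      split_ifs <;> omega
  ext k
  rw [key _ le_rfl, Fin.revPerm_apply, Fin.val_rev]
  have := k.2
  split_ifs <;> omega

theorem ascWord_garsideWord (n : ℕ) : AscWord 1 (garsideWord n) :=
  ascWord_of_length (prod_garsideWord n) (length_garsideWord n)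

theorem exponentSum_prod {n : ℕ} (w : List (Fin (n - 1))) :
    exponentSum (w.map sigma).prod = w.length := by
  induction w with
  | nil => exact congrArg Multiplicative.toAdd (map_one (exponentSumHom n))
  | cons i w ih =>
    have h : exponentSumHom n (sigma i) = Multiplicative.ofAdd 1 :=
      PresentedGroup.toGroup.of (exponentSum_rels n)
    rw [exponentSum] at ih ⊢
    rw [List.map_cons, List.prod_cons, map_mul, toAdd_mul, ih, h, List.length_cons]
    push_cast
    exact add_comm _ _

theorem exponentSum_mul {n : ℕ} (X Y : BraidGroup n) :
    exponentSum (X * Y) = exponentSum X + exponentSum Y := by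
  rw [exponentSum, map_mul, toAdd_mul]
  rfl

/-! ### Products of all the generators -/

theorem sigma_commute {n : ℕ} {i j : Fin (n - 1)} (h : (i : ℕ) + 2 ≤ j) :
    Commute (sigma i : BraidGroup n) (sigma j) := by
  have := PresentedGroup.mk_eq_one_iff (rels := artinRels n)
    (x := (FreeGroup.of i * FreeGroup.of j) * (FreeGroup.of j * FreeGroup.of i)⁻¹) |>.2
    (Subgroup.subset_normalClosure (Or.inl ⟨i, j, h, rfl⟩))
  rw [map_mul, map_inv, mul_inv_eq_one, map_mul, map_mul] at this
  exact this

theorem commute_prod {n : ℕ} {u v : List (Fin (n - 1))}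
    (h : ∀ i ∈ u, ∀ j ∈ v, (i : ℕ) + 2 ≤ j) :
    Commute (u.map sigma).prod ((v.map sigma).prod : BraidGroup n) := by
  refine Commute.list_prod_left _ _ fun x hx => Commute.list_prod_right _ _ fun y hy => ?_
  obtain ⟨i, hi, rfl⟩ := List.mem_map.1 hx
  obtain ⟨j, hj, rfl⟩ := List.mem_map.1 hy
  exact sigma_commute (h i hi j hj)

/-- The products of all generators, each once, in the various orders, are conjugate: the next
generator is moved to the left past those that commute with `σ_0 ⋯ σ_{k-1}`, which are then moved
to the end by a conjugation. -/
theorem exists_conj_prod {n : ℕ} {w : List (Fin (n - 1))} (hw : w.Perm (List.finRange (n - 1))) :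
    ∃ a : BraidGroup n, a * (w.map sigma).prod * a⁻¹ = ((List.finRange (n - 1)).map sigma).prod := by
  have key : ∀ k ≤ n - 1, ∃ (a : BraidGroup n) (z : List (Fin (n - 1))),
      z.Perm ((List.finRange (n - 1)).drop k) ∧ a * (w.map sigma).prod * a⁻¹ =
        (((List.finRange (n - 1)).take k).map sigma).prod * (z.map sigma).prod := by
    intro k
    induction k with
    | zero => exact fun _ => ⟨1, w, by simpa using hw, by simp⟩
    | succ k ih =>
      intro hk
      obtain ⟨a, z, hz, ha⟩ := ih (by omega)
      have hk' : k < (List.finRange (n - 1)).length := by simpa using hk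
      rw [List.drop_eq_getElem_cons hk'] at hz
      obtain ⟨u, v, rfl⟩ := List.append_of_mem (hz.mem_iff.2 List.mem_cons_self)
      have huv : (u ++ v).Perm ((List.finRange (n - 1)).drop (k + 1)) :=
        (List.perm_middle.symm.trans hz).cons_inv
      refine ⟨((u.map sigma).prod)⁻¹ * a, v ++ u, List.perm_append_comm.trans huv, ?_⟩
      have hcomm : Commute (((List.finRange (n - 1)).take k).map sigma).prod
          ((u.map sigma).prod : BraidGroup n) := by
        refine commute_prod fun i hi j hj => ?_
        have hj' := huv.mem_iff.1 (List.mem_append_left v hj)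
        obtain ⟨x, hx, rfl⟩ := List.mem_take_iff_getElem.1 hi
        obtain ⟨y, hy, rfl⟩ := List.mem_drop_iff_getElem.1 hj'
        simp only [List.getElem_finRange, Fin.val_cast]
        omega
      have e : (((List.finRange (n - 1)).take (k + 1)).map (sigma (n := n))).prod =
          (((List.finRange (n - 1)).take k).map sigma).prod *
            sigma (List.finRange (n - 1))[k] := by
        rw [← List.take_concat_get' _ _ hk', List.map_append, List.prod_append]
        simp
      rw [e, mul_inv_rev, inv_inv]
      calc _ = ((u.map sigma).prod)⁻¹ * (a * (w.map sigma).prod * a⁻¹) * (u.map sigma).prod := by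
            group
        _ = _ := by
            rw [ha]
            simp only [List.map_append, List.map_cons, List.prod_append, List.prod_cons]
            rw [← mul_assoc _ (u.map sigma).prod, hcomm.eq]
            group
  obtain ⟨a, z, hz, ha⟩ := key (n - 1) le_rfl
  rw [List.drop_of_length_le (by simp)] at hz
  rw [hz.eq_nil, List.take_of_length_le (by simp)] at ha
  exact ⟨a, by simpa using ha⟩

/-- The permutations that preserve the set of the positions `0, …, i`. -/
def cutSubgroup {n : ℕ} (i : ℕ) : Subgroup (Equiv.Perm (Fin n)) where
  carrier := {σ | ∀ x, (σ x : ℕ) ≤ i ↔ (x : ℕ) ≤ i}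
  mul_mem' {σ τ} hσ hτ x := (hσ (τ x)).trans (hτ x)
  one_mem' _ := Iff.rfl
  inv_mem' {σ} hσ x := by have := hσ (σ⁻¹ x); simpa using this.symm

/-- A word of `n - 1` letters with a transitive permutation contains every generator exactly once: if
`σ_i` were missing, then the positions `0, …, i` would be preserved. -/
theorem perm_finRange_of_sameCycle {n : ℕ} {w : List (Fin (n - 1))} (hl : w.length = n - 1)
    (h : ∀ j k, ((w.map genSwap).prod).SameCycle j k) : w.Perm (List.finRange (n - 1)) := by
  have hsub : List.finRange (n - 1) ⊆ w := by
    intro i _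
    by_contra hi'
    have hmem : (w.map genSwap).prod ∈ cutSubgroup (n := n) i := by
      refine Subgroup.list_prod_mem _ fun x hx => ?_
      obtain ⟨j, hj, rfl⟩ := List.mem_map.1 hx
      have hne : (j : ℕ) ≠ i := fun h => hi' (Fin.ext h ▸ hj)
      intro x
      simp only [genSwap, Equiv.swap_apply_def, lo, hi, Fin.ext_iff]
      split_ifs <;> simp only <;> omega
    obtain ⟨z, hz⟩ := h (lo i) (hi i)
    have := (Subgroup.zpow_mem _ hmem z) (lo i)
    rw [hz] at this
    simp [lo, hi] at this
  exact ((List.subperm_of_subset (List.nodup_finRange _) hsub).perm_of_length_le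
    (by simp [hl])).symm

theorem isCycle_and_card_support_iff {d : ℕ} (hd : 2 ≤ d) (σ : Equiv.Perm (Fin d)) :
    (σ.IsCycle ∧ σ.support.card = d) ↔ ∀ j k, σ.SameCycle j k := by
  constructor
  · rintro ⟨hc, hs⟩ j k
    have hu : σ.support = Finset.univ := by
      rw [← Finset.card_eq_iff_eq_univ, hs, Fintype.card_fin]
    have h : ∀ x, σ x ≠ x := fun x => Equiv.Perm.mem_support.1 (hu ▸ Finset.mem_univ x)
    exact hc.sameCycle (h j) (h k)
  · intro h
    have hne : ∀ x, σ x ≠ x := by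
      intro x hx
      have : Nontrivial (Fin d) := Fin.nontrivial_iff_two_le.2 hd
      obtain ⟨y, hy⟩ := exists_ne x
      exact hy ((h x y).eq_of_left hx).symm
    refine ⟨⟨⟨0, by omega⟩, hne _, fun y _ => h _ y⟩, ?_⟩
    have : σ.support = Finset.univ :=
      Finset.eq_univ_iff_forall.2 fun x => Equiv.Perm.mem_support.2 (hne x)
    rw [this, Finset.card_univ, Fintype.card_fin]

/-! ### The half-turn and the projective closure -/

theorem pos_rev {n : ℕ} (k : Fin n) : (pos (Fin.rev k) : ℂ) = -pos k := by
  have h : ((Fin.rev k : ℕ) : ℂ) = n - (k + 1) := by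
    rw [Fin.val_rev, Nat.cast_sub k.2]
    push_cast
    ring
  rw [pos, pos, h]
  ring

/-- The geometric braid in which all points make a half-turn about `0`. -/
def turnPath (n : ℕ) : Path (stdConf (n := n) 1) (stdConf Fin.revPerm) where
  toFun t := ⟨fun k => Complex.exp (((Real.pi * (t : ℝ) : ℝ) : ℂ) * Complex.I) * pos k,
    (mul_right_injective₀ (Complex.exp_ne_zero _)).comp pos_injective⟩
  continuous_toFun := Continuous.subtype_mk (continuous_pi fun k => by fun_prop) _
  source' := Subtype.ext (funext fun k => by simp [stdConf])
  target' := Subtype.ext (funext fun k => by simp [stdConf, pos_rev, Complex.exp_pi_mul_I])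

theorem ascending_turnPath {n : ℕ} (t : unitInterval) : Ascending (turnPath n t).1 := by
  intro p q hpq
  change (_ * _ : ℂ).re = (_ * _ : ℂ).re → (_ * _ : ℂ).im < (_ * _ : ℂ).im
  have hlt : (pos p).re < (pos q).re := by
    rw [pos_re, pos_re]
    have : (p : ℝ) < q := by exact_mod_cast hpq
    linarith
  simp only [Complex.mul_re, Complex.mul_im, pos_im, Complex.exp_ofReal_mul_I_re,
    Complex.exp_ofReal_mul_I_im, mul_zero, sub_zero, zero_add]
  intro h
  have hcos : Real.cos (Real.pi * t) = 0 := by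
    by_contra hne
    exact hlt.ne (mul_left_cancel₀ hne h)
  have hs : 0 ≤ Real.sin (Real.pi * t) :=
    Real.sin_nonneg_of_nonneg_of_le_pi (mul_nonneg Real.pi_pos.le t.2.1)
      (by nlinarith [Real.pi_pos, t.2.2])
  have hs' : Real.sin (Real.pi * t) ≠ 0 := by
    intro hs'
    have := Real.sin_sq_add_cos_sq (Real.pi * t)
    rw [hs', hcos] at this
    norm_num at this
  exact mul_lt_mul_of_pos_left hlt (lt_of_le_of_ne hs hs'.symm)

theorem revPerm_inv {n : ℕ} : (Fin.revPerm : Equiv.Perm (Fin n))⁻¹ = Fin.revPerm := rfl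

/-- Every word in which any two strands cross exactly once represents the half-turn. -/
theorem mk_posWord_of_revPerm {n : ℕ} {w : List (Fin (n - 1))} (h : AscWord 1 w)
    (h' : (w.map genSwap).prod = Fin.revPerm) :
    braidHom n (w.map sigma).prod = BraidClass.mk (turnPath n) := by
  rw [braidHom_prod]
  exact mk_posWord_eq_of_ascending h (by rw [endPerm_posWord, h', revPerm_inv])
    ascending_turnPath

theorem braidHom_garside (n : ℕ) : braidHom n (garside n) = BraidClass.mk (turnPath n) := by
  rw [garside_eq]
  exact mk_posWord_of_revPerm (ascWord_garsideWord n) (prod_garsideWord n)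

/-- A motion of points, seen from the frame that makes a half-turn. -/
def untwist {n : ℕ} {π : Equiv.Perm (Fin n)} (p : Path (stdConf 1) (stdConf π)) :
    Path (stdConf 1) (stdConf (Fin.revPerm * π)) where
  toFun t := ⟨fun k => Complex.exp (((-(Real.pi * (t : ℝ)) : ℝ) : ℂ) * Complex.I) * (p t).1 k,
    (mul_right_injective₀ (Complex.exp_ne_zero _)).comp (p t).2⟩
  continuous_toFun := by
    refine Continuous.subtype_mk (continuous_pi fun k => ?_) _
    have : Continuous fun t => (p t).1 k :=
      (continuous_apply k).comp (continuous_subtype_val.comp p.continuous)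
    fun_prop
  source' := Subtype.ext (funext fun k => by
    rw [p.source]
    simp [stdConf])
  target' := Subtype.ext (funext fun k => by
    rw [p.target]
    simp [stdConf, pos_rev, Complex.exp_pi_mul_I, Complex.exp_neg])

/-- The half-turn of the frame may be postponed until the motion of the points is over. -/
theorem mk_untwist {n : ℕ} {π : Equiv.Perm (Fin n)} (p : Path (stdConf 1) (stdConf π)) :
    BraidClass.mk (untwist p) = BraidClass.mk p * (BraidClass.mk (turnPath n))⁻¹ := by
  rw [← BraidClass.mk_invPath, BraidClass.mk_mul_mk]
  -- the two motions are images of two paths in a square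
  let Q : C(unitInterval × unitInterval, Conf n) :=
    ⟨fun x => ⟨fun k => Complex.exp (((-(Real.pi * (x.1 : ℝ)) : ℝ) : ℂ) * Complex.I) *
      (p x.2).1 k, (mul_right_injective₀ (Complex.exp_ne_zero _)).comp (p x.2).2⟩, by
        refine Continuous.subtype_mk (continuous_pi fun k => ?_) _
        have : Continuous fun x : unitInterval × unitInterval => (p x.2).1 k :=
          (continuous_apply k).comp
            (continuous_subtype_val.comp (p.continuous.comp continuous_snd))
        exact Continuous.mul (by fun_prop) this⟩
  have hproj : Continuous (Set.projIcc (0 : ℝ) 1 zero_le_one) := continuous_projIcc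
  have : ContractibleSpace unitInterval :=
    (convex_Icc (0 : ℝ) 1).contractibleSpace ⟨0, by simp⟩
  let diag : Path ((0, 0) : unitInterval × unitInterval) (1, 1) :=
    ⟨⟨fun t => (t, t), by fun_prop⟩, rfl, rfl⟩
  let edge : Path ((0, 0) : unitInterval × unitInterval) (1, 1) :=
    ⟨⟨fun t => (Set.projIcc (0 : ℝ) 1 zero_le_one (2 * t - 1),
      Set.projIcc (0 : ℝ) 1 zero_le_one (2 * t)), by fun_prop⟩,
      Prod.ext (Set.projIcc_of_le_left zero_le_one (by simp))
        (Set.projIcc_of_le_left zero_le_one (by simp)),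
      Prod.ext (Set.projIcc_of_right_le zero_le_one (by norm_num))
        (Set.projIcc_of_right_le zero_le_one (by norm_num))⟩
  refine BraidClass.mk_eq_mk_of_homotopic
    ((SimplyConnectedSpace.paths_homotopic diag edge).map Q) rfl (fun _ => rfl) fun t => ?_
  refine Subtype.ext (funext fun k => ?_)
  change _ = Complex.exp (((-(Real.pi * ((Set.projIcc (0 : ℝ) 1 zero_le_one (2 * (t : ℝ) - 1) :
    unitInterval) : ℝ)) : ℝ) : ℂ) * Complex.I) *
      (p (Set.projIcc (0 : ℝ) 1 zero_le_one (2 * (t : ℝ)))).1 k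
  by_cases h : (t : ℝ) ≤ 1 / 2
  · rw [mulPath_of_le _ _ h, Set.projIcc_of_le_left _ (by linarith),
      Set.projIcc_of_mem _ ⟨by linarith [t.2.1], by linarith⟩]
    simp
  · rw [mulPath_of_not_le _ _ h,
      Set.projIcc_of_mem _ ⟨by linarith [not_le.1 h], by linarith [t.2.2]⟩,
      Set.projIcc_of_right_le _ (by linarith [not_le.1 h])]
    have e1 : (p ⟨1, Set.right_mem_Icc.2 zero_le_one⟩) = stdConf π := p.target
    rw [e1]
    change Complex.exp (((Real.pi * (1 - (2 * (t : ℝ) - 1)) : ℝ) : ℂ) * Complex.I) *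
      pos (Fin.rev (π k)) = _ * pos (π k)
    rw [pos_rev, show (((Real.pi * (1 - (2 * (t : ℝ) - 1)) : ℝ) : ℂ) * Complex.I) =
      Real.pi * Complex.I + ((-(Real.pi * (2 * (t : ℝ) - 1)) : ℝ) : ℂ) * Complex.I by
        push_cast; ring, Complex.exp_add, Complex.exp_pi_mul_I]
    ring

/-- The projective closure is the link of the same motion, seen from the turning frame. -/
theorem projClosure_eq {n : ℕ} (w : BraidWord n) :
    projClosure w = twLink fun t => (untwist (wordPath w) t).1 := by
  have hm : (0 : ℝ) < (w.length : ℝ) + 1 := by positivity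
  have e : ∀ (τ : ℝ) (u : ℂ), Complex.exp (((Real.pi * τ : ℝ) : ℂ) * Complex.I) *
      (Complex.exp (((-(Real.pi * τ) : ℝ) : ℂ) * Complex.I) * u) = u := by
    intro τ u
    rw [← mul_assoc, ← Complex.exp_add, ← add_mul, ← Complex.ofReal_add, add_neg_cancel]
    simp
  ext x
  constructor
  · rintro ⟨k, t, ht, rfl⟩
    refine ⟨⟨t / (w.length + 1), div_nonneg ht.1 hm.le, (div_le_one hm).2 ht.2⟩, k, ?_⟩
    congr 1
    refine Prod.ext (by simp only [mul_div_assoc]) ?_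
    change _ = Complex.exp _ * (Complex.exp _ * strand w k (t / (w.length + 1) * (w.length + 1)))
    rw [e, div_mul_cancel₀ _ hm.ne']
  · rintro ⟨t, k, rfl⟩
    refine ⟨k, t * (w.length + 1), ⟨mul_nonneg t.2.1 hm.le, by nlinarith [t.2.2]⟩, ?_⟩
    congr 1
    have e2 : Real.pi * ((t : ℝ) * (w.length + 1)) / (w.length + 1) = Real.pi * t := by
      field_simp
    refine Prod.ext (by simp only [e2]) ?_
    exact e t (strand w k (t * (w.length + 1)))

/-- The projective closure of a braid `X` is the link of the class of `X Δ⁻¹`. -/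
theorem closes_of_isProjectiveClosure {n : ℕ} {X : BraidGroup n} {L : Set RP3}
    (h : IsProjectiveClosure X L) :
    BraidClass.Closes (braidHom n (X * (garside n)⁻¹)) L := by
  obtain ⟨w, rfl, hL⟩ := h
  rw [map_mul, map_inv, braidHom_garside, braidHom_toBraid, ← mk_untwist]
  refine (BraidClass.closes_mk _).congr ?_
  rwa [← projClosure_eq]

/-! ### Components -/

/-- The part of the link that is swept out by the point `k`. -/
def component {n : ℕ} {π : Equiv.Perm (Fin n)} (p : Path (stdConf 1) (stdConf π)) (k : Fin n) :
    Set RP3 :=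
  Set.range fun t : unitInterval => (Projectivization.mk ℝ
    (Complex.exp (((Real.pi * (t : ℝ) : ℝ) : ℂ) * Complex.I),
      Complex.exp (((Real.pi * (t : ℝ) : ℝ) : ℂ) * Complex.I) * (p t).1 k)
      (exp_pair_ne_zero _ _) : RP3)

theorem twLink_eq_iUnion {n : ℕ} {π : Equiv.Perm (Fin n)} (p : Path (stdConf 1) (stdConf π)) :
    (twLink fun t => (p t).1) = ⋃ k, component p k := by
  ext x
  simp only [Set.mem_iUnion, component, Set.mem_range]
  constructor
  · rintro ⟨t, k, rfl⟩; exact ⟨k, t, rfl⟩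
  · rintro ⟨k, t, rfl⟩; exact ⟨t, k, rfl⟩

theorem continuous_component {n : ℕ} {π : Equiv.Perm (Fin n)}
    (p : Path (stdConf 1) (stdConf π)) (k : Fin n) :
    Continuous fun t : unitInterval => (Projectivization.mk ℝ
      (Complex.exp (((Real.pi * (t : ℝ) : ℝ) : ℂ) * Complex.I),
        Complex.exp (((Real.pi * (t : ℝ) : ℝ) : ℂ) * Complex.I) * (p t).1 k)
        (exp_pair_ne_zero _ _) : RP3) := by
  have : Continuous fun t => (p t).1 k :=
    (continuous_apply k).comp (continuous_subtype_val.comp p.continuous)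
  exact continuous_mk (f := fun t : unitInterval =>
    (Complex.exp (((Real.pi * (t : ℝ) : ℝ) : ℂ) * Complex.I),
      Complex.exp (((Real.pi * (t : ℝ) : ℝ) : ℂ) * Complex.I) * (p t).1 k)) (by fun_prop)
      fun _ => exp_pair_ne_zero _ _

/-- The component of `k` ends where that of `π k` begins, because `[-1 : -u] = [1 : u]`. -/
theorem component_inter_nonempty {n : ℕ} {π : Equiv.Perm (Fin n)}
    (p : Path (stdConf 1) (stdConf π)) (k : Fin n) :
    (component p k ∩ component p (π k)).Nonempty := by
  refine ⟨_, ⟨1, rfl⟩, ⟨0, ?_⟩⟩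
  refine (Projectivization.mk_eq_mk_iff' ℝ _ _ _ _).2 ⟨-1, ?_⟩
  rw [p.source, p.target]
  simp [stdConf, Complex.exp_pi_mul_I]

theorem sameCycle_of_component_inter {n : ℕ} {π : Equiv.Perm (Fin n)}
    {p : Path (stdConf 1) (stdConf π)} {j k : Fin n}
    (h : (component p j ∩ component p k).Nonempty) : π.SameCycle j k := by
  obtain ⟨x, ⟨t, rfl⟩, ⟨s, hs⟩⟩ := h
  obtain ⟨r, hr⟩ := (Projectivization.mk_eq_mk_iff' ℝ _ _ _ _).1 hs
  have h1 : (r : ℂ) * Complex.exp (((Real.pi * (t : ℝ) : ℝ) : ℂ) * Complex.I) =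
      Complex.exp (((Real.pi * (s : ℝ) : ℝ) : ℂ) * Complex.I) := congrArg Prod.fst hr
  have h2 : (r : ℂ) * (Complex.exp (((Real.pi * (t : ℝ) : ℝ) : ℂ) * Complex.I) * (p t).1 j) =
      Complex.exp (((Real.pi * (s : ℝ) : ℝ) : ℂ) * Complex.I) * (p s).1 k :=
    congrArg Prod.snd hr
  rw [← mul_assoc, h1] at h2
  have h3 : (p t).1 j = (p s).1 k := mul_left_cancel₀ (Complex.exp_ne_zero _) h2
  -- the angles agree up to multiples of `π`, so that the times agree or are `0` and `1`
  have h4 : Real.sin (Real.pi * s - Real.pi * t) = 0 := by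
    have : (r : ℂ) = Complex.exp (((Real.pi * (s : ℝ) - Real.pi * t : ℝ) : ℂ) * Complex.I) := by
      rw [Complex.ofReal_sub, sub_mul, Complex.exp_sub, ← h1,
        mul_div_cancel_right₀ _ (Complex.exp_ne_zero _)]
    rw [← Complex.exp_ofReal_mul_I_im, ← this, Complex.ofReal_im]
  obtain ⟨m, hm⟩ := Real.sin_eq_zero_iff.1 h4
  have hm' : (m : ℝ) = s - t :=
    mul_right_cancel₀ Real.pi_pos.ne' (by linarith)
  have hs0 := s.2.1
  have hs1 := s.2.2
  have ht0 := t.2.1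
  have ht1 := t.2.2
  have hm1 : m ≤ 1 := by exact_mod_cast (by linarith : (m : ℝ) ≤ 1)
  have hm2 : -1 ≤ m := by exact_mod_cast (by linarith : (-1 : ℝ) ≤ m)
  interval_cases m
  · push_cast at hm'
    have es : (s : ℝ) = 0 := by linarith
    have et : (t : ℝ) = 1 := by linarith
    obtain rfl : s = 0 := Subtype.ext es
    obtain rfl : t = 1 := Subtype.ext et
    rw [p.source, p.target] at h3
    exact ⟨1, by simpa using pos_injective h3⟩
  · obtain rfl : s = t := Subtype.ext (by push_cast at hm'; linarith)
    rw [(p s).2 h3]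
  · push_cast at hm'
    have es : (s : ℝ) = 1 := by linarith
    have et : (t : ℝ) = 0 := by linarith
    obtain rfl : s = 1 := Subtype.ext es
    obtain rfl : t = 0 := Subtype.ext et
    rw [p.source, p.target] at h3
    exact Equiv.Perm.SameCycle.symm ⟨1, by simpa using (pos_injective h3).symm⟩

theorem sameCycle_of_isConnected {n : ℕ} {π : Equiv.Perm (Fin n)}
    {p : Path (stdConf 1) (stdConf π)} (h : IsConnected (twLink fun t => (p t).1)) (j k : Fin n) :
    π.SameCycle j k := by
  rw [twLink_eq_iUnion] at h
  have hclosed : ∀ k, IsClosed (component p k) := fun k =>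
    (isCompact_range (continuous_component p k)).isClosed
  -- the union of the components in the orbit of `j`, and the union of the others
  have hA : IsClosed (⋃ i ∈ {i | π.SameCycle j i}, component p i) :=
    (Set.toFinite _).isClosed_biUnion fun i _ => hclosed i
  have hB : IsClosed (⋃ i ∈ {i | ¬ π.SameCycle j i}, component p i) :=
    (Set.toFinite _).isClosed_biUnion fun i _ => hclosed i
  by_contra hjk
  have hne : ∀ i, (component p i).Nonempty := fun i => Set.range_nonempty _
  have h1 := isPreconnected_closed_iff.1 h.isPreconnected _ _ hA hB ?_ ?_ ?_
  · obtain ⟨x, -, hx1, hx2⟩ := h1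
    simp only [Set.mem_iUnion, Set.mem_ofPred_eq] at hx1 hx2
    obtain ⟨a, ha, hxa⟩ := hx1
    obtain ⟨b, hb, hxb⟩ := hx2
    exact hb (ha.trans (sameCycle_of_component_inter ⟨x, hxa, hxb⟩))
  · refine Set.iUnion_subset fun i => ?_
    by_cases hi : π.SameCycle j i
    · exact (Set.subset_biUnion_of_mem (u := fun i => component p i)
        (show i ∈ {i | π.SameCycle j i} from hi)).trans Set.subset_union_left
    · exact (Set.subset_biUnion_of_mem (u := fun i => component p i)
        (show i ∈ {i | ¬ π.SameCycle j i} from hi)).trans Set.subset_union_right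
  · obtain ⟨x, hx⟩ := hne j
    exact ⟨x, Set.mem_iUnion.2 ⟨j, hx⟩, Set.mem_biUnion (show j ∈ {i | π.SameCycle j i} from
      Equiv.Perm.SameCycle.refl _ _) hx⟩
  · obtain ⟨x, hx⟩ := hne k
    exact ⟨x, Set.mem_iUnion.2 ⟨k, hx⟩,
      Set.mem_biUnion (show k ∈ {i | ¬ π.SameCycle j i} from hjk) hx⟩

theorem isConnected_of_sameCycle {n : ℕ} [Nonempty (Fin n)] {π : Equiv.Perm (Fin n)}
    (p : Path (stdConf 1) (stdConf π)) (h : ∀ j k, π.SameCycle j k) :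
    IsConnected (twLink fun t => (p t).1) := by
  rw [twLink_eq_iUnion]
  refine IsConnected.iUnion_of_reflTransGen
    (fun k => isConnected_range (continuous_component p k)) fun j k => ?_
  obtain ⟨m, -, -, rfl⟩ := (h j k).exists_pow_eq π
  induction m with
  | zero => exact Relation.ReflTransGen.refl
  | succ m ih =>
    refine ih.tail ?_
    rw [pow_succ', Equiv.Perm.mul_apply]
    exact component_inter_nonempty p _

theorem sameCycle_permHom {n : ℕ} {π : Equiv.Perm (Fin n)} {p : Path (stdConf 1) (stdConf π)}
    {j k : Fin n} : (BraidClass.permHom (BraidClass.mk p)).SameCycle j k ↔ π.SameCycle j k := by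
  rw [BraidClass.permHom_mk, Equiv.Perm.sameCycle_inv]

theorem BraidClass.Closes.sameCycle {n : ℕ} {g : BraidClass n} {L : Set RP3} (h : Closes g L)
    (hL : IsKnot L) (j k : Fin n) : (permHom g).SameCycle j k := by
  obtain ⟨π, p, rfl, hp⟩ := h
  exact sameCycle_permHom.2 (sameCycle_of_isConnected (hp.isConnected_iff.2 hL) j k)

theorem BraidClass.Closes.isKnot {n : ℕ} [Nonempty (Fin n)] {g : BraidClass n} {L : Set RP3}
    (h : Closes g L) (hg : ∀ j k, (permHom g).SameCycle j k) : IsKnot L := by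
  obtain ⟨π, p, rfl, hp⟩ := h
  exact hp.isConnected_iff.1 (isConnected_of_sameCycle p fun j k => sameCycle_permHom.1 (hg j k))

/-! ### Projective torus links as closures of rotations -/

/-- The angles, in clockwise direction, of `n` points that rotate counterclockwise by `2π / n`. -/
def rotAngle (n : ℕ) (t : ℝ) (k : Fin n) : ℝ := 2 * Real.pi * (k - t) / n

/-- The motion of `n` equidistant points on the unit circle that rotate by `2π / n`. -/
def rotation (n : ℕ) (t : ℝ) (k : Fin n) : ℂ :=
  Complex.exp (((-rotAngle n t k : ℝ) : ℂ) * Complex.I)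

/-- The rotating points at the time `t` are the `n`-th roots of `e ^ (2πit)`. -/
theorem exists_eq_rotation_iff {n : ℕ} (hn : n ≠ 0) (t : ℝ) (u : ℂ) :
    (∃ k : Fin n, u = rotation n t k) ↔
      u ^ n = Complex.exp (((2 * Real.pi * t : ℝ) : ℂ) * Complex.I) := by
  have hn' : (n : ℂ) ≠ 0 := by exact_mod_cast hn
  have hζ := (Complex.isPrimitiveRoot_exp n hn).inv
  set ζ := (Complex.exp (2 * Real.pi * Complex.I / n))⁻¹ with hζdef
  have hpow : ∀ k : ℕ, ζ ^ k = Complex.exp (-(k * (2 * Real.pi * Complex.I / n))) := by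
    intro k
    rw [hζdef, inv_pow, ← Complex.exp_nat_mul, Complex.exp_neg]
  have hrot : ∀ k : Fin n, rotation n t k =
      ζ ^ (k : ℕ) * Complex.exp (2 * Real.pi * t / n * Complex.I) := by
    intro k
    rw [hpow, ← Complex.exp_add, rotation, rotAngle]
    congr 1
    push_cast
    field_simp
    ring
  have he : Complex.exp (2 * Real.pi * t / n * Complex.I) ^ n =
      Complex.exp (((2 * Real.pi * t : ℝ) : ℂ) * Complex.I) := by
    rw [← Complex.exp_nat_mul]
    congr 1
    push_cast
    field_simp
  constructor
  · rintro ⟨k, rfl⟩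
    rw [hrot, mul_pow, he, ← pow_mul, mul_comm (k : ℕ), pow_mul, hζ.pow_eq_one, one_pow, one_mul]
  · intro hu
    have : NeZero n := ⟨hn⟩
    have hne : Complex.exp (2 * Real.pi * t / n * Complex.I) ≠ 0 := Complex.exp_ne_zero _
    obtain ⟨k, hk, hk'⟩ := hζ.eq_pow_of_pow_eq_one
      (ξ := u / Complex.exp (2 * Real.pi * t / n * Complex.I))
      (by rw [div_pow, he, hu, div_self (Complex.exp_ne_zero _)])
    exact ⟨⟨k, hk⟩, by rw [hrot, hk', div_mul_cancel₀ _ hne]⟩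

/-- Up to sign, a complex number of norm `1` has an angle in `[0, π]`. -/
theorem exists_eq_exp_of_norm_eq_one {z : ℂ} (hz : ‖z‖ = 1) : ∃ (t : unitInterval) (r : ℝ),
    r ^ 2 = 1 ∧ z = r * Complex.exp (((Real.pi * (t : ℝ) : ℝ) : ℂ) * Complex.I) := by
  have h1 : Complex.exp (Complex.arg z * Complex.I) = z := by
    simpa [hz] using Complex.norm_mul_exp_arg_mul_I z
  have hπ := Real.pi_pos
  by_cases h : 0 ≤ Complex.arg z
  · refine ⟨⟨Complex.arg z / Real.pi, by positivity,
      (div_le_one hπ).2 (Complex.arg_le_pi z)⟩, 1, by norm_num, ?_⟩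
    simp only [mul_div_cancel₀ _ hπ.ne', h1]
    simp
  · push Not at h
    have h2 := Complex.neg_pi_lt_arg z
    refine ⟨⟨(Complex.arg z + Real.pi) / Real.pi, div_nonneg (by linarith) hπ.le,
      (div_le_one hπ).2 (by linarith)⟩, -1, by norm_num, ?_⟩
    simp only [mul_comm Real.pi, div_mul_cancel₀ _ hπ.ne', Complex.ofReal_add, add_mul,
      Complex.exp_add, Complex.exp_pi_mul_I, h1]
    push_cast
    ring

theorem sq_exp_pi_mul (t : ℝ) : Complex.exp (((Real.pi * t : ℝ) : ℂ) * Complex.I) ^ 2 =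
    Complex.exp (((2 * Real.pi * t : ℝ) : ℂ) * Complex.I) := by
  rw [← Complex.exp_nat_mul]
  congr 1
  push_cast
  ring

theorem norm_exp_ofReal (θ : ℝ) : ‖Complex.exp ((θ : ℂ) * Complex.I)‖ = 1 :=
  Complex.norm_exp_ofReal_mul_I θ

/-- The torus link lies on the torus `|z| = |w| = 1`. -/
theorem norm_eq_one_of_pow_eq {z w : ℂ} {p q : ℕ} (hp : p ≠ 0) (h : z ^ p = w ^ q)
    (h2 : ‖z‖ ^ 2 + ‖w‖ ^ 2 = 2) : ‖z‖ = 1 := by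
  have h' : ‖z‖ ^ p = ‖w‖ ^ q := by rw [← norm_pow, ← norm_pow, h]
  have hz := norm_nonneg z
  have hw := norm_nonneg w
  rcases lt_trichotomy ‖z‖ 1 with hlt | heq | hgt
  · have h1 : 1 ≤ ‖w‖ := by nlinarith
    have := pow_lt_one₀ hz hlt hp
    have := one_le_pow₀ h1 (n := q)
    linarith
  · exact heq
  · have h1 : ‖w‖ ≤ 1 := by nlinarith
    have := one_lt_pow₀ hgt hp
    have := pow_le_one₀ hw h1 (n := q)
    linarith

/-- The points `w = z u` with `u ^ n = z ^ 2` are those with `z ^ (n + 2) = w ^ n`. -/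
theorem twLink_rotation_eq {n : ℕ} (hn : n ≠ 0) :
    (twLink fun t : unitInterval => rotation n t) = Tproj (n + 2) n := by
  ext x
  constructor
  · rintro ⟨t, k, rfl⟩
    refine ⟨_, _, _, ?_, ?_, rfl⟩
    · simp only [rotation, norm_mul, norm_exp_ofReal]
      norm_num
    · rw [mul_pow, (exists_eq_rotation_iff hn t _).1 ⟨k, rfl⟩, ← sq_exp_pi_mul, pow_add]
  · rintro ⟨z, w, h0, h2, hzw, rfl⟩
    have hz : ‖z‖ = 1 := norm_eq_one_of_pow_eq (by omega) hzw h2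
    obtain ⟨t, r, hr, hzt⟩ := exists_eq_exp_of_norm_eq_one hz
    have hz0 : z ≠ 0 := by rintro rfl; simp at hz
    have hr' : (r : ℂ) ^ 2 = 1 := by exact_mod_cast hr
    have hu : (w / z) ^ n = Complex.exp (((2 * Real.pi * (t : ℝ) : ℝ) : ℂ) * Complex.I) := by
      rw [div_pow, ← hzw, ← sq_exp_pi_mul, pow_add, mul_div_cancel_left₀ _ (pow_ne_zero _ hz0)]
      nth_rewrite 1 [hzt]
      rw [mul_pow, hr', one_mul]
    obtain ⟨k, hk⟩ := (exists_eq_rotation_iff hn t _).2 hu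
    refine mk_mem_twLink.2 ⟨t, k, r, by rintro rfl; norm_num at hr, hzt, ?_⟩
    dsimp only
    rw [← hk]
    field_simp

/-- The rotation in the opposite direction gives a torus link with the coordinates exchanged. -/
theorem mk_mem_twLink_rotation_reverse {n : ℕ} (hn : 2 ≤ n) {v : ℂ × ℂ} {hv : v ≠ 0}
    {hv' : (v.2, v.1) ≠ (0 : ℂ × ℂ)} : (Projectivization.mk ℝ v hv : RP3) ∈
      (twLink fun t : unitInterval => rotation n (1 - t)) ↔
        (Projectivization.mk ℝ (v.2, v.1) hv' : RP3) ∈ Tproj n (n - 2) := by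
  have hn0 : n ≠ 0 := by omega
  have he : ∀ t : ℝ, Complex.exp (((2 * Real.pi * (1 - t) : ℝ) : ℂ) * Complex.I) =
      (Complex.exp (((2 * Real.pi * t : ℝ) : ℂ) * Complex.I))⁻¹ := by
    intro t
    rw [← Complex.exp_neg, show (((2 * Real.pi * (1 - t) : ℝ) : ℂ) * Complex.I) =
      -(((2 * Real.pi * t : ℝ) : ℂ) * Complex.I) + 2 * Real.pi * Complex.I by push_cast; ring,
      Complex.exp_add, Complex.exp_two_pi_mul_I, mul_one]
  obtain ⟨m, rfl⟩ : ∃ m, n = m + 2 := ⟨n - 2, by omega⟩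
  rw [Nat.add_sub_cancel]
  constructor
  · rintro ⟨t, k, h⟩
    obtain ⟨r, hr⟩ := (Projectivization.mk_eq_mk_iff' ℝ _ _ _ _).1 h
    have hz0 : Complex.exp (((Real.pi * (t : ℝ) : ℝ) : ℂ) * Complex.I) ≠ 0 :=
      Complex.exp_ne_zero _
    refine ⟨Complex.exp (((Real.pi * (t : ℝ) : ℝ) : ℂ) * Complex.I) * rotation (m + 2) (1 - t) k,
      Complex.exp (((Real.pi * (t : ℝ) : ℝ) : ℂ) * Complex.I),
      fun h => hz0 (congrArg Prod.snd h), ?_, ?_, ?_⟩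
    · rw [norm_mul, rotation, norm_exp_ofReal, norm_exp_ofReal]
      norm_num
    · rw [mul_pow, (exists_eq_rotation_iff hn0 (1 - t) _).1 ⟨k, rfl⟩, he, ← sq_exp_pi_mul,
        pow_add]
      field_simp
    · exact (Projectivization.mk_eq_mk_iff' ℝ _ _ _ _).2 ⟨r, by rw [← hr]; rfl⟩
  · rintro ⟨z, w, h0, h2, hzw, h⟩
    obtain ⟨s, hs⟩ := (Projectivization.mk_eq_mk_iff' ℝ _ _ _ _).1 h
    have hz : ‖z‖ = 1 := norm_eq_one_of_pow_eq (by omega) hzw h2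
    have hw : ‖w‖ = 1 := by
      rw [hz] at h2
      nlinarith [norm_nonneg w]
    obtain ⟨t, r, hr, hwt⟩ := exists_eq_exp_of_norm_eq_one hw
    have hw0 : w ≠ 0 := by rintro rfl; simp at hw
    have hr' : (r : ℂ) ^ 2 = 1 := by exact_mod_cast hr
    have hw2 : w ^ 2 = Complex.exp (((2 * Real.pi * (t : ℝ) : ℝ) : ℂ) * Complex.I) := by
      rw [hwt, mul_pow, hr', one_mul, sq_exp_pi_mul]
    have hu : (z / w) ^ (m + 2) =
        Complex.exp (((2 * Real.pi * (1 - (t : ℝ)) : ℝ) : ℂ) * Complex.I) := by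
      rw [he, ← hw2, div_pow, hzw, pow_add]
      field_simp
    obtain ⟨k, hk⟩ := (exists_eq_rotation_iff hn0 (1 - t) _).2 hu
    have hvw : (Projectivization.mk ℝ v hv : RP3) =
        Projectivization.mk ℝ (w, z) fun h => hw0 (congrArg Prod.fst h) :=
      (Projectivization.mk_eq_mk_iff' ℝ _ _ _ _).2
        ⟨s, Prod.ext (congrArg Prod.snd hs) (congrArg Prod.fst hs)⟩
    rw [hvw]
    refine mk_mem_twLink.2 ⟨t, k, r, by rintro rfl; norm_num at hr, hwt, ?_⟩
    dsimp only
    rw [← hk]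
    field_simp

/-- The exchange of the coordinates is isotopic to the identity: it is the linear map with the
eigenvalues `1` and `-1`, and `-1` can be joined to `1` by the eigenvalues `e ^ (iπs)`. -/
theorem ambientIsotopic_swap {L L' : Set RP3}
    (h : ∀ v (hv : v ≠ 0) (hv' : (v.2, v.1) ≠ (0 : ℂ × ℂ)),
      (Projectivization.mk ℝ v hv : RP3) ∈ L ↔ (Projectivization.mk ℝ (v.2, v.1) hv' : RP3) ∈ L') :
    AmbientIsotopic L L' := by
  refine ambientIsotopic_of_family (fun s v =>
    ((v.1 + v.2) / 2 + Complex.exp (Real.pi * (s : ℝ) * Complex.I) * ((v.1 - v.2) / 2),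
      (v.1 + v.2) / 2 - Complex.exp (Real.pi * (s : ℝ) * Complex.I) * ((v.1 - v.2) / 2)))
    (by fun_prop) ?_ ?_ ?_ ?_
  · intro s r v
    simp only [Prod.smul_fst, Prod.smul_snd, Prod.smul_mk, Complex.real_smul, Prod.mk.injEq]
    constructor <;> ring
  · intro s
    have he : Complex.exp (Real.pi * (s : ℝ) * Complex.I) ≠ 0 := Complex.exp_ne_zero _
    constructor
    · rintro ⟨z, v⟩ ⟨z', v'⟩ h
      simp only [Prod.mk.injEq] at h
      obtain ⟨h1, h2⟩ := h
      have e1 : z + v = z' + v' := by linear_combination h1 + h2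
      have e2 : z - v = z' - v' := by
        refine mul_left_cancel₀ he ?_
        linear_combination h1 - h2
      exact Prod.ext (by linear_combination (e1 + e2) / 2) (by linear_combination (e1 - e2) / 2)
    · rintro ⟨z, v⟩
      refine ⟨((z + v) / 2 + (Complex.exp (Real.pi * (s : ℝ) * Complex.I))⁻¹ * ((z - v) / 2),
        (z + v) / 2 - (Complex.exp (Real.pi * (s : ℝ) * Complex.I))⁻¹ * ((z - v) / 2)), ?_⟩
      refine Prod.ext ?_ ?_ <;> (field_simp; ring)
  · intro v
    refine Prod.ext ?_ ?_ <;> (simp; ring)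
  · intro v hv hv'
    have e : Complex.exp (Real.pi * (((1 : unitInterval) : ℝ) : ℂ) * Complex.I) = -1 := by
      simp [Complex.exp_pi_mul_I]
    have h1 : ((v.1 + v.2) / 2 + Complex.exp (Real.pi * (((1 : unitInterval) : ℝ) : ℂ) *
        Complex.I) * ((v.1 - v.2) / 2), (v.1 + v.2) / 2 - Complex.exp (Real.pi *
        (((1 : unitInterval) : ℝ) : ℂ) * Complex.I) * ((v.1 - v.2) / 2)) = (v.2, v.1) := by
      rw [e]
      refine Prod.ext ?_ ?_ <;> ring
    simp only [h1] at hv' ⊢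
    exact h v hv hv'

theorem ambientIsotopic_rotation_reverse {n : ℕ} (hn : 2 ≤ n) :
    AmbientIsotopic (twLink fun t : unitInterval => rotation n (1 - t)) (Tproj n (n - 2)) :=
  ambientIsotopic_swap fun _ _ _ => mk_mem_twLink_rotation_reverse hn

/-! ### From the product of the generators to a rotation -/

theorem ascWord_take {n m : ℕ} (hm : m ≤ n - 1) :
    AscWord 1 ((List.finRange (n - 1)).take m) := by
  induction m with
  | zero => trivial
  | succ m ih =>
    have hm' : m < (List.finRange (n - 1)).length := by simpa using hm
    rw [← List.take_concat_get' _ _ hm', ascWord_append, one_mul]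
    refine ⟨ih (by omega), ?_, trivial⟩
    rw [Fin.lt_def, prod_take_apply (by omega), prod_take_apply (by omega)]
    simp [lo, hi]

theorem ascWord_finRange (n : ℕ) : AscWord 1 (List.finRange (n - 1)) := by
  have := ascWord_take (n := n) (m := n - 1) le_rfl
  rwa [List.take_of_length_le (by simp)] at this

/-- The permutation of the strands of the product of all generators. -/
def cyclePerm (n : ℕ) : Equiv.Perm (Fin n) := endPerm (posWord (List.finRange (n - 1)))

theorem cyclePerm_apply {n : ℕ} (k : Fin n) :
    (cyclePerm n k : ℕ) = if (k : ℕ) = 0 then n - 1 else (k : ℕ) - 1 := by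
  have h := prod_take_apply (n := n) (m := n - 1) le_rfl (cyclePerm n k)
  rw [List.take_of_length_le (by simp)] at h
  have h1 : ((List.finRange (n - 1)).map genSwap).prod (cyclePerm n k) = k := by
    rw [cyclePerm, endPerm_posWord]
    simp
  rw [h1] at h
  have := (cyclePerm n k).2
  split_ifs at h ⊢ <;> omega

/-- The configurations through which the product of the generators moves the points: the points
other than `0` have increasing real parts, and the point `0` passes below them from the left to
the right. The condition is convex. -/
structure Sliding {n : ℕ} (t : ℝ) (x : Fin n → ℂ) : Prop where
  re_lt : ∀ j k : Fin n, (j : ℕ) ≠ 0 → j < k → (x j).re < (x k).re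
  im_nonneg : ∀ k : Fin n, (k : ℕ) ≠ 0 → 0 ≤ (x k).im
  im_neg : ∀ k : Fin n, (k : ℕ) = 0 → 0 < t → t < 1 → (x k).im < 0
  left : ∀ j k : Fin n, (j : ℕ) = 0 → (k : ℕ) ≠ 0 → t = 0 → (x j).re < (x k).re
  right : ∀ j k : Fin n, (j : ℕ) = 0 → (k : ℕ) ≠ 0 → t = 1 → (x k).re < (x j).re

theorem Sliding.ascending {n : ℕ} {t : ℝ} {x : Fin n → ℂ} (hx : Sliding t x) (h0 : 0 ≤ t)
    (h1 : t ≤ 1) : Ascending x := by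
  intro j k hjk hre
  by_cases hj : (j : ℕ) = 0
  · have hk : (k : ℕ) ≠ 0 := by have := Fin.lt_def.1 hjk; omega
    rcases h0.eq_or_lt with h0 | h0
    · exact absurd hre (hx.left j k hj hk h0.symm).ne
    rcases h1.eq_or_lt with h1 | h1
    · exact absurd hre (hx.right j k hj hk h1).ne'
    exact (hx.im_neg j hj h0 h1).trans_le (hx.im_nonneg k hk)
  · exact absurd hre (hx.re_lt j k hj hjk).ne

theorem convexComb_lt {s a b c d : ℝ} (h0 : 0 ≤ s) (h1 : s ≤ 1) (h : a < b) (h' : c < d) :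
    (1 - s) * a + s * c < (1 - s) * b + s * d := by
  rcases h0.eq_or_lt with rfl | h0
  · linarith
  · have := mul_lt_mul_of_pos_left h' h0
    have := mul_le_mul_of_nonneg_left h.le (sub_nonneg.2 h1)
    linarith

theorem Sliding.convexComb {n : ℕ} {t s : ℝ} {x y : Fin n → ℂ} (hx : Sliding t x)
    (hy : Sliding t y) (h0 : 0 ≤ s) (h1 : s ≤ 1) :
    Sliding t fun k => ((1 - s : ℝ) : ℂ) * x k + (s : ℂ) * y k := by
  have h1' := sub_nonneg.2 h1
  constructor
  all_goals
    simp only [Complex.add_re, Complex.add_im, Complex.re_ofReal_mul, Complex.im_ofReal_mul]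
  · exact fun j k hj hjk => convexComb_lt h0 h1 (hx.re_lt j k hj hjk) (hy.re_lt j k hj hjk)
  · exact fun k hk => add_nonneg (mul_nonneg h1' (hx.im_nonneg k hk))
      (mul_nonneg h0 (hy.im_nonneg k hk))
  · intro k hk ht0 ht1
    simpa using convexComb_lt h0 h1 (hx.im_neg k hk ht0 ht1) (hy.im_neg k hk ht0 ht1)
  · exact fun j k hj hk ht => convexComb_lt h0 h1 (hx.left j k hj hk ht) (hy.left j k hj hk ht)
  · exact fun j k hj hk ht => convexComb_lt h0 h1 (hx.right j k hj hk ht) (hy.right j k hj hk ht)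

/-- The motion in which the point `0` moves along the lower half-circle, and the other points along
the real axis, by one position to the left. -/
def slide (n : ℕ) (t : ℝ) (k : Fin n) : ℂ :=
  if (k : ℕ) = 0 then ((n - 1 : ℝ) : ℂ) * -Complex.exp (((Real.pi * t : ℝ) : ℂ) * Complex.I)
  else pos k - 2 * t

/-- The clockwise angles of points on the unit circle, of which the point `0` moves along the lower
half-circle, and the other points are equidistant on the upper half-circle. -/
def arcAngle (n : ℕ) (t : ℝ) (k : Fin n) : ℝ :=
  if (k : ℕ) = 0 then Real.pi - Real.pi * t else Real.pi + Real.pi * (k - t) / (n - 1)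

/-- The motion on the unit circle with the angles `arcAngle`. -/
def arc (n : ℕ) (t : ℝ) (k : Fin n) : ℂ :=
  Complex.exp (((-arcAngle n t k : ℝ) : ℂ) * Complex.I)

theorem arc_zero {n : ℕ} {t : ℝ} {k : Fin n} (hk : (k : ℕ) = 0) :
    arc n t k = -Complex.exp (((Real.pi * t : ℝ) : ℂ) * Complex.I) := by
  rw [arc, arcAngle, if_pos hk, show ((-(Real.pi - Real.pi * t) : ℝ) : ℂ) * Complex.I =
    ((Real.pi * t : ℝ) : ℂ) * Complex.I - Real.pi * Complex.I by push_cast; ring,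
    Complex.exp_sub, Complex.exp_pi_mul_I, div_neg, div_one]

theorem arc_re {n : ℕ} {t : ℝ} {k : Fin n} (hk : (k : ℕ) ≠ 0) :
    (arc n t k).re = -Real.cos (Real.pi * (k - t) / (n - 1)) := by
  rw [arc, arcAngle, if_neg hk, Complex.exp_ofReal_mul_I_re, Real.cos_neg, add_comm,
    Real.cos_add_pi]

theorem arc_im {n : ℕ} {t : ℝ} {k : Fin n} (hk : (k : ℕ) ≠ 0) :
    (arc n t k).im = Real.sin (Real.pi * (k - t) / (n - 1)) := by
  rw [arc, arcAngle, if_neg hk, Complex.exp_ofReal_mul_I_im, Real.sin_neg, add_comm,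
    Real.sin_add_pi, neg_neg]

theorem natCast_sub_one_pos {n : ℕ} (hn : 2 ≤ n) : (0 : ℝ) < n - 1 := by
  have : (2 : ℝ) ≤ n := by exact_mod_cast hn
  linarith

theorem arc_angle_mem {n : ℕ} (hn : 2 ≤ n) {t : ℝ} (ht0 : 0 ≤ t) (ht1 : t ≤ 1) {k : Fin n}
    (hk : (k : ℕ) ≠ 0) : Real.pi * (k - t) / (n - 1) ∈ Set.Icc 0 Real.pi := by
  have h1 := natCast_sub_one_pos hn
  have h2 : (1 : ℝ) ≤ k := by exact_mod_cast Nat.one_le_iff_ne_zero.2 hk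
  have h3 : (k : ℝ) + 1 ≤ n := by exact_mod_cast k.2
  constructor
  · exact div_nonneg (mul_nonneg Real.pi_pos.le (by linarith)) h1.le
  · rw [div_le_iff₀ h1]
    exact mul_le_mul_of_nonneg_left (by linarith) Real.pi_pos.le

theorem sin_pi_mul_pos {t : ℝ} (h0 : 0 < t) (h1 : t < 1) : 0 < Real.sin (Real.pi * t) :=
  Real.sin_pos_of_pos_of_lt_pi (mul_pos Real.pi_pos h0)
    (by simpa using mul_lt_mul_of_pos_left h1 Real.pi_pos)

theorem sliding_slide {n : ℕ} (hn : 2 ≤ n) (t : ℝ) : Sliding t (slide n t) := by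
  have h1 := natCast_sub_one_pos hn
  have h2 : ∀ k : Fin n, (k : ℕ) ≠ 0 → (1 : ℝ) ≤ k := fun k hk => by
    exact_mod_cast Nat.one_le_iff_ne_zero.2 hk
  have h3 : ∀ k : Fin n, (k : ℝ) + 1 ≤ n := fun k => by exact_mod_cast k.2
  have e : ∀ k : Fin n, (k : ℕ) = 0 → slide n t k =
      ((n - 1 : ℝ) : ℂ) * -Complex.exp (((Real.pi * t : ℝ) : ℂ) * Complex.I) :=
    fun k hk => if_pos hk
  have e' : ∀ k : Fin n, (k : ℕ) ≠ 0 → slide n t k = ((2 * k - (n - 1) - 2 * t : ℝ) : ℂ) := by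
    intro k hk
    rw [slide, if_neg hk, pos]
    push_cast
    ring
  constructor
  · intro j k hj hjk
    have hjk' : (j : ℝ) < k := by exact_mod_cast Fin.lt_def.1 hjk
    rw [e' j hj, e' k (by have := Fin.lt_def.1 hjk; omega), Complex.ofReal_re, Complex.ofReal_re]
    linarith
  · intro k hk
    rw [e' k hk, Complex.ofReal_im]
  · intro k hk ht0 ht1
    rw [e k hk, Complex.im_ofReal_mul, Complex.neg_im, Complex.exp_ofReal_mul_I_im]
    have := mul_pos h1 (sin_pi_mul_pos ht0 ht1)
    linarith
  · intro j k hj hk ht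
    rw [e j hj, e' k hk, Complex.re_ofReal_mul, Complex.neg_re, Complex.exp_ofReal_mul_I_re,
      Complex.ofReal_re, ht, mul_zero, Real.cos_zero]
    linarith [h2 k hk]
  · intro j k hj hk ht
    rw [e j hj, e' k hk, Complex.re_ofReal_mul, Complex.neg_re, Complex.exp_ofReal_mul_I_re,
      Complex.ofReal_re, ht, mul_one Real.pi, Real.cos_pi]
    linarith [h3 k]

theorem sliding_arc {n : ℕ} (hn : 2 ≤ n) {t : ℝ} (ht0 : 0 ≤ t) (ht1 : t ≤ 1) :
    Sliding t (arc n t) := by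
  have h1 := natCast_sub_one_pos hn
  have hπ := Real.pi_pos
  have h2 : ∀ k : Fin n, (k : ℕ) ≠ 0 → (1 : ℝ) ≤ k := fun k hk => by
    exact_mod_cast Nat.one_le_iff_ne_zero.2 hk
  have h3 : ∀ k : Fin n, (k : ℝ) + 1 ≤ n := fun k => by exact_mod_cast k.2
  constructor
  · intro j k hj hjk
    have hk : (k : ℕ) ≠ 0 := by have := Fin.lt_def.1 hjk; omega
    have hjk' : (j : ℝ) < k := by exact_mod_cast Fin.lt_def.1 hjk
    rw [arc_re hj, arc_re hk]
    refine neg_lt_neg (Real.strictAntiOn_cos (arc_angle_mem hn ht0 ht1 hj)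
      (arc_angle_mem hn ht0 ht1 hk) ?_)
    gcongr
  · intro k hk
    have := arc_angle_mem hn ht0 ht1 hk
    rw [arc_im hk]
    exact Real.sin_nonneg_of_nonneg_of_le_pi this.1 this.2
  · intro k hk ht0 ht1
    rw [arc_zero hk, Complex.neg_im, Complex.exp_ofReal_mul_I_im]
    linarith [sin_pi_mul_pos ht0 ht1]
  · intro j k hj hk ht
    have := arc_angle_mem hn ht0 ht1 hk
    rw [arc_zero hj, arc_re hk, Complex.neg_re, Complex.exp_ofReal_mul_I_re]
    refine neg_lt_neg (Real.strictAntiOn_cos (by simp [ht, hπ.le]) this ?_)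
    rw [ht, mul_zero, sub_zero]
    exact div_pos (mul_pos hπ (by linarith [h2 k hk])) h1
  · intro j k hj hk ht
    have := arc_angle_mem hn ht0 ht1 hk
    rw [arc_zero hj, arc_re hk, Complex.neg_re, Complex.exp_ofReal_mul_I_re]
    refine neg_lt_neg (Real.strictAntiOn_cos this (by simp [ht, hπ.le]) ?_)
    rw [ht, mul_one, div_lt_iff₀ h1]
    exact mul_lt_mul_of_pos_left (by linarith [h3 k]) hπ

/-! ### The closure of the product of the generators -/

theorem cyclePerm_of_eq_zero {n : ℕ} {k : Fin n} (hk : (k : ℕ) = 0) :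
    ((cyclePerm n k : ℕ) : ℝ) = n - 1 := by
  rw [cyclePerm_apply, if_pos hk, Nat.cast_sub (by have := k.2; omega), Nat.cast_one]

theorem cyclePerm_of_ne_zero {n : ℕ} {k : Fin n} (hk : (k : ℕ) ≠ 0) :
    ((cyclePerm n k : ℕ) : ℝ) = k - 1 := by
  rw [cyclePerm_apply, if_neg hk, Nat.cast_sub (by omega), Nat.cast_one]

theorem slide_zero {n : ℕ} (k : Fin n) : slide n 0 k = pos k := by
  rw [slide, pos]
  split_ifs with hk
  · simp [hk]
  · simp

theorem slide_one {n : ℕ} (k : Fin n) : slide n 1 k = pos (cyclePerm n k) := by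
  rw [slide, pos, pos, ← Complex.ofReal_natCast (cyclePerm n k : ℕ)]
  split_ifs with hk
  · rw [cyclePerm_of_eq_zero hk, mul_one, Complex.exp_pi_mul_I]
    push_cast
    ring
  · rw [cyclePerm_of_ne_zero hk]
    push_cast
    ring

theorem continuous_slide (n : ℕ) : Continuous fun t : unitInterval => slide n t := by
  refine continuous_pi fun k => ?_
  by_cases hk : (k : ℕ) = 0
  · simp only [slide, if_pos hk]
    fun_prop
  · simp only [slide, if_neg hk]
    fun_prop

/-- The geometric braid `slide`. -/
def slidePath {n : ℕ} (hn : 2 ≤ n) : Path (stdConf 1) (stdConf (cyclePerm n)) where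
  toFun t := ⟨slide n t, ((sliding_slide hn t).ascending t.2.1 t.2.2).injective⟩
  continuous_toFun := (continuous_slide n).subtype_mk _
  source' := Subtype.ext (funext fun k => slide_zero k)
  target' := Subtype.ext (funext fun k => slide_one k)

theorem mk_slidePath {n : ℕ} (hn : 2 ≤ n) :
    BraidClass.mk (slidePath hn) = braidHom n ((List.finRange (n - 1)).map sigma).prod := by
  rw [braidHom_prod]
  exact (mk_posWord_eq_of_ascending (ascWord_finRange n) rfl fun t =>
    (sliding_slide hn t).ascending t.2.1 t.2.2).symm

/-- The angles at the end are those at the beginning, up to the full turn of one point. -/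
theorem arcAngle_one {n : ℕ} (hn : 2 ≤ n) (k : Fin n) :
    arcAngle n 1 k = arcAngle n 0 (cyclePerm n k) - if (k : ℕ) = 0 then 2 * Real.pi else 0 := by
  have h1 := natCast_sub_one_pos hn
  have hc := cyclePerm_apply k
  by_cases hk : (k : ℕ) = 0
  · rw [if_pos hk] at hc
    rw [arcAngle, arcAngle, if_pos hk, if_pos hk, if_neg (by omega), cyclePerm_of_eq_zero hk]
    field_simp
    ring
  · rw [if_neg hk] at hc
    rw [arcAngle, arcAngle, if_neg hk, if_neg hk, cyclePerm_of_ne_zero hk]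
    split_ifs with h0
    · have : (k : ℕ) = 1 := by omega
      simp [this]
    · ring

theorem rotAngle_one {n : ℕ} (k : Fin n) :
    rotAngle n 1 k = rotAngle n 0 (cyclePerm n k) - if (k : ℕ) = 0 then 2 * Real.pi else 0 := by
  have hn : (n : ℝ) ≠ 0 := by have := k.2; exact_mod_cast (by omega : n ≠ 0)
  rw [rotAngle, rotAngle]
  by_cases hk : (k : ℕ) = 0
  · rw [if_pos hk, cyclePerm_of_eq_zero hk, hk]
    push_cast
    field_simp
    ring
  · rw [if_neg hk, cyclePerm_of_ne_zero hk]
    ring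

theorem exp_neg_sub_two_pi (a : ℝ) : Complex.exp (((-(a - 2 * Real.pi) : ℝ) : ℂ) * Complex.I) =
    Complex.exp (((-a : ℝ) : ℂ) * Complex.I) := by
  rw [show ((-(a - 2 * Real.pi) : ℝ) : ℂ) * Complex.I =
    ((-a : ℝ) : ℂ) * Complex.I + 2 * Real.pi * Complex.I by push_cast; ring,
    Complex.exp_add, Complex.exp_two_pi_mul_I, mul_one]

theorem exp_ne_exp_of_sub_mem {a b : ℝ} (h0 : 0 < b - a) (h1 : b - a < 2 * Real.pi) :
    Complex.exp (((-a : ℝ) : ℂ) * Complex.I) ≠ Complex.exp (((-b : ℝ) : ℂ) * Complex.I) := by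
  intro h
  obtain ⟨m, hm⟩ := Complex.exp_eq_exp_iff_exists_int.1 h
  have := congrArg Complex.im hm
  have h2 : b - a = m * (2 * Real.pi) := by
    simp at this
    linarith
  have h3 : (0 : ℝ) < m := by
    by_contra h
    nlinarith [Real.pi_pos]
  have h4 : (m : ℝ) < 1 := by
    by_contra h
    nlinarith [Real.pi_pos]
  have h5 : 0 < m := by exact_mod_cast h3
  have h6 : m < 1 := by exact_mod_cast h4
  omega

theorem arcAngle_sub_mem {n : ℕ} (hn : 2 ≤ n) {t : ℝ} (ht0 : 0 ≤ t) (ht1 : t ≤ 1)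
    {j k : Fin n} (hjk : j < k) : 0 < arcAngle n t k - arcAngle n t j ∧
      arcAngle n t k - arcAngle n t j < 2 * Real.pi := by
  have h1 := natCast_sub_one_pos hn
  have hπ := Real.pi_pos
  have hjk' := Fin.lt_def.1 hjk
  have h2 : (1 : ℝ) ≤ k := by exact_mod_cast (by omega : 1 ≤ (k : ℕ))
  have h3 : (k : ℝ) + 1 ≤ n := by exact_mod_cast k.2
  have hu : (0 : ℝ) < 1 / (n - 1) := by positivity
  have hku : (k : ℝ) * (1 / (n - 1)) ≤ 1 := by
    rw [mul_one_div, div_le_one h1]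
    linarith
  rw [arcAngle, arcAngle, if_neg (by omega : (k : ℕ) ≠ 0)]
  by_cases hj : (j : ℕ) = 0
  · rw [if_pos hj, show Real.pi + Real.pi * (k - t) / (n - 1) - (Real.pi - Real.pi * t) =
      Real.pi * ((k - t) * (1 / (n - 1)) + t) by ring]
    have h4 : (0 : ℝ) ≤ (k - t) * (1 / (n - 1)) := mul_nonneg (by linarith) hu.le
    constructor
    · refine mul_pos hπ ?_
      rcases ht0.eq_or_lt with rfl | ht
      · rw [sub_zero, add_zero]
        positivity
      · linarith
    · rw [mul_comm 2]
      refine mul_lt_mul_of_pos_left ?_ hπ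
      nlinarith [mul_nonneg (sub_nonneg.2 ht1) hu.le]
  · have h5 : (j : ℝ) < k := by exact_mod_cast hjk'
    have h6 : (1 : ℝ) ≤ j := by exact_mod_cast Nat.one_le_iff_ne_zero.2 hj
    rw [if_neg hj, show Real.pi + Real.pi * (k - t) / (n - 1) -
      (Real.pi + Real.pi * (j - t) / (n - 1)) = Real.pi * ((k - j) * (1 / (n - 1))) by ring]
    constructor
    · have := sub_pos.2 h5
      positivity
    · rw [mul_comm 2]
      refine mul_lt_mul_of_pos_left ?_ hπ
      nlinarith

theorem rotAngle_sub_mem {n : ℕ} (t : ℝ) {j k : Fin n} (hjk : j < k) :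
    0 < rotAngle n t k - rotAngle n t j ∧ rotAngle n t k - rotAngle n t j < 2 * Real.pi := by
  have h1 : (j : ℝ) < k := by exact_mod_cast Fin.lt_def.1 hjk
  have h2 : (k : ℝ) + 1 ≤ n := by exact_mod_cast k.2
  have h3 : (0 : ℝ) ≤ j := Nat.cast_nonneg _
  have hn : (0 : ℝ) < n := by linarith
  have hπ := Real.pi_pos
  rw [rotAngle, rotAngle, show 2 * Real.pi * (k - t) / n - 2 * Real.pi * (j - t) / n =
    2 * Real.pi * (k - j) / n by ring]
  constructor
  · have := sub_pos.2 h1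
    positivity
  · rw [div_lt_iff₀ hn]
    exact mul_lt_mul_of_pos_left (by linarith) (by positivity)

/-- The linear homotopy from `slide` to `arc`. -/
def slideToArc (n : ℕ) (s t : unitInterval) (k : Fin n) : ℂ :=
  ((1 - (s : ℝ) : ℝ) : ℂ) * slide n t k + ((s : ℝ) : ℂ) * arc n t k

/-- The homotopy from `arc` to `rotation` that is linear in the angles. -/
def arcToRotation (n : ℕ) (s t : unitInterval) (k : Fin n) : ℂ :=
  Complex.exp (((-((1 - s) * arcAngle n t k + s * rotAngle n t k) : ℝ) : ℂ) * Complex.I)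

theorem continuous_arcAngle {n : ℕ} (k : Fin n) :
    Continuous fun t : unitInterval => arcAngle n t k := by
  by_cases hk : (k : ℕ) = 0
  · simp only [arcAngle, if_pos hk]
    fun_prop
  · simp only [arcAngle, if_neg hk]
    fun_prop

theorem continuous_rotAngle {n : ℕ} (k : Fin n) :
    Continuous fun t : unitInterval => rotAngle n t k := by
  unfold rotAngle
  fun_prop

theorem continuous_slideToArc (n : ℕ) :
    Continuous fun x : unitInterval × unitInterval => slideToArc n x.1 x.2 := by
  refine continuous_pi fun k => ?_
  have h1 : Continuous fun x : unitInterval × unitInterval => slide n x.2 k :=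
    ((continuous_apply k).comp (continuous_slide n)).comp continuous_snd
  have h2 : Continuous fun x : unitInterval × unitInterval => arcAngle n x.2 k :=
    (continuous_arcAngle k).comp continuous_snd
  unfold slideToArc arc
  fun_prop

theorem continuous_arcToRotation (n : ℕ) :
    Continuous fun x : unitInterval × unitInterval => arcToRotation n x.1 x.2 := by
  refine continuous_pi fun k => ?_
  have h1 : Continuous fun x : unitInterval × unitInterval => arcAngle n x.2 k :=
    (continuous_arcAngle k).comp continuous_snd
  have h2 : Continuous fun x : unitInterval × unitInterval => rotAngle n x.2 k :=
    (continuous_rotAngle k).comp continuous_snd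
  unfold arcToRotation
  fun_prop

theorem slideToArc_injective {n : ℕ} (hn : 2 ≤ n) (s t : unitInterval) :
    Function.Injective (slideToArc n s t) :=
  (((sliding_slide hn t).convexComb (sliding_arc hn t.2.1 t.2.2) s.2.1 s.2.2).ascending
    t.2.1 t.2.2).injective

theorem arcToRotation_injective {n : ℕ} (hn : 2 ≤ n) (s t : unitInterval) :
    Function.Injective (arcToRotation n s t) := by
  have h : ∀ j k : Fin n, j < k → arcToRotation n s t j ≠ arcToRotation n s t k := by
    intro j k hjk
    obtain ⟨h1, h2⟩ := arcAngle_sub_mem hn t.2.1 t.2.2 hjk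
    obtain ⟨h3, h4⟩ := rotAngle_sub_mem t hjk
    refine exp_ne_exp_of_sub_mem ?_ ?_
    · linarith [convexComb_lt s.2.1 s.2.2 h1 h3]
    · linarith [convexComb_lt s.2.1 s.2.2 h2 h4]
  intro j k hjk
  rcases lt_trichotomy j k with hlt | heq | hgt
  · exact absurd hjk (h j k hlt)
  · exact heq
  · exact absurd hjk.symm (h k j hgt)

theorem rotation_one {n : ℕ} (k : Fin n) : rotation n 1 k = rotation n 0 (cyclePerm n k) := by
  rw [rotation, rotation, rotAngle_one]
  split_ifs
  · rw [exp_neg_sub_two_pi]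
  · rw [sub_zero]

theorem arc_one {n : ℕ} (hn : 2 ≤ n) (k : Fin n) : arc n 1 k = arc n 0 (cyclePerm n k) := by
  rw [arc, arc, arcAngle_one hn]
  split_ifs
  · rw [exp_neg_sub_two_pi]
  · rw [sub_zero]

theorem slideToArc_one {n : ℕ} (hn : 2 ≤ n) (s : unitInterval) (k : Fin n) :
    slideToArc n s 1 k = slideToArc n s 0 (cyclePerm n k) := by
  simp only [slideToArc, Set.Icc.coe_one, Set.Icc.coe_zero, slide_one, slide_zero, arc_one hn]

theorem arcToRotation_one {n : ℕ} (hn : 2 ≤ n) (s : unitInterval) (k : Fin n) :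
    arcToRotation n s 1 k = arcToRotation n s 0 (cyclePerm n k) := by
  simp only [arcToRotation, Set.Icc.coe_one, Set.Icc.coe_zero, arcAngle_one hn, rotAngle_one]
  split_ifs
  · refine Eq.trans ?_ (exp_neg_sub_two_pi _)
    congr 4
    ring
  · simp

/-- The time-reversed form of `ambientIsotopic_twLink_of_homotopy`. -/
theorem ambientIsotopic_twLink_of_homotopy_symm {n : ℕ}
    (F : unitInterval → unitInterval → Fin n → ℂ)
    (hF : Continuous fun x : unitInterval × unitInterval => F x.1 x.2)
    (hi : ∀ s t, Function.Injective (F s t)) (σ : Equiv.Perm (Fin n))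
    (hσ : ∀ s k, F s 1 k = F s 0 (σ k)) :
    AmbientIsotopic (twLink fun t => F 0 (unitInterval.symm t))
      (twLink fun t => F 1 (unitInterval.symm t)) := by
  refine ambientIsotopic_twLink_of_homotopy (fun s t => F s (unitInterval.symm t))
    (hF.comp (by fun_prop : Continuous fun x : unitInterval × unitInterval =>
      (x.1, unitInterval.symm x.2))) (fun s t => hi s _) σ⁻¹ fun s k => ?_
  simp [hσ]

theorem closes_rotation {n : ℕ} (hn : n ≠ 0) :
    BraidClass.Closes (braidHom n ((List.finRange (n - 1)).map sigma).prod)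
      (twLink fun t : unitInterval => rotation n t) := by
  obtain rfl | hn : n = 1 ∨ 2 ≤ n := by omega
  -- for one strand, `slide` and `arc` degenerate; the resting point is moved linearly instead
  · have e : (List.finRange (1 - 1)) = [] := rfl
    rw [e, List.map_nil, List.prod_nil, map_one, BraidClass.one_def]
    refine (BraidClass.closes_mk _).congr ?_
    have h := ambientIsotopic_twLink_of_homotopy (n := 1)
      (fun s t k => ((s : ℝ) : ℂ) * rotation 1 t k) (by
        refine continuous_pi fun k => ?_
        have h2 : Continuous fun x : unitInterval × unitInterval => rotAngle 1 x.2 k :=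
          (continuous_rotAngle k).comp continuous_snd
        unfold rotation
        fun_prop) (fun s t => Function.injective_of_subsingleton _) (cyclePerm 1)
      (fun s k => by simp only [Set.Icc.coe_one, Set.Icc.coe_zero, rotation_one])
    have e1 : (twLink fun t : unitInterval => ((Path.refl (stdConf (n := 1) 1)) t).1) =
        twLink fun (t : unitInterval) (k : Fin 1) =>
          (((0 : unitInterval) : ℝ) : ℂ) * rotation 1 t k := by
      congr 1
      funext t k
      obtain rfl : k = 0 := Subsingleton.elim _ _
      change pos 0 = _
      simp [pos]
    have e2 : (twLink fun t : unitInterval => rotation 1 t) =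
        twLink fun (t : unitInterval) (k : Fin 1) =>
          (((1 : unitInterval) : ℝ) : ℂ) * rotation 1 t k := by
      congr 1
      funext t k
      simp
    rw [e2]
    exact e1 ▸ h
  · rw [← mk_slidePath hn]
    refine (BraidClass.closes_mk _).congr ?_
    have h1 := ambientIsotopic_twLink_of_homotopy _ (continuous_slideToArc n)
      (slideToArc_injective hn) _ (slideToArc_one hn)
    have h2 := ambientIsotopic_twLink_of_homotopy _ (continuous_arcToRotation n)
      (arcToRotation_injective hn) _ (arcToRotation_one hn)
    have e0 : slideToArc n 0 = fun t : unitInterval => slide n t := by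
      funext t k; simp [slideToArc]
    have e1 : slideToArc n 1 = arcToRotation n 0 := by
      funext t k; simp [slideToArc, arcToRotation, arc]
    have e2 : arcToRotation n 1 = fun t : unitInterval => rotation n t := by
      funext t k; simp [arcToRotation, rotation]
    rw [e0, e1] at h1
    rw [e2] at h2
    exact h1.trans h2

theorem closes_rotation_reverse {n : ℕ} (hn : 2 ≤ n) :
    BraidClass.Closes (braidHom n ((List.finRange (n - 1)).map sigma).prod)⁻¹
      (twLink fun t : unitInterval => rotation n (1 - t)) := by
  rw [← mk_slidePath hn, ← BraidClass.mk_invPath]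
  refine (BraidClass.closes_mk _).congr ?_
  have h1 := ambientIsotopic_twLink_of_homotopy_symm _ (continuous_slideToArc n)
    (slideToArc_injective hn) _ (slideToArc_one hn)
  have h2 := ambientIsotopic_twLink_of_homotopy_symm _ (continuous_arcToRotation n)
    (arcToRotation_injective hn) _ (arcToRotation_one hn)
  have e1 : slideToArc n 1 = arcToRotation n 0 := by
    funext t k; simp [slideToArc, arcToRotation, arc]
  have e2 : (fun t => arcToRotation n 1 (unitInterval.symm t)) =
      fun t : unitInterval => rotation n (1 - t) := by
    funext t k; simp [arcToRotation, rotation]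
  have hinv : ∀ (t : unitInterval) k, (invPath (slidePath hn) t).1 k =
      slideToArc n 0 (unitInterval.symm t) ((cyclePerm n)⁻¹ k) := by
    intro t k
    simp only [slideToArc, Set.Icc.coe_zero]
    norm_num
    rfl
  -- the labels of the points do not matter
  have e0 : (twLink fun t => slideToArc n 0 (unitInterval.symm t)) =
      twLink fun t => (invPath (slidePath hn) t).1 := by
    ext x
    constructor
    · rintro ⟨t, k, rfl⟩
      exact ⟨t, cyclePerm n k, by simp [hinv]⟩
    · rintro ⟨t, k, rfl⟩
      exact ⟨t, (cyclePerm n)⁻¹ k, by simp only [hinv]⟩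
  rw [e1, e0] at h1
  rw [e2] at h2
  exact h1.trans h2

/-! ### Both families of braids reduce to Coxeter elements -/

theorem exists_eq_prod_of_mem_positiveBraids {n : ℕ} {A : BraidGroup n}
    (hA : A ∈ positiveBraids n) : ∃ y : List (Fin (n - 1)), A = (y.map sigma).prod := by
  induction hA using Submonoid.closure_induction with
  | mem _ h =>
    obtain ⟨i, rfl⟩ := h
    exact ⟨[i], by simp⟩
  | one => exact ⟨[], by simp⟩
  | mul _ _ _ _ h h' =>
    obtain ⟨y, rfl⟩ := h
    obtain ⟨y', rfl⟩ := h'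
    exact ⟨y ++ y', by simp⟩

theorem numN_eq_choose (d : ℕ) : numN d = (d - 1).choose 2 := by
  rw [numN, Nat.choose_two_right, Nat.sub_sub]

theorem numN_add {d : ℕ} (hd : 2 ≤ d) : numN d + (d - 1) = d.choose 2 := by
  obtain ⟨m, rfl⟩ : ∃ m, d = m + 1 := ⟨d - 1, by omega⟩
  rw [numN_eq_choose, Nat.choose_succ_succ' m 1, Nat.choose_one_right, Nat.add_sub_cancel,
    add_comm]

/-- A positive word of `n - 1` letters whose permutation is transitive is conjugate to the product
of all generators, so that its closure is the torus link. -/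
theorem ambientIsotopic_Tproj_of_closes {n : ℕ} (hn : n ≠ 0) {y : List (Fin (n - 1))}
    (hy : y.length = n - 1) {L : Set RP3}
    (h : BraidClass.Closes (braidHom n (y.map sigma).prod) L) (hL : IsKnot L) :
    AmbientIsotopic L (Tproj (n + 2) n) := by
  have ht : ∀ j k, ((y.map genSwap).prod).SameCycle j k := fun j k => by
    simpa only [permHom_braidHom, perm_prod] using h.sameCycle hL j k
  obtain ⟨a, ha⟩ := exists_conj_prod (perm_finRange_of_sameCycle hy ht)
  have h' := h.conj (braidHom n a)
  rw [← map_inv, ← map_mul, ← map_mul, ha] at h'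
  rw [← twLink_rotation_eq hn]
  exact h'.ambientIsotopic (closes_rotation hn)

/-- The form of `ambientIsotopic_Tproj_of_closes` for the inverse of a positive word. -/
theorem ambientIsotopic_Tproj_of_closes_inv {n : ℕ} (hn : 2 ≤ n) {y : List (Fin (n - 1))}
    (hy : y.length = n - 1) {L : Set RP3}
    (h : BraidClass.Closes (braidHom n (y.map sigma).prod)⁻¹ L) (hL : IsKnot L) :
    AmbientIsotopic L (Tproj n (n - 2)) := by
  have ht : ∀ j k, ((y.map genSwap).prod).SameCycle j k := fun j k => by
    simpa only [map_inv, permHom_braidHom, perm_prod, Equiv.Perm.sameCycle_inv] using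
      h.sameCycle hL j k
  obtain ⟨a, ha⟩ := exists_conj_prod (perm_finRange_of_sameCycle hy ht)
  have h' := h.conj (braidHom n a)
  rw [← map_inv, ← map_inv, ← map_mul, ← map_mul, ← conj_inv, ha, map_inv] at h'
  exact (h'.ambientIsotopic (closes_rotation_reverse hn)).trans
    (ambientIsotopic_rotation_reverse hn)

theorem isKnot_iff_of_isProjectiveClosure {d : ℕ} (hd : 2 ≤ d) {X : BraidGroup d} {L : Set RP3}
    (h : IsProjectiveClosure X L) : IsKnot L ↔ (perm d (X * garside d)).IsCycle ∧
      (perm d (X * garside d)).support.card = d := by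
  have hg : perm d (garside d) = Fin.revPerm := by
    rw [garside_eq, perm_prod, prod_garsideWord]
  have hp : BraidClass.permHom (braidHom d (X * (garside d)⁻¹)) = perm d (X * garside d) := by
    rw [permHom_braidHom, map_mul, map_mul, map_inv, hg, revPerm_inv]
  have hc := closes_of_isProjectiveClosure h
  have : Nonempty (Fin d) := ⟨⟨0, by omega⟩⟩
  rw [isCycle_and_card_support_iff hd, ← hp]
  exact ⟨fun hL => hc.sameCycle hL, hc.isKnot⟩

/-- A permutation braid divides the Garside element: the quotient is a positive word, of as many
letters as there are pairs of strands that do not cross. The equation is stated for the classes of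
geometric braids, where the uniqueness of the half-turn is available. -/
theorem IsPermutationBraid.exists_mul_eq {n : ℕ} {X : BraidGroup n} (hX : IsPermutationBraid X) :
    ∃ y : List (Fin (n - 1)), exponentSum X + y.length = n.choose 2 ∧
      braidHom n X * braidHom n (y.map sigma).prod = braidHom n (garside n) := by
  obtain ⟨w, hw, rfl⟩ := hX
  obtain ⟨y, h1, h2⟩ := exists_append_revPerm (ascWord_one_of_nodup hw)
  refine ⟨y, ?_, ?_⟩
  · rw [exponentSum_prod, ← length_of_ascWord_revPerm h1 h2, List.length_append, Nat.cast_add]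
  · rw [braidHom_garside, ← mk_posWord_of_revPerm h1 h2, List.map_append, List.prod_append,
      map_mul]

theorem ambientIsotopic_of_isPermutationBraid {d : ℕ} (hd : 2 ≤ d) {X : BraidGroup d}
    (hX : IsPermutationBraid X) (he : exponentSum X = numN d) {L : Set RP3}
    (h : IsProjectiveClosure X L) (hL : IsKnot L) : AmbientIsotopic L (Tproj d (d - 2)) := by
  obtain ⟨y, hy, hXy⟩ := hX.exists_mul_eq
  have hl : y.length = d - 1 := by
    have := numN_add hd
    omega
  refine ambientIsotopic_Tproj_of_closes_inv hd hl ?_ hL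
  -- `X Δ⁻¹ = X Y⁻¹ X⁻¹`
  have hc := (closes_of_isProjectiveClosure h).conj (braidHom d X)⁻¹
  rw [map_mul, map_inv, ← hXy] at hc
  convert hc using 1
  group

theorem ambientIsotopic_of_eq_garside_mul {n : ℕ} {A : BraidGroup n} (hA : A ∈ positiveBraids n)
    (he : exponentSum (garside n * A) = (numN (n + 2) : ℤ) - 1) {L : Set RP3}
    (h : IsProjectiveClosure (garside n * A) L) (hL : IsKnot L) :
    AmbientIsotopic L (Tproj (n + 2) n) := by
  obtain ⟨y, rfl⟩ := exists_eq_prod_of_mem_positiveBraids hA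
  have hN : numN (n + 2) = n + n.choose 2 := by
    rw [numN_eq_choose, show n + 2 - 1 = n + 1 from rfl, Nat.choose_succ_succ' n 1,
      Nat.choose_one_right]
  rw [exponentSum_mul, garside_eq, exponentSum_prod, exponentSum_prod, length_garsideWord] at he
  -- `n = 0` is excluded by the exponent sum, which would be `-1`
  refine ambientIsotopic_Tproj_of_closes (y := y) (by omega) (by omega) ?_ hL
  have hc := (closes_of_isProjectiveClosure h).conj (braidHom n (garside n))⁻¹
  rw [map_mul, map_mul, map_inv] at hc
  convert hc using 1
  group

end ProjBraid

end

theorem theorem4p4 (d : ℕ) (hd : 2 ≤ d) :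
    (∀ X : ProjBraid.BraidGroup d, ProjBraid.IsPermutationBraid X →
      ProjBraid.exponentSum X = (ProjBraid.numN d : ℤ) →
      ∀ L : Set ProjBraid.RP3, ProjBraid.IsProjectiveClosure X L →
        (ProjBraid.IsKnot L ↔
          (ProjBraid.perm d (X * ProjBraid.garside d)).IsCycle ∧
          (ProjBraid.perm d (X * ProjBraid.garside d)).support.card = d) ∧
        (ProjBraid.IsKnot L → ProjBraid.AmbientIsotopic L (ProjBraid.Tproj d (d - 2)))) ∧
    (∀ X : ProjBraid.BraidGroup (d - 2),
      ProjBraid.exponentSum X = (ProjBraid.numN d : ℤ) - 1 →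
      (∃ A ∈ ProjBraid.positiveBraids (d - 2), X = ProjBraid.garside (d - 2) * A) →
      ∀ L : Set ProjBraid.RP3, ProjBraid.IsProjectiveClosure X L →
        ProjBraid.IsKnot L → ProjBraid.AmbientIsotopic L (ProjBraid.Tproj d (d - 2))) := by
  refine ⟨fun X hX he L hL =>
    ⟨ProjBraid.isKnot_iff_of_isProjectiveClosure hd hL,
      ProjBraid.ambientIsotopic_of_isPermutationBraid hd hX he hL⟩, ?_⟩
  obtain ⟨n, rfl⟩ : ∃ n, d = n + 2 := ⟨d - 2, by omega⟩
  rintro X he ⟨A, hA, rfl⟩ L hL hknot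
  exact ProjBraid.ambientIsotopic_of_eq_garside_mul hA he hL hknot
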